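/- Fix $A>0$, $\omega\in\mathbb R$, $L\in\mathbb N$. In spherical coordinates $(r,\theta,\phi)$ of $\mathbb R^3$ let $D=\{0\le r\le A,\ 0\le\theta\le\pi,\ \phi=0\}$ be the half-disc, with the measure $d\mu_D=r^2\,dr\,d(\cos\theta)$ (that is, $r^2\sin\theta\,dr\,d\theta$), and let $\alpha\in L^\infty(D,d\mu_D)$ be real valued. Let $\Pi_L$ be the orthogonal projector of $L^2(\mathbb R^3)$ onto the closed subspace generated by the functions $\chi(r)Y_l^m(\theta,\phi)$ with $l\le L$, $|m|\le l$, and let $J=-i(x\partial_y-y\partial_x)$. Let $H^L_\omega=-\Delta-\omega J\Pi_L$ with domain $H^2(\mathbb R^3)$, and let $F_{\omega,L}$ be the closed semibounded quadratic form associated with $H^L_\omega$ (the closure of $\Psi\mapsto(\Psi,H^L_\omega\Psi)$). Consider the quadratic form $$\mathcal F_{\alpha,L}(\Psi)=F_{\omega,L}(\Psi)-\int_D\alpha\,\big|\Psi|_D\big|^2\,d\mu_D ,$$ defined for those $\Psi\in L^2(\mathbb R^3)$ that are in the domain of $F_{\omega,L}$ and have a trace $\Psi|_D\in L^2(D,d\mu_D)$,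 the trace being the continuous extension of the restriction to $D$ from Schwartz functions, with respect to the norm of $H^1(\mathbb R^3)$. For $z\in\mathbb C\setminus\mathbb R$ and $\xi\in L^2(D,d\mu_D)$ let $$\big(\tilde{\mathcal G}^L_z\xi\big)(x)=\int_D\mathcal G^L_z(x,x')\,\xi(x')\,d\mu_D(x'),\qquad \mathcal G^L_z(x,x')=\int_0^\infty dk\sum_{l=0}^L\sum_{m=-l}^l\frac{\varphi_{klm}(x')^*\,\varphi_{klm}(x)}{k^2-m\omega-z},$$ where $\varphi_{klm}(x)=\sqrt{2k^2/\pi}\;j_l(kr)\,Y_l^m(\theta,\phi)$ and $j_l$ is the spherical Bessel function. Then $\mathcal F_{\alpha,L}$ is a well-defined quadratic form, the diagonal of a Hermitian sesquilinear form on a linear subspace of $L^2(\mathbb R^3)$; it is bounded from below and closed; and for every $z\in\mathbb C\setminus\mathbb R$ its domain is $$\mathcal D(\mathcal F_{\alpha,L})=\big\{\Psi\in L^2(\mathbb R^3)\;:\;\exists\,\xi\in L^2(D,d\mu_D),\ \Psi-\tilde{\mathcal G}^L_z\xi\in H^1(\mathbb R^3)\big\}.$$ -/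

import Mathlib

open MeasureTheory Filter Topology Set
open scoped ENNReal SchwartzMap LineDeriv Laplacian

noncomputable section

namespace RotatingBlade

/-- Three-dimensional Euclidean space; the coordinates `0, 1, 2` are `x, y, z`. -/
abbrev Space : Type := EuclideanSpace ℝ (Fin 3)

/-- The Hilbert space `L²(ℝ³)`. -/
abbrev L2 : Type := Lp ℂ 2 (volume : Measure Space)

/-! ### Hermitian forms on a Hilbert space -/

section Forms

variable (E : Type*) [NormedAddCommGroup E] [InnerProductSpace ℂ E]

/-- A Hermitian sesquilinear form defined on a linear subspace of `E`. -/
structure HermitianForm where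
  /-- the domain of the form -/
  dom : Submodule ℂ E
  /-- the form, conjugate linear in the first and linear in the second argument -/
  form : dom →ₗ⋆[ℂ] dom →ₗ[ℂ] ℂ
  hermitian : ∀ u v : dom, form v u = star (form u v)

variable {E}

/-- The quadratic form `u ↦ q(u, u)`, which is real valued because `q` is Hermitian. -/
def HermitianForm.quad (q : HermitianForm E) (u : q.dom) : ℝ := (q.form u u).re

/-- Boundedness from below. -/
def HermitianForm.IsBoundedBelow (q : HermitianForm E) : Prop :=
  ∃ c : ℝ, ∀ u : q.dom, c * ‖(u : E)‖ ^ 2 ≤ q.quad u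

/-- Closedness of a form: whenever `uₙ ∈ dom q`, `uₙ → Ψ` in `E` and `q(uₙ - uₘ) → 0`, then
`Ψ ∈ dom q` and `q(uₙ - Ψ) → 0`. -/
def HermitianForm.IsClosed (q : HermitianForm E) : Prop :=
  ∀ (u : ℕ → q.dom) (Ψ : E),
    Tendsto (fun n => (u n : E)) atTop (𝓝 Ψ) →
    Tendsto (fun p : ℕ × ℕ => q.quad (u p.1 - u p.2)) atTop (𝓝 0) →
    ∃ h : Ψ ∈ q.dom, Tendsto (fun n => q.quad (u n - ⟨Ψ, h⟩)) atTop (𝓝 0)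

/-- Let `T` be the graph of a symmetric operator on `E` that is bounded from below. The quadratic
form associated with `T` is the closure of `u ↦ ⟪u, T u⟫`: the vector `Ψ` is in its domain, and `v`
is its value at `Ψ`, if there are `uₙ` in the domain of `T` with `uₙ → Ψ`,
`⟪uₙ - uₘ, T (uₙ - uₘ)⟫ → 0` and `⟪uₙ, T uₙ⟫ → v`. -/
def IsAssociatedFormValue (T : E → E → Prop) (Ψ : E) (v : ℝ) : Prop :=
  ∃ u w : ℕ → E, (∀ n, T (u n) (w n)) ∧ Tendsto u atTop (𝓝 Ψ) ∧
    Tendsto (fun p : ℕ × ℕ => inner ℂ (u p.1 - u p.2) (w p.1 - w p.2)) atTop (𝓝 0) ∧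
    Tendsto (fun n => inner ℂ (u n) (w n)) atTop (𝓝 (v : ℂ))

end Forms

/-! ### Spherical waves -/

/-- The spherical Bessel function of order `l`, by Poisson's integral
`j_l(r) = r^l / (2^{l+1} l!) ∫_{-1}^1 cos(r t) (1 - t²)^l dt`. -/
def sphericalBessel (l : ℕ) (r : ℝ) : ℝ :=
  r ^ l / (2 ^ (l + 1) * l.factorial) * ∫ t in (-1 : ℝ)..1, Real.cos (r * t) * (1 - t ^ 2) ^ l

/-- The spherical harmonic `Y_l^m`, `0 ≤ m ≤ l`, as a function of `x ≠ 0` (homogeneous of degree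
`0`), i.e. `√((2l+1)/(4π) · (l-m)!/(l+m)!) P_l^m(cos θ) e^{imφ}` with
`P_l^m(t) = (-1)^m (1-t²)^{m/2} (d/dt)^{l+m} (t²-1)^l / (2^l l!)`; here `cos θ = x₂/|x|` and
`(sin θ)^m e^{imφ} = ((x₀ + i x₁)/|x|)^m`. -/
def sphericalHarmonicNat (l m : ℕ) (x : Space) : ℂ :=
  (-1) ^ m *
    (√((2 * l + 1) / (4 * Real.pi) * ((l - m).factorial / (l + m).factorial)) : ℝ) *
    (((x 0 : ℂ) + Complex.I * (x 1 : ℂ)) / (‖x‖ : ℂ)) ^ m *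
    ((((Polynomial.derivative^[l + m] ((Polynomial.X ^ 2 - 1 : Polynomial ℝ) ^ l)).eval (x 2 / ‖x‖))
      / (2 ^ l * l.factorial) : ℝ) : ℂ)

/-- The spherical harmonic `Y_l^m` for `-l ≤ m ≤ l`; `Y_l^{-m} = (-1)^m (Y_l^m)^*`. -/
def sphericalHarmonic (l : ℕ) (m : ℤ) (x : Space) : ℂ :=
  if 0 ≤ m then sphericalHarmonicNat l m.natAbs x
  else (-1) ^ m.natAbs * star (sphericalHarmonicNat l m.natAbs x)

/-- The spherical wave `φ_{klm}(x) = √(2k²/π) j_l(k|x|) Y_l^m(x/|x|)`. -/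
def sphericalWave (k : ℝ) (l : ℕ) (m : ℤ) (x : Space) : ℂ :=
  (√(2 * k ^ 2 / Real.pi) * sphericalBessel l (k * ‖x‖) : ℝ) * sphericalHarmonic l m x

/-- The closed subspace of `L²(ℝ³)` generated by the functions `χ(r) Y_l^m(θ, φ)` with `l ≤ L`. -/
abbrev lowAngularMomentum (L : ℕ) : Submodule ℂ L2 :=
  (Submodule.span ℂ {Ψ : L2 | ∃ l : ℕ, l ≤ L ∧ ∃ m ∈ Finset.Icc (-(l : ℤ)) l, ∃ χ : ℝ → ℂ,
    (Ψ : Space → ℂ) =ᵐ[volume] fun x => χ ‖x‖ * sphericalHarmonic l m x}).topologicalClosure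

/-- The cutoff `Π_L`: the orthogonal projector onto the angular momenta `l ≤ L`. -/
def cutoffProjector (L : ℕ) : L2 →L[ℂ] L2 := (lowAngularMomentum L).starProjection

/-! ### The cutoff Hamiltonian without the blade -/

/-- The `i`-th vector of the standard basis of `ℝ³`. -/
abbrev e (i : Fin 3) : Space := EuclideanSpace.single i 1

/-- The third component `J = -i (x ∂_y - y ∂_x)` of the angular momentum, acting on tempered
distributions. -/
def angularMomentum (T : 𝓢'(Space, ℂ)) : 𝓢'(Space, ℂ) :=
  (-Complex.I) •
    (TemperedDistribution.smulLeftCLM ℂ (fun x : Space => ((x 0 : ℝ) : ℂ)) (∂_{e 1} T) -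
      TemperedDistribution.smulLeftCLM ℂ (fun x : Space => ((x 1 : ℝ) : ℂ)) (∂_{e 0} T))

/-- `Ψ ∈ L²(ℝ³)` belongs to the Sobolev space `H^s(ℝ³)`. -/
def MemH (s : ℝ) (Ψ : L2) : Prop := TemperedDistribution.MemSobolev s 2 (Ψ : 𝓢'(Space, ℂ))

/-- The graph of the cutoff Hamiltonian `H_ω^L = -Δ - ω J Π_L` with domain `H²(ℝ³)`: `Ψ` is in the
domain and is mapped to `Φ`. -/
def cutoffHamiltonian (ω : ℝ) (L : ℕ) (Ψ Φ : L2) : Prop :=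
  MemH 2 Ψ ∧
    (Φ : 𝓢'(Space, ℂ)) =
      -Δ (Ψ : 𝓢'(Space, ℂ)) - (ω : ℂ) • angularMomentum (cutoffProjector L Ψ : 𝓢'(Space, ℂ))

/-! ### The blade -/

/-- The point of the half-plane `φ = 0` with spherical coordinates `(r, θ)`. -/
def bladePoint (p : ℝ × ℝ) : Space := !₂[p.1 * Real.sin p.2, 0, p.1 * Real.cos p.2]

/-- The measure `dμ_D = r² dr d(cos θ) = r² sin θ dr dθ` on the half-disc
`D = {φ = 0, 0 ≤ r ≤ A, 0 ≤ θ ≤ π}`, regarded as a measure on `ℝ³` carried by `D`. -/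
def bladeMeasure (A : ℝ) : Measure Space :=
  (((volume : Measure (ℝ × ℝ)).restrict (Icc 0 A ×ˢ Icc 0 Real.pi)).withDensity
    fun p => ENNReal.ofReal (p.1 ^ 2 * Real.sin p.2)).map bladePoint

/-- The space `L²(D, dμ_D)`. -/
abbrev BladeL2 (A : ℝ) : Type := Lp ℂ 2 (bladeMeasure A)

/-- `τ` is the trace `Ψ|_D` of `Ψ ∈ H¹(ℝ³)` on the blade: there are Schwartz functions that converge
to `Ψ` in `H¹(ℝ³)` and whose restrictions to `D` converge to `τ` in `L²(D, dμ_D)`. -/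
def IsBladeTrace (A : ℝ) (Ψ : L2) (τ : BladeL2 A) : Prop :=
  ∃ f : ℕ → 𝓢(Space, ℂ),
    Tendsto (fun n => (f n).toLp 2 volume) atTop (𝓝 Ψ) ∧
    (∀ i : Fin 3, ∃ v : L2, (v : 𝓢'(Space, ℂ)) = ∂_{e i} (Ψ : 𝓢'(Space, ℂ)) ∧
      Tendsto (fun n => (∂_{e i} (f n) : 𝓢(Space, ℂ)).toLp 2 volume) atTop (𝓝 v)) ∧
    Tendsto (fun n => eLpNorm (fun x => f n x - τ x) 2 (bladeMeasure A)) atTop (𝓝 0)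

/-- The form `F_{α,L}(Ψ) = F_{ω,L}(Ψ) - ∫_D α |Ψ|_D|² dμ_D`, where `F_{ω,L}` is the form associated
with `H_ω^L`: the right-hand side makes sense for `Ψ`, and `v` is its value. -/
def IsBladeFormValue (A ω : ℝ) (L : ℕ) (α : Space → ℝ) (Ψ : L2) (v : ℝ) : Prop :=
  ∃ (w : ℝ) (τ : BladeL2 A), IsAssociatedFormValue (cutoffHamiltonian ω L) Ψ w ∧
    IsBladeTrace A Ψ τ ∧ v = w - ∫ x, α x * ‖τ x‖ ^ 2 ∂(bladeMeasure A)

/-- The cutoff Green's function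
`G_z^L(x, x') = ∫_0^∞ dk ∑_{l ≤ L} ∑_{|m| ≤ l} φ_{klm}(x')^* φ_{klm}(x) / (k² - m ω - z)`. -/
def cutoffGreen (ω : ℝ) (L : ℕ) (z : ℂ) (x x' : Space) : ℂ :=
  ∫ k in Ioi (0 : ℝ), ∑ l ∈ Finset.range (L + 1), ∑ m ∈ Finset.Icc (-(l : ℤ)) l,
    star (sphericalWave k l m x') * sphericalWave k l m x / ((k : ℂ) ^ 2 - m * ω - z)

/-- The potential `(G̃_z^L ξ)(x) = ∫_D G_z^L(x, x') ξ(x') dμ_D(x')` of a density `ξ` on the blade. -/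
def bladePotential (A ω : ℝ) (L : ℕ) (z : ℂ) (ξ : BladeL2 A) (x : Space) : ℂ :=
  ∫ x', cutoffGreen ω L z x x' * ξ x' ∂(bladeMeasure A)

end RotatingBlade

end

open RotatingBlade

noncomputable section

namespace RotatingBlade

open FourierTransform

/-! ### The Fourier side of `L²` and Sobolev spaces -/

/-! The form domain is exactly `H¹`, and both descriptions of the form reduce to that. The operator
`J Π_L` is bounded: every generator of the range of `Π_L` is multiplied by a phase `e^{imt}` with
`|m| ≤ L` under rotation about the third axis, so on that range `J` is a finite sum of integers
times orthogonal projectors (`angularMomentum_cutoffProjector`), and it is symmetric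
(`inner_cutoffAngular`). Hence `F_{ω,L}(u) = ‖∇u‖² - ω ⟪u, J Π_L u⟫` on all of `H¹`
(`IsAssociatedFormValue.exists_eq`, `isAssociatedFormValue_of_mem`).

The blade lies in the plane `y = 0`, and its measure is at most `A` times planar Lebesgue measure.
The fundamental theorem of calculus in the direction `y` and Cauchy–Schwarz therefore give `‖u|_D‖²
≤ 2A ‖u‖ ‖∂_y u‖` (`norm_bladeTrace_sq_le`). So every `u` in `H¹` has a trace, and the blade term is
bounded by any small multiple of `‖∇u‖²` plus a multiple of `‖u‖²`. The resulting Gårding inequality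
`exists_garding` yields both the lower bound and closedness, the latter because `H¹` is complete.

For the last claim, `ξ = 0` shows that `H¹` is contained in the stated set; the converse needs the
potential of any `ξ` to lie in `H¹` (`exists_mem_sobolevOne_bladePotential`). By Fubini the
potential is a finite sum of superpositions of `φ_{klm}` with amplitude `g(k) = c(k) / (k² - mω -
z)`. The coefficient `c` is bounded, since `|φ_{klm}(x)| ≤ C/|x|` uniformly in `k` and `1/|x|` is
square integrable on the blade; thus `g(k) = O((1+k²)⁻¹)`. The Fourier transform of such a
superposition is a constant times `|p|⁻¹ g(2π|p|) Y_l^m(p)`, and after multiplication by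
`(1+|p|²)^{1/2}` it is still square integrable in three dimensions.

That transform comes from a Bochner–Hecke formula for powers of null linear forms
(`integral_radial_mul_cdot_pow`), since `r^l Y_l^m` is a combination of such powers:
`coeff_nullPower_eq` reads it off a generating polynomial. The integral over all `k` is reached from
momentum shells by dominated convergence (`integral_mul_waveSuperposition`). -/

/-- The embedding of `L²` into tempered distributions, as a continuous linear map. -/
abbrev toDist : L2 →L[ℂ] 𝓢'(Space, ℂ) := Lp.toTemperedDistributionCLM ℂ volume 2

theorem toDist_injective : Function.Injective toDist := by
  have h := Lp.ker_toTemperedDistributionCLM_eq_bot (F := ℂ) (μ := (volume : Measure Space)) (p := 2)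
  exact LinearMap.ker_eq_bot.mp h

theorem coe_eq_coe_iff {u v : L2} : (u : 𝓢'(Space, ℂ)) = v ↔ u = v :=
  ⟨fun h => toDist_injective h, fun h => by rw [h]⟩

/-- Both sides are locally integrable, so testing against smooth functions of compact support
determines them almost everywhere. This turns every identity on the Fourier side into a pointwise
one. -/
theorem coe_eq_smulLeftCLM_iff {g : Space → ℂ} (hg : g.HasTemperateGrowth) (f h : L2) :
    (h : 𝓢'(Space, ℂ)) = TemperedDistribution.smulLeftCLM ℂ g (f : 𝓢'(Space, ℂ)) ↔
      (h : Space → ℂ) =ᵐ[volume] fun p => g p * f p := by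
  constructor
  · intro H
    apply ae_eq_of_integral_contDiff_smul_eq
    · exact (Lp.memLp h).locallyIntegrable (by norm_num)
    · have := (Lp.memLp f).locallyIntegrable (by norm_num)
      rw [← locallyIntegrableOn_univ] at this ⊢
      exact this.continuousOn_mul hg.1.continuous.continuousOn isOpen_univ.isLocallyClosed
    · intro φ hφ hc
      have hg₁ : HasCompactSupport (Complex.ofRealCLM ∘ φ) := hc.comp_left rfl
      have hg₂ : ContDiff ℝ ((⊤ : ℕ∞) : WithTop ℕ∞) (Complex.ofRealCLM ∘ φ) := by fun_prop
      have h2 := DFunLike.congr_fun H (hg₁.toSchwartzMap hg₂)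
      rw [Lp.toTemperedDistribution_apply, TemperedDistribution.smulLeftCLM_apply_apply,
        Lp.toTemperedDistribution_apply] at h2
      simp only [SchwartzMap.smulLeftCLM_apply_apply hg] at h2
      simp only [HasCompactSupport.toSchwartzMap_toFun, Function.comp, smul_eq_mul,
        Complex.ofRealCLM_apply, Complex.real_smul] at h2 ⊢
      rw [h2]
      congr 1 with x
      ring
  · intro H
    ext φ
    rw [Lp.toTemperedDistribution_apply, TemperedDistribution.smulLeftCLM_apply_apply,
      Lp.toTemperedDistribution_apply]
    apply integral_congr_ae
    filter_upwards [H] with x hx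
    rw [SchwartzMap.smulLeftCLM_apply_apply hg, hx]
    simp only [smul_eq_mul]; ring

theorem exists_coe_eq_smulLeftCLM_iff {g : Space → ℂ} (hg : g.HasTemperateGrowth) (f : L2) :
    (∃ h : L2, TemperedDistribution.smulLeftCLM ℂ g (f : 𝓢'(Space, ℂ)) = h) ↔
      MemLp (fun p => g p * f p) 2 := by
  constructor
  · rintro ⟨h, hh⟩
    exact (memLp_congr_ae ((coe_eq_smulLeftCLM_iff hg f h).mp hh.symm)).mp (Lp.memLp h)
  · intro h
    exact ⟨h.toLp _, ((coe_eq_smulLeftCLM_iff hg f _).mpr h.coeFn_toLp).symm⟩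

theorem memH_iff (s : ℝ) (u : L2) :
    MemH s u ↔ MemLp (fun p => (((1 + ‖p‖ ^ 2) ^ (s / 2) : ℝ) : ℂ) * (𝓕 u : L2) p) 2 := by
  rw [MemH, TemperedDistribution.memSobolev_iff_exists_smulLeftCLM_fourier,
    Lp.fourier_toTemperedDistribution_eq]
  exact exists_coe_eq_smulLeftCLM_iff (by fun_prop) _

/-- `v ∈ L²` is the distributional partial derivative `∂_i u`. -/
def IsWeakDeriv (i : Fin 3) (u v : L2) : Prop :=
  (v : 𝓢'(Space, ℂ)) = ∂_{e i} (u : 𝓢'(Space, ℂ))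

theorem IsWeakDeriv.unique {i : Fin 3} {u v w : L2} (hv : IsWeakDeriv i u v)
    (hw : IsWeakDeriv i u w) : v = w :=
  coe_eq_coe_iff.mp (hv.trans hw.symm)

theorem IsWeakDeriv.add {i : Fin 3} {u v u' v' : L2} (h : IsWeakDeriv i u v)
    (h' : IsWeakDeriv i u' v') : IsWeakDeriv i (u + u') (v + v') := by
  change toDist (v + v') = ∂_{e i} (toDist (u + u'))
  rw [map_add, map_add, LineDeriv.lineDerivOp_add]
  exact congrArg₂ _ h h'

theorem IsWeakDeriv.smul {i : Fin 3} {u v : L2} (c : ℂ) (h : IsWeakDeriv i u v) :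
    IsWeakDeriv i (c • u) (c • v) := by
  change toDist (c • v) = ∂_{e i} (toDist (c • u))
  rw [map_smul, map_smul, LineDeriv.lineDerivOp_smul]
  exact congrArg _ h

theorem IsWeakDeriv.sub {i : Fin 3} {u v u' v' : L2} (h : IsWeakDeriv i u v)
    (h' : IsWeakDeriv i u' v') : IsWeakDeriv i (u - u') (v - v') := by
  have := h.add (h'.smul (-1))
  simpa [sub_eq_add_neg] using this

/-- Differentiation is continuous on tempered distributions and `L²` embeds continuously, so the
graph of the weak derivative is closed. The completeness of `H¹` rests on this. -/
theorem IsWeakDeriv.of_tendsto {i : Fin 3} {u v : ℕ → L2} {u₀ v₀ : L2}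
    (h : ∀ n, IsWeakDeriv i (u n) (v n)) (hu : Tendsto u atTop (𝓝 u₀))
    (hv : Tendsto v atTop (𝓝 v₀)) : IsWeakDeriv i u₀ v₀ := by
  have h1 : Tendsto (fun n => toDist (v n)) atTop (𝓝 (toDist v₀)) :=
    (toDist.continuous.tendsto _).comp hv
  have h2 : Tendsto (fun n => LineDeriv.lineDerivOpCLM ℂ 𝓢'(Space, ℂ) (e i) (toDist (u n))) atTop
      (𝓝 (LineDeriv.lineDerivOpCLM ℂ 𝓢'(Space, ℂ) (e i) (toDist u₀))) :=
    (((LineDeriv.lineDerivOpCLM ℂ 𝓢'(Space, ℂ) (e i)).continuous.comp toDist.continuous).tendsto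
      _).comp hu
  exact tendsto_nhds_unique h1 (h2.congr fun n => (h n).symm)

theorem isWeakDeriv_toLp (i : Fin 3) (f : 𝓢(Space, ℂ)) :
    IsWeakDeriv i (f.toLp 2 volume) ((∂_{e i} f : 𝓢(Space, ℂ)).toLp 2 volume) := by
  rw [IsWeakDeriv, Lp.toTemperedDistribution_toLp_eq, Lp.toTemperedDistribution_toLp_eq,
    TemperedDistribution.lineDerivOp_toTemperedDistributionCLM_eq]

theorem fourier_coe_injective {S T : 𝓢'(Space, ℂ)} : S = T ↔ 𝓕 S = 𝓕 T := by
  constructor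
  · rintro rfl; rfl
  · intro h
    have h' := congrArg (fun U : 𝓢'(Space, ℂ) => (𝓕⁻ U : 𝓢'(Space, ℂ))) h
    simpa using h'

theorem hasTemperateGrowth_coord (i : Fin 3) :
    (fun p : Space => (p i : ℂ)).HasTemperateGrowth :=
  (Complex.ofRealCLM ∘L (EuclideanSpace.proj i : Space →L[ℝ] ℝ)).hasTemperateGrowth

theorem isWeakDeriv_iff (i : Fin 3) (u v : L2) :
    IsWeakDeriv i u v ↔ ((𝓕 v : L2) : Space → ℂ) =ᵐ[volume]
      fun p => 2 * Real.pi * Complex.I * (p i : ℂ) * (𝓕 u : L2) p := by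
  have hg : (fun p : Space => 2 * Real.pi * Complex.I * (p i : ℂ)).HasTemperateGrowth := by
    have := hasTemperateGrowth_coord i
    fun_prop
  rw [← coe_eq_smulLeftCLM_iff hg, IsWeakDeriv, fourier_coe_injective,
    Lp.fourier_toTemperedDistribution_eq, TemperedDistribution.fourier_lineDerivOp_eq,
    Lp.fourier_toTemperedDistribution_eq]
  have h2 : (fun p : Space => ((inner ℝ p (e i) : ℝ) : ℂ)).HasTemperateGrowth := by fun_prop
  have : (fun p : Space => 2 * Real.pi * Complex.I * (p i : ℂ)) =
      (2 * Real.pi * Complex.I) • (fun p : Space => ((inner ℝ p (e i) : ℝ) : ℂ)) := by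
    ext p
    simp [EuclideanSpace.inner_single_right]
  rw [this, TemperedDistribution.smulLeftCLM_smul h2]
  rfl

/-- Integration by parts through Plancherel: the multiplier `2πi p_i` is purely imaginary, so
conjugation flips its sign. -/
theorem IsWeakDeriv.inner_eq_neg {i : Fin 3} {u v a b : L2} (h : IsWeakDeriv i u v)
    (h' : IsWeakDeriv i a b) : inner ℂ u b = -inner ℂ v a := by
  rw [← Lp.inner_fourier_eq u b, ← Lp.inner_fourier_eq v a, L2.inner_def, L2.inner_def,
    ← integral_neg]
  apply integral_congr_ae
  filter_upwards [(isWeakDeriv_iff i u v).mp h, (isWeakDeriv_iff i a b).mp h'] with p h1 h2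
  rw [h1, h2]
  simp only [RCLike.inner_apply, map_mul, Complex.conj_I, Complex.conj_ofReal, map_ofNat]
  ring

theorem one_le_japanese (p : Space) : 1 ≤ (1 + ‖p‖ ^ 2) ^ ((1 : ℝ) / 2) :=
  Real.one_le_rpow (by nlinarith [sq_nonneg ‖p‖]) (by norm_num)

theorem abs_coord_le_norm (p : Space) (i : Fin 3) : |p i| ≤ ‖p‖ := by
  simpa using PiLp.norm_apply_le p i

theorem norm_le_japanese (p : Space) : ‖p‖ ≤ (1 + ‖p‖ ^ 2) ^ ((1 : ℝ) / 2) := by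
  rw [← Real.sqrt_eq_rpow]
  exact Real.le_sqrt_of_sq_le (by linarith)

theorem japanese_le (p : Space) : (1 + ‖p‖ ^ 2) ^ ((1 : ℝ) / 2) ≤ 1 + ∑ i, |p i| := by
  rw [← Real.sqrt_eq_rpow]
  apply Real.sqrt_le_iff.mpr
  refine ⟨by positivity, ?_⟩
  rw [EuclideanSpace.norm_sq_eq]
  simp only [Fin.sum_univ_three, Real.norm_eq_abs]
  nlinarith [abs_nonneg (p 0), abs_nonneg (p 1), abs_nonneg (p 2),
    mul_nonneg (abs_nonneg (p 0)) (abs_nonneg (p 1)),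
    mul_nonneg (abs_nonneg (p 0)) (abs_nonneg (p 2)),
    mul_nonneg (abs_nonneg (p 1)) (abs_nonneg (p 2))]

/-- The weight `(1+|p|²)^{1/2}` dominates each `|p_i|` and is at most `1 + ∑ |p_i|`, so weighted
integrability of the transform and integrability of all derivative symbols are equivalent. -/
theorem memH_one_iff (u : L2) : MemH 1 u ↔ ∀ i, ∃ v, IsWeakDeriv i u v := by
  have hm : AEStronglyMeasurable ((𝓕 u : L2) : Space → ℂ) volume := Lp.aestronglyMeasurable _
  rw [memH_iff]
  constructor
  · intro h i
    have h2 : MemLp (fun p : Space => 2 * Real.pi * Complex.I * (p i : ℂ) * (𝓕 u : L2) p) 2 := by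
      refine (h.const_mul (2 * Real.pi : ℂ)).mono ?_ ?_
      · have := (hasTemperateGrowth_coord i).1.continuous
        exact ((continuous_const.mul this).aestronglyMeasurable).mul hm
      · filter_upwards with p
        simp only [norm_mul, Complex.norm_I, one_mul, Complex.norm_real, mul_assoc]
        gcongr
        exact ((abs_coord_le_norm p i).trans (norm_le_japanese p)).trans (le_abs_self _)
    refine ⟨𝓕⁻ (h2.toLp _), ?_⟩
    rw [isWeakDeriv_iff, fourier_fourierInv_eq]
    exact h2.coeFn_toLp
  · intro h
    choose v hv using h
    have h0 : MemLp (fun p : Space => ‖(𝓕 u : L2) p‖ + ∑ i, ‖(𝓕 (v i) : L2) p‖) 2 :=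
      (Lp.memLp _).norm.add (memLp_finsetSum _ fun i _ => (Lp.memLp _).norm)
    refine h0.mono ?_ ?_
    · have : Continuous fun p : Space => (((1 + ‖p‖ ^ 2) ^ ((1 : ℝ) / 2) : ℝ) : ℂ) := by
        refine Complex.continuous_ofReal.comp (Continuous.rpow_const (by fun_prop) ?_)
        intro p; right; norm_num
      exact this.aestronglyMeasurable.mul hm
    · have h1 : ∀ᵐ p : Space, ∀ i, (𝓕 (v i) : L2) p =
          2 * Real.pi * Complex.I * (p i : ℂ) * (𝓕 u : L2) p :=
        ae_all_iff.mpr fun i => (isWeakDeriv_iff i u (v i)).mp (hv i)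
      filter_upwards [h1] with p hp
      have e1 : ∀ i, |p i| * ‖(𝓕 u : L2) p‖ ≤ ‖(𝓕 (v i) : L2) p‖ := by
        intro i
        rw [hp i]
        simp only [norm_mul, Complex.norm_I, mul_one, Complex.norm_real, Real.norm_eq_abs,
          Complex.norm_ofNat, abs_of_pos Real.pi_pos]
        gcongr
        have : 1 ≤ 2 * Real.pi := by linarith [Real.pi_gt_three]
        exact le_mul_of_one_le_left (abs_nonneg _) this
      rw [norm_mul, Complex.norm_real, Real.norm_of_nonneg (by positivity),
        Real.norm_of_nonneg (by positivity)]
      calc _ ≤ (1 + ∑ i, |p i|) * ‖(𝓕 u : L2) p‖ := by gcongr; exact japanese_le p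
        _ = ‖(𝓕 u : L2) p‖ + ∑ i, |p i| * ‖(𝓕 u : L2) p‖ := by rw [add_mul, one_mul, Finset.sum_mul]
        _ ≤ _ := by gcongr with i; exact e1 i

theorem norm_le_of_fourier_weight {u G : L2}
    (hG : (G : Space → ℂ) =ᵐ[volume] fun p => (((1 + ‖p‖ ^ 2) ^ ((1 : ℝ) / 2) : ℝ) : ℂ) *
      (𝓕 u : L2) p) : ‖u‖ ≤ ‖G‖ := by
  rw [← Lp.norm_fourier_eq u]
  apply Lp.norm_le_norm_of_ae_le
  filter_upwards [hG] with p hp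
  rw [hp, norm_mul, Complex.norm_real, Real.norm_of_nonneg (by positivity)]
  exact le_mul_of_one_le_left (norm_nonneg _) (one_le_japanese p)

theorem IsWeakDeriv.norm_le_of_fourier_weight {i : Fin 3} {u v G : L2} (h : IsWeakDeriv i u v)
    (hG : (G : Space → ℂ) =ᵐ[volume] fun p => (((1 + ‖p‖ ^ 2) ^ ((1 : ℝ) / 2) : ℝ) : ℂ) *
      (𝓕 u : L2) p) : ‖v‖ ≤ 2 * Real.pi * ‖G‖ := by
  rw [← Lp.norm_fourier_eq v]
  apply Lp.norm_le_mul_norm_of_ae_le_mul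
  filter_upwards [hG, (isWeakDeriv_iff i u v).mp h] with p hp h2
  rw [hp, h2]
  simp only [norm_mul, Complex.norm_I, one_mul, Complex.norm_real,
    Complex.norm_ofNat, Real.norm_of_nonneg Real.pi_pos.le, mul_assoc]
  gcongr
  exact ((abs_coord_le_norm p i).trans (norm_le_japanese p)).trans (le_abs_self _)

/-- Schwartz functions are dense in `H¹`. -/
theorem exists_schwartz_tendsto {u : L2} {v : Fin 3 → L2} (h : ∀ i, IsWeakDeriv i u (v i)) :
    ∃ f : ℕ → 𝓢(Space, ℂ), Tendsto (fun n => (f n).toLp 2 volume) atTop (𝓝 u) ∧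
      ∀ i, Tendsto (fun n => (∂_{e i} (f n) : 𝓢(Space, ℂ)).toLp 2 volume) atTop (𝓝 (v i)) := by
  have hu : MemH 1 u := (memH_one_iff u).mpr fun i => ⟨v i, h i⟩
  rw [memH_iff] at hu
  -- `G` is the weighted transform of `u`. Approximating `G` in `L²` by Schwartz functions, dividing
  -- by the weight and transforming back stays inside the Schwartz class, and `L²` convergence to
  -- `G` controls the `H¹` distance to `u`.
  set G : L2 := hu.toLp _ with hG
  have hd : DenseRange (SchwartzMap.toLpCLM ℂ (E := Space) ℂ 2 volume) :=
    SchwartzMap.denseRange_toLpCLM ENNReal.ofNat_ne_top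
  have hn : ∀ n : ℕ, ∃ g : 𝓢(Space, ℂ), ‖g.toLp 2 volume - G‖ < 1 / ((n : ℝ) + 1) := by
    intro n
    obtain ⟨g, hg⟩ := hd.exists_dist_lt G (ε := 1 / ((n : ℝ) + 1)) (by positivity)
    refine ⟨g, ?_⟩
    rw [← dist_eq_norm, dist_comm]
    exact hg
  choose g hg using hn
  have ht : Tendsto (fun n => ‖(g n).toLp 2 volume - G‖) atTop (𝓝 0) :=
    squeeze_zero (fun _ => norm_nonneg _) (fun n => (hg n).le) tendsto_one_div_add_atTop_nhds_zero_nat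
  have hw : (fun p : Space => (((1 + ‖p‖ ^ 2) ^ (-(1 : ℝ) / 2) : ℝ) : ℂ)).HasTemperateGrowth := by
    fun_prop
  let f : ℕ → 𝓢(Space, ℂ) := fun n => 𝓕⁻ (SchwartzMap.smulLeftCLM ℂ
    (fun p : Space => (((1 + ‖p‖ ^ 2) ^ (-(1 : ℝ) / 2) : ℝ) : ℂ)) (g n))
  have key : ∀ n, (((g n).toLp 2 volume - G : L2) : Space → ℂ) =ᵐ[volume]
      fun p => (((1 + ‖p‖ ^ 2) ^ ((1 : ℝ) / 2) : ℝ) : ℂ) *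
        (𝓕 ((f n).toLp 2 volume - u) : L2) p := by
    intro n
    have e1 : (𝓕 ((f n).toLp 2 volume - u) : L2) = (SchwartzMap.smulLeftCLM ℂ
        (fun p : Space => (((1 + ‖p‖ ^ 2) ^ (-(1 : ℝ) / 2) : ℝ) : ℂ)) (g n)).toLp 2 volume
          - 𝓕 u := by
      have : (𝓕 ((f n).toLp 2 volume - u) : L2) = 𝓕 ((f n).toLp 2 volume) - 𝓕 u :=
        (Lp.fourierTransformₗᵢ Space ℂ).map_sub _ _
      rw [this, SchwartzMap.toLp_fourier_eq]
      simp only [f, fourier_fourierInv_eq]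
    rw [e1]
    filter_upwards [Lp.coeFn_sub ((g n).toLp 2 volume) G, (g n).coeFn_toLp 2 volume,
      Lp.coeFn_sub ((SchwartzMap.smulLeftCLM ℂ
        (fun p : Space => (((1 + ‖p‖ ^ 2) ^ (-(1 : ℝ) / 2) : ℝ) : ℂ)) (g n)).toLp 2 volume) (𝓕 u),
      (SchwartzMap.smulLeftCLM ℂ (fun p : Space => (((1 + ‖p‖ ^ 2) ^ (-(1 : ℝ) / 2) : ℝ) : ℂ))
        (g n)).coeFn_toLp 2 volume, hu.coeFn_toLp] with p h1 h2 h3 h4 h5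
    rw [h1, h3, Pi.sub_apply, Pi.sub_apply, h2, h4, h5, SchwartzMap.smulLeftCLM_apply_apply hw,
      mul_sub, smul_eq_mul, ← mul_assoc, ← Complex.ofReal_mul, ← Real.rpow_add (by positivity)]
    norm_num
  refine ⟨f, ?_, fun i => ?_⟩
  · rw [tendsto_iff_norm_sub_tendsto_zero]
    exact squeeze_zero (fun _ => norm_nonneg _) (fun n => norm_le_of_fourier_weight (key n)) ht
  · rw [tendsto_iff_norm_sub_tendsto_zero]
    refine squeeze_zero (fun _ => norm_nonneg _) (fun n =>
      ((isWeakDeriv_toLp i (f n)).sub (h i)).norm_le_of_fourier_weight (key n)) ?_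
    simpa using ht.const_mul (2 * Real.pi)

/-- `⟪u, Δ u⟫ = -‖∇ u‖²` for `u ∈ H²`. -/
theorem inner_laplacian_eq {u y : L2} {v : Fin 3 → L2} (hu : MemH 2 u)
    (hy : (y : 𝓢'(Space, ℂ)) = Δ (u : 𝓢'(Space, ℂ))) (hv : ∀ i, IsWeakDeriv i u (v i)) :
    inner ℂ u y = -((∑ i, ‖v i‖ ^ 2 : ℝ) : ℂ) := by
  -- Second derivatives exist because `u` is in `H²`; the Laplacian is their sum, and each term is
  -- integrated by parts.
  have h1 : ∀ i, ∃ w, IsWeakDeriv i (v i) w := by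
    intro i
    have : MemH 1 (v i) := by
      have := TemperedDistribution.MemSobolev.lineDerivOp hu (m := e i)
      rw [← hv i] at this
      norm_num at this
      exact this
    exact (memH_one_iff _).mp this i
  choose w hw using h1
  have h2 : y = ∑ i, w i := by
    apply toDist_injective
    rw [map_sum]
    change (y : 𝓢'(Space, ℂ)) = _
    rw [hy, TemperedDistribution.laplacian_eq_sum (EuclideanSpace.basisFun (Fin 3) ℝ)]
    refine Finset.sum_congr rfl fun i _ => ?_
    rw [EuclideanSpace.basisFun_apply]
    change _ = (w i : 𝓢'(Space, ℂ))
    rw [hw i, hv i]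
  rw [h2, inner_sum, Complex.ofReal_sum, ← Finset.sum_neg_distrib]
  refine Finset.sum_congr rfl fun i _ => ?_
  rw [(hv i).inner_eq_neg (hw i), inner_self_eq_norm_sq_to_K]
  simp

/-! ### The trace on the blade -/

/-- Fubini's coordinates: the point whose `i`-th coordinate is `t`, the others being `a`, `b`. -/
def insertCoord (i : Fin 3) (q : ℝ × ℝ × ℝ) : Space :=
  WithLp.toLp 2 (i.insertNth q.1 ![q.2.1, q.2.2])

theorem measurePreserving_insertCoord (i : Fin 3) : MeasurePreserving (insertCoord i) := by
  have h1 := PiLp.volume_preserving_toLp (Fin 3)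
  have h2 := (volume_preserving_piFinSuccAbove (fun _ : Fin 3 => ℝ) i).symm
  have h3 := (MeasurePreserving.id (volume : Measure ℝ)).prod
    (volume_preserving_finTwoArrow ℝ).symm
  exact h1.comp (h2.comp h3)

theorem measurable_bladePoint : Measurable bladePoint := by
  have h : Continuous bladePoint := by
    unfold bladePoint
    refine (PiLp.continuous_toLp 2 _).comp ?_
    rw [continuous_pi_iff]
    intro i
    fin_cases i <;> simp <;> fun_prop
  exact h.measurable

theorem measurable_bladeDensity :
    Measurable fun p : ℝ × ℝ => ENNReal.ofReal (p.1 ^ 2 * Real.sin p.2) := by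
  fun_prop

theorem lintegral_bladeMeasure (A : ℝ) {F : Space → ℝ≥0∞} (hF : Measurable F) :
    ∫⁻ x, F x ∂(bladeMeasure A) = ∫⁻ p in Icc 0 A ×ˢ Icc 0 Real.pi,
      ENNReal.ofReal (p.1 ^ 2 * Real.sin p.2) * F (bladePoint p) := by
  rw [bladeMeasure, lintegral_map hF measurable_bladePoint]
  exact lintegral_withDensity_eq_lintegral_mul _ measurable_bladeDensity
    (hF.comp measurable_bladePoint)

/-- The density is at most `A²` on a compact rectangle. Finiteness is what puts restrictions of
Schwartz functions into `L²(D, dμ_D)`. -/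
instance isFiniteMeasure_bladeMeasure (A : ℝ) : IsFiniteMeasure (bladeMeasure A) := by
  constructor
  rw [← lintegral_one, lintegral_bladeMeasure A measurable_const]
  calc _ ≤ ∫⁻ p in Icc 0 A ×ˢ Icc 0 Real.pi, ENNReal.ofReal (A ^ 2) := by
        refine setLIntegral_mono (by fun_prop) fun p hp => ?_
        rw [mul_one]
        obtain ⟨⟨h1, h2⟩, -⟩ := hp
        apply ENNReal.ofReal_le_ofReal
        calc p.1 ^ 2 * Real.sin p.2 ≤ p.1 ^ 2 * 1 := by gcongr; exact Real.sin_le_one _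
          _ ≤ A ^ 2 := by rw [mul_one]; gcongr
    _ < ⊤ := by
        rw [setLIntegral_const]
        refine ENNReal.mul_lt_top ENNReal.ofReal_lt_top ?_
        exact (isCompact_Icc.prod isCompact_Icc).measure_lt_top

/-- The pair `(r, θ)` is a system of polar coordinates in the plane `y = 0`, with `z` as first and
`x` as second Cartesian coordinate, and `r² sin θ ≤ A r` on the half-disc, where `r` is the polar
Jacobian. -/
theorem lintegral_bladeMeasure_le (A : ℝ) {F : Space → ℝ≥0∞} (hF : Measurable F) :
    ∫⁻ x, F x ∂(bladeMeasure A) ≤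
      ENNReal.ofReal A * ∫⁻ q : ℝ × ℝ, F (insertCoord 1 (0, q.2, q.1)) := by
  rw [lintegral_bladeMeasure A hF, ← lintegral_comp_polarCoord_symm, ← lintegral_const_mul',
    ← lintegral_indicator (measurableSet_Icc.prod measurableSet_Icc),
    ← lintegral_indicator polarCoord.open_target.measurableSet]
  swap
  · exact ENNReal.ofReal_ne_top
  refine lintegral_mono fun p => ?_
  by_cases hp : p ∈ Icc 0 A ×ˢ Icc 0 Real.pi
  swap
  · rw [indicator_of_notMem hp]; exact zero_le
  rw [indicator_of_mem hp]
  obtain ⟨⟨h1, h2⟩, h3, h4⟩ := hp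
  by_cases ht : p ∈ polarCoord.target
  · rw [indicator_of_mem ht, smul_eq_mul, ← mul_assoc, ← ENNReal.ofReal_mul (h1.trans h2)]
    have : bladePoint p = insertCoord 1 (0, (polarCoord.symm p).2, (polarCoord.symm p).1) := by
      ext i
      fin_cases i <;> simp [bladePoint, insertCoord, polarCoord_symm_apply] <;> rfl
    rw [this]
    refine mul_le_mul_left (ENNReal.ofReal_le_ofReal ?_) _
    calc p.1 ^ 2 * Real.sin p.2 ≤ p.1 ^ 2 * 1 := by gcongr; exact Real.sin_le_one _
      _ = p.1 * p.1 := by ring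
      _ ≤ A * p.1 := by gcongr
  -- The part of the closed rectangle outside the open polar chart is `r = 0` or `θ = π`, where the
  -- density vanishes.
  · have : p.1 = 0 ∨ p.2 = Real.pi := by
      by_contra hc
      push Not at hc
      apply ht
      refine ⟨lt_of_le_of_ne h1 (Ne.symm hc.1), ?_, lt_of_le_of_ne h4 hc.2⟩
      exact lt_of_lt_of_le (by linarith [Real.pi_pos]) h3
    rcases this with h | h <;> simp [h]

theorem hasDerivAt_insertCoord (i : Fin 3) (q : ℝ × ℝ) (t : ℝ) :
    HasDerivAt (fun t => insertCoord i (t, q)) (e i) t := by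
  have : (fun t => insertCoord i (t, q)) = fun t => insertCoord i (0, q) + t • e i := by
    ext t j
    rcases Fin.eq_self_or_eq_succAbove i j with rfl | ⟨k, rfl⟩
    · simp [insertCoord]
    · simp [insertCoord]
  rw [this]
  simpa using ((hasDerivAt_id t).smul_const (e i)).const_add (insertCoord i (0, q))

/-- `|f|²` vanishes at infinity along the line, so its value at `0` is the integral over `(-∞, 0]`
of its derivative `2 Re (f̄ ∂_i f)`. -/
theorem sq_enorm_le_lintegral (f : 𝓢(Space, ℂ)) (i : Fin 3) (q : ℝ × ℝ) :
    ‖f (insertCoord i (0, q))‖ₑ ^ 2 ≤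
      2 * ∫⁻ t, ‖f (insertCoord i (t, q))‖ₑ * ‖(∂_{e i} f : 𝓢(Space, ℂ)) (insertCoord i (t, q))‖ₑ := by
  have hcont : Continuous fun t => insertCoord i (t, q) :=
    continuous_iff_continuousAt.mpr fun t => (hasDerivAt_insertCoord i q t).continuousAt
  set I := ∫⁻ t, ‖f (insertCoord i (t, q))‖ₑ *
    ‖(∂_{e i} f : 𝓢(Space, ℂ)) (insertCoord i (t, q))‖ₑ with hI
  -- An infinite right-hand side needs no proof; a finite one supplies the integrability that the
  -- fundamental theorem of calculus requires.
  by_cases hfin : I = ⊤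
  · rw [hfin]; simp
  have hd : ∀ t, HasDerivAt (fun t => ‖f (insertCoord i (t, q))‖ ^ 2)
      (2 * inner ℝ (f (insertCoord i (t, q)))
        ((∂_{e i} f : 𝓢(Space, ℂ)) (insertCoord i (t, q)))) t := by
    intro t
    have h1 : HasDerivAt (fun t => f (insertCoord i (t, q)))
        ((∂_{e i} f : 𝓢(Space, ℂ)) (insertCoord i (t, q))) t := by
      rw [SchwartzMap.lineDerivOp_apply_eq_fderiv]
      exact (f.differentiableAt.hasFDerivAt).comp_hasDerivAt t (hasDerivAt_insertCoord i q t)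
    exact h1.norm_sq
  have hc1 : Continuous fun t => f (insertCoord i (t, q)) := f.continuous.comp hcont
  have hc2 : Continuous fun t => (∂_{e i} f : 𝓢(Space, ℂ)) (insertCoord i (t, q)) :=
    (∂_{e i} f : 𝓢(Space, ℂ)).continuous.comp hcont
  have hint : Integrable fun t => ‖f (insertCoord i (t, q))‖ *
      ‖(∂_{e i} f : 𝓢(Space, ℂ)) (insertCoord i (t, q))‖ := by
    refine ⟨(hc1.norm.mul hc2.norm).aestronglyMeasurable, ?_⟩
    rw [HasFiniteIntegral]
    simp only [enorm_mul, enorm_norm]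
    exact lt_top_iff_ne_top.mpr hfin
  have hint' : Integrable fun t => 2 * inner ℝ (f (insertCoord i (t, q)))
      ((∂_{e i} f : 𝓢(Space, ℂ)) (insertCoord i (t, q))) := by
    refine (hint.const_mul 2).mono' ((continuous_const.mul (hc1.inner hc2)).aestronglyMeasurable) ?_
    filter_upwards with t
    rw [norm_mul, Real.norm_ofNat]
    gcongr
    exact norm_inner_le_norm _ _
  have hlim : Tendsto (fun t => ‖f (insertCoord i (t, q))‖ ^ 2) atBot (𝓝 0) := by
    have h1 : Tendsto (fun t => insertCoord i (t, q)) atBot (cocompact Space) := by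
      apply tendsto_cocompact_of_tendsto_dist_comp_atTop (0 : Space)
      simp only [dist_zero_right]
      refine tendsto_atTop_mono (fun t => ?_) tendsto_abs_atBot_atTop
      have := abs_coord_le_norm (insertCoord i (t, q)) i
      simpa [insertCoord] using this
    have h2 := ((zero_at_infty f).comp h1).norm.pow 2
    simpa using h2
  have hF := integral_Iic_of_hasDerivAt_of_tendsto' (a := 0) (fun t _ => hd t)
    hint'.integrableOn hlim
  rw [sub_zero] at hF
  have hle : ‖f (insertCoord i (0, q))‖ ^ 2 ≤ 2 * ∫ t, ‖f (insertCoord i (t, q))‖ *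
      ‖(∂_{e i} f : 𝓢(Space, ℂ)) (insertCoord i (t, q))‖ := by
    rw [← hF, ← integral_const_mul]
    refine (setIntegral_mono_on hint'.integrableOn (hint.const_mul 2).integrableOn
      measurableSet_Iic fun t _ => ?_).trans
      (setIntegral_le_integral (hint.const_mul 2) (ae_of_all _ fun t => by positivity))
    gcongr
    exact real_inner_le_norm _ _
  have h2 : ENNReal.ofReal (∫ t, ‖f (insertCoord i (t, q))‖ *
      ‖(∂_{e i} f : 𝓢(Space, ℂ)) (insertCoord i (t, q))‖) = I := by
    rw [ofReal_integral_eq_lintegral_ofReal hint (ae_of_all _ fun t => by positivity)]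
    simp only [ENNReal.ofReal_mul (norm_nonneg _), ofReal_norm, hI]
  have h3 := ENNReal.ofReal_le_ofReal hle
  rwa [ENNReal.ofReal_mul (by norm_num), h2, ENNReal.ofReal_pow (norm_nonneg _), ofReal_norm,
    ENNReal.ofReal_ofNat] at h3

/-- Integrating the one-dimensional estimate over the plane `y = 0` gives a full space integral by
Fubini, and Cauchy–Schwarz splits it. Keeping the product `‖f‖ ‖∂_y f‖`, instead of an `H¹` norm
squared, is what later makes the blade term small relative to the gradient. -/
theorem lintegral_blade_schwartz_le (A : ℝ) (f : 𝓢(Space, ℂ)) :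
    ∫⁻ x, ‖f x‖ₑ ^ 2 ∂(bladeMeasure A) ≤ ENNReal.ofReal A * (2 *
      (eLpNorm f 2 volume * eLpNorm (∂_{e 1} f : 𝓢(Space, ℂ)) 2 volume)) := by
  refine (lintegral_bladeMeasure_le A (by fun_prop)).trans ?_
  gcongr
  calc _ ≤ ∫⁻ q : ℝ × ℝ, 2 * ∫⁻ t, ‖f (insertCoord 1 (t, q.2, q.1))‖ₑ *
        ‖(∂_{e 1} f : 𝓢(Space, ℂ)) (insertCoord 1 (t, q.2, q.1))‖ₑ :=
        lintegral_mono fun q => sq_enorm_le_lintegral f 1 (q.2, q.1)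
    _ = 2 * ∫⁻ x, ‖f x‖ₑ * ‖(∂_{e 1} f : 𝓢(Space, ℂ)) x‖ₑ := by
        rw [lintegral_const_mul' _ _ (by norm_num)]
        congr 1
        have hm := (measurePreserving_insertCoord 1).measurable
        have hc : Measurable fun x => ‖f x‖ₑ * ‖(∂_{e 1} f : 𝓢(Space, ℂ)) x‖ₑ := by
          fun_prop
        rw [← (measurePreserving_insertCoord 1).lintegral_comp hc,
          Measure.volume_eq_prod ℝ (ℝ × ℝ)]
        refine Eq.trans ?_ (lintegral_prod_symm _ (hc.comp hm).aemeasurable).symm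
        have hs : MeasurePreserving (Prod.swap : ℝ × ℝ → ℝ × ℝ) volume volume :=
          Measure.measurePreserving_swap
        exact hs.lintegral_comp (hc.comp hm).lintegral_prod_left'
    _ ≤ _ := by
        gcongr
        have := ENNReal.lintegral_mul_le_Lp_mul_Lq (volume : Measure Space)
          (Real.HolderConjugate.two_two) (f := fun x => ‖f x‖ₑ)
          (g := fun x => ‖(∂_{e 1} f : 𝓢(Space, ℂ)) x‖ₑ) (by fun_prop) (by fun_prop)
        rw [eLpNorm_eq_lintegral_rpow_enorm_toReal (by norm_num) (by norm_num),
          eLpNorm_eq_lintegral_rpow_enorm_toReal (by norm_num) (by norm_num)]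
        simpa using this

/-- The restriction of a Schwartz function to the blade. -/
abbrev bladeRestrict (A : ℝ) (f : 𝓢(Space, ℂ)) : BladeL2 A := f.toLp 2 (bladeMeasure A)

theorem norm_bladeRestrict_sq_le {A : ℝ} (hA : 0 ≤ A) (f : 𝓢(Space, ℂ)) :
    ‖bladeRestrict A f‖ ^ 2 ≤ 2 * A * (‖f.toLp 2 volume‖ *
      ‖(∂_{e 1} f : 𝓢(Space, ℂ)).toLp 2 volume‖) := by
  have h := lintegral_blade_schwartz_le A f
  have h1 : eLpNorm f 2 (bladeMeasure A) ^ 2 = ∫⁻ x, ‖f x‖ₑ ^ 2 ∂(bladeMeasure A) := by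
    have := eLpNorm_nnreal_pow_eq_lintegral (f := f) (μ := bladeMeasure A) (p := 2) (by norm_num)
    simpa using this
  rw [← h1] at h
  rw [SchwartzMap.norm_toLp, SchwartzMap.norm_toLp, SchwartzMap.norm_toLp, ← ENNReal.toReal_pow]
  have hf := (f.memLp 2 volume).eLpNorm_ne_top
  have hg := ((∂_{e 1} f : 𝓢(Space, ℂ)).memLp 2 volume).eLpNorm_ne_top
  have := ENNReal.toReal_mono (ENNReal.mul_ne_top ENNReal.ofReal_ne_top
    (ENNReal.mul_ne_top (by norm_num) (ENNReal.mul_ne_top hf hg))) h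
  refine this.trans (le_of_eq ?_)
  simp only [ENNReal.toReal_mul, ENNReal.toReal_ofReal hA, ENNReal.toReal_ofNat]
  ring

/-! ### Rotations about the third axis and the angular momentum -/

/-- The rotation by the angle `t` about the third axis. -/
def rotation (t : ℝ) : Space ≃ₗᵢ[ℝ] Space :=
  LinearIsometry.toLinearIsometryEquiv
    { toFun := fun x => !₂[Real.cos t * x 0 - Real.sin t * x 1,
        Real.sin t * x 0 + Real.cos t * x 1, x 2]
      map_add' := fun x y => by ext i; fin_cases i <;> simp <;> ring
      map_smul' := fun c x => by ext i; fin_cases i <;> simp <;> ring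
      norm_map' := fun x => by
        rw [EuclideanSpace.norm_eq, EuclideanSpace.norm_eq]
        congr 1
        simp [Fin.sum_univ_three]
        linear_combination (x 0 ^ 2 + x 1 ^ 2) * Real.sin_sq_add_cos_sq t }
    rfl

theorem rotation_apply (t : ℝ) (x : Space) : rotation t x =
    !₂[Real.cos t * x 0 - Real.sin t * x 1, Real.sin t * x 0 + Real.cos t * x 1, x 2] := rfl

theorem rotation_zero (x : Space) : rotation 0 x = x := by
  ext i
  fin_cases i <;> simp [rotation_apply]

theorem measurePreserving_rotation (t : ℝ) : MeasurePreserving (rotation t) :=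
  (rotation t).measurePreserving

/-- The only factor of a spherical harmonic that feels the rotation is a power of `x + i y`, so the
phase `e^{imt}` comes from here. -/
theorem rotation_plane (t : ℝ) (x : Space) :
    ((rotation t x 0 : ℝ) : ℂ) + Complex.I * ((rotation t x 1 : ℝ) : ℂ) =
      Complex.exp (t * Complex.I) * ((x 0 : ℂ) + Complex.I * (x 1 : ℂ)) := by
  rw [Complex.exp_mul_I, ← Complex.ofReal_cos, ← Complex.ofReal_sin]
  simp only [rotation_apply]
  apply Complex.ext <;> simp
  ring

theorem sphericalHarmonicNat_rotation (l m : ℕ) (t : ℝ) (x : Space) :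
    sphericalHarmonicNat l m (rotation t x) =
      Complex.exp (m * t * Complex.I) * sphericalHarmonicNat l m x := by
  unfold sphericalHarmonicNat
  have h2 : rotation t x 2 = x 2 := by simp [rotation_apply]
  rw [rotation_plane, (rotation t).norm_map, h2, mul_div_assoc, mul_pow, ← Complex.exp_nat_mul,
    ← mul_assoc (m : ℂ)]
  ring

theorem sphericalHarmonic_rotation (l : ℕ) (m : ℤ) (t : ℝ) (x : Space) :
    sphericalHarmonic l m (rotation t x) =
      Complex.exp (m * t * Complex.I) * sphericalHarmonic l m x := by
  unfold sphericalHarmonic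
  split_ifs with h
  · rw [sphericalHarmonicNat_rotation]
    have : ((m.natAbs : ℕ) : ℂ) = (m : ℂ) := by
      rw [← Int.cast_natCast, Int.natAbs_of_nonneg h]
    rw [this]
  · have : ((m.natAbs : ℕ) : ℂ) = -(m : ℂ) := by
      rw [← Int.cast_natCast, Int.ofNat_natAbs_of_nonpos (by omega), Int.cast_neg]
    rw [sphericalHarmonicNat_rotation, star_mul', this]
    have h2 : star (Complex.exp (-(m : ℂ) * t * Complex.I)) = Complex.exp (m * t * Complex.I) := by
      rw [Complex.star_def, ← Complex.exp_conj]
      congr 1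
      simp
    rw [h2]
    ring

/-- The action of the rotation by `t` on `L²`. -/
def rotationL2 (t : ℝ) : L2 →ₗᵢ[ℂ] L2 :=
  Lp.compMeasurePreservingₗᵢ ℂ (rotation t) (measurePreserving_rotation t)

theorem coeFn_rotationL2 (t : ℝ) (u : L2) :
    (rotationL2 t u : Space → ℂ) =ᵐ[volume] fun x => u (rotation t x) :=
  Lp.coeFn_compMeasurePreserving u (measurePreserving_rotation t)

/-- The closed subspace of `L²` on which the rotation by `t` acts by `e^{imt}`. -/
def azimuthal (m : ℤ) : Submodule ℂ L2 where
  carrier := {u | ∀ t : ℝ, rotationL2 t u = Complex.exp (m * t * Complex.I) • u}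
  add_mem' := fun {a b} ha hb t => by rw [map_add, ha t, hb t, smul_add]
  zero_mem' := fun t => by simp
  smul_mem' := fun c u hu t => by rw [map_smul, hu t, smul_comm]

theorem isClosed_azimuthal (m : ℤ) : _root_.IsClosed (azimuthal m : Set L2) := by
  have : (azimuthal m : Set L2) =
      ⋂ t : ℝ, {u | rotationL2 t u = Complex.exp (m * t * Complex.I) • u} := by
    ext u; simp [azimuthal]
  rw [this]
  refine isClosed_iInter fun t => isClosed_eq (rotationL2 t).continuous (by fun_prop)

instance completeSpace_azimuthal (m : ℤ) : CompleteSpace (azimuthal m) :=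
  (isClosed_azimuthal m).completeSpace_coe

/-- Rotations preserve inner products, so `⟪u, v⟫ = e^{i(n-m)t} ⟪u, v⟫` for every `t`; the angle `t
= π/(n-m)` makes the phase `-1`. -/
theorem azimuthal_isOrtho {m n : ℤ} (h : m ≠ n) : azimuthal m ⟂ azimuthal n := by
  rw [Submodule.isOrtho_iff_inner_eq]
  intro u hu v hv
  have hne : ((n : ℝ) - m) ≠ 0 := sub_ne_zero.mpr (by exact_mod_cast h.symm)
  have h1 := (rotationL2 (Real.pi / (n - m))).inner_map_map u v
  rw [hu, hv, inner_smul_left, inner_smul_right, ← Complex.exp_conj, ← mul_assoc,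
    ← Complex.exp_add] at h1
  have h2 : (starRingEnd ℂ) ((m : ℂ) * ((Real.pi / (n - m) : ℝ) : ℂ) * Complex.I) +
      (n : ℂ) * ((Real.pi / (n - m) : ℝ) : ℂ) * Complex.I = Real.pi * Complex.I := by
    have hne' : ((n : ℂ) - m) ≠ 0 := by exact_mod_cast hne
    simp only [map_mul, Complex.conj_I, Complex.conj_ofReal, map_intCast]
    push_cast
    field_simp
    ring
  rw [h2, Complex.exp_pi_mul_I] at h1
  have h3 : inner ℂ u v + inner ℂ u v = 0 := by linear_combination -h1
  exact self_eq_neg.mp (by linear_combination h3)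

/-- The vector field `x ∂_y - y ∂_x` on Schwartz functions. -/
def rotationField (f : 𝓢(Space, ℂ)) : 𝓢(Space, ℂ) :=
  SchwartzMap.smulLeftCLM ℂ (fun x : Space => ((x 0 : ℝ) : ℂ)) (∂_{e 1} f) -
    SchwartzMap.smulLeftCLM ℂ (fun x : Space => ((x 1 : ℝ) : ℂ)) (∂_{e 0} f)

theorem rotationField_apply (f : 𝓢(Space, ℂ)) (x : Space) : rotationField f x =
    (x 0 : ℂ) * (∂_{e 1} f : 𝓢(Space, ℂ)) x - (x 1 : ℂ) * (∂_{e 0} f : 𝓢(Space, ℂ)) x := by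
  simp only [rotationField, sub_apply,
    SchwartzMap.smulLeftCLM_apply_apply (hasTemperateGrowth_coord _), smul_eq_mul]

theorem hasDerivAt_rotation (x : Space) (t : ℝ) :
    HasDerivAt (fun t => rotation t x)
      ((rotation t x 0) • e 1 - (rotation t x 1) • e 0) t := by
  have h1 : (fun t => rotation t x) = fun t => Real.cos t • (!₂[x 0, x 1, 0] : Space) +
      Real.sin t • (!₂[-x 1, x 0, 0] : Space) + (!₂[0, 0, x 2] : Space) := by
    ext t i
    fin_cases i <;> simp [rotation_apply] <;> ring
  have h2 := (((Real.hasDerivAt_cos t).smul_const (!₂[x 0, x 1, 0] : Space)).add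
    ((Real.hasDerivAt_sin t).smul_const (!₂[-x 1, x 0, 0] : Space))).add_const
    (!₂[0, 0, x 2] : Space)
  rw [h1]
  have h3 : (rotation t x 0) • e 1 - (rotation t x 1) • e 0 =
      -Real.sin t • (!₂[x 0, x 1, 0] : Space) + Real.cos t • (!₂[-x 1, x 0, 0] : Space) := by
    ext i
    fin_cases i <;> simp [rotation_apply] <;> ring
  rw [h3]
  exact h2

theorem hasDerivAt_comp_rotation (f : 𝓢(Space, ℂ)) (x : Space) (t : ℝ) :
    HasDerivAt (fun t => f (rotation t x)) (rotationField f (rotation t x)) t := by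
  have h := (f.differentiableAt (x := rotation t x)).hasFDerivAt.comp_hasDerivAt t
    (hasDerivAt_rotation x t)
  rw [map_sub, map_smul, map_smul, ← SchwartzMap.lineDerivOp_apply_eq_fderiv,
    ← SchwartzMap.lineDerivOp_apply_eq_fderiv] at h
  rw [rotationField_apply]
  simp only [Complex.real_smul] at h
  exact h

/-- Since `∂_j x_i = 0` for `i ≠ j`, the field `x ∂_y - y ∂_x` is skew under transposition with no
zeroth-order term, which lets `J` be moved onto test functions. -/
theorem lineDerivOp_smulLeftCLM_coord {i j : Fin 3} (h : i ≠ j) (f : 𝓢(Space, ℂ)) :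
    (∂_{e j} (SchwartzMap.smulLeftCLM ℂ (fun x : Space => ((x i : ℝ) : ℂ)) f) : 𝓢(Space, ℂ)) =
      SchwartzMap.smulLeftCLM ℂ (fun x : Space => ((x i : ℝ) : ℂ)) (∂_{e j} f) := by
  ext x
  rw [SchwartzMap.smulLeftCLM_apply_apply (hasTemperateGrowth_coord _),
    SchwartzMap.lineDerivOp_apply_eq_fderiv, SchwartzMap.lineDerivOp_apply_eq_fderiv]
  have h0 : ⇑(SchwartzMap.smulLeftCLM ℂ (fun x : Space => ((x i : ℝ) : ℂ)) f) =
      fun x => (Complex.ofRealCLM ∘L (EuclideanSpace.proj i : Space →L[ℝ] ℝ)) x * f x := by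
    ext y
    rw [SchwartzMap.smulLeftCLM_apply_apply (hasTemperateGrowth_coord _)]
    rfl
  rw [h0, fderiv_fun_mul (ContinuousLinearMap.differentiableAt _) f.differentiableAt,
    ContinuousLinearMap.fderiv]
  simp [h]

/-- Schwartz functions decay fast enough to be paired with `L²`, uniformly over each sphere. -/
theorem integrable_decay_mul (C : ℝ) (u : L2) :
    Integrable fun x : Space => C * (1 + ‖x‖) ^ (-2 : ℝ) * ‖u x‖ := by
  have h0 : Integrable fun x : Space => (1 + ‖x‖) ^ (-4 : ℝ) :=
    integrable_one_add_norm (by simp; norm_num)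
  have h1 : MemLp (fun x : Space => (1 + ‖x‖) ^ (-2 : ℝ)) 2 := by
    have hc : Continuous fun x : Space => (1 + ‖x‖) ^ (-2 : ℝ) := by
      refine Continuous.rpow_const (by fun_prop) fun x => Or.inl ?_
      positivity
    rw [memLp_two_iff_integrable_sq hc.aestronglyMeasurable]
    refine h0.congr (ae_of_all _ fun x => ?_)
    simp only
    rw [← Real.rpow_natCast, ← Real.rpow_mul (by positivity)]
    norm_num
  exact (h1.const_mul C).integrable_mul (Lp.memLp u).norm

/-- The exponent `2` makes the majorant square integrable in dimension three, and being radial it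
dominates all rotates of `f` at once. -/
theorem exists_decay_bound (f : 𝓢(Space, ℂ)) :
    ∃ C : ℝ, ∀ x, ‖f x‖ ≤ C * (1 + ‖x‖) ^ (-2 : ℝ) := by
  refine ⟨2 ^ 2 * ((Finset.Iic (2, 0)).sup fun m => SchwartzMap.seminorm ℝ m.1 m.2) f, fun x => ?_⟩
  have := SchwartzMap.one_add_le_sup_seminorm_apply (𝕜 := ℝ) (m := (2, 0)) le_rfl le_rfl f x
  rw [norm_iteratedFDeriv_zero] at this
  rw [Real.rpow_neg (by positivity), ← div_eq_mul_inv, le_div_iff₀ (by positivity), mul_comm]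
  exact_mod_cast this

/-- The pairing of `u` with the rotates of `f` can be computed in two ways: invariance of Lebesgue
measure gives `∫ f(R_t x) u(x) dx = e^{-imt} ∫ f u`, and differentiation under the integral at `t =
0` produces the rotation field. -/
theorem integral_rotationField_mul {m : ℤ} {u : L2} (hu : u ∈ azimuthal m) (f : 𝓢(Space, ℂ)) :
    ∫ x, rotationField f x * u x = -(m * Complex.I) * ∫ x, f x * u x := by
  obtain ⟨C, hC⟩ := exists_decay_bound f
  obtain ⟨C', hC'⟩ := exists_decay_bound (rotationField f)
  have hm : ∀ (g : 𝓢(Space, ℂ)) (t : ℝ),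
      AEStronglyMeasurable (fun x => g (rotation t x) * u x) volume := fun g t =>
    (g.continuous.comp (rotation t).continuous).aestronglyMeasurable.mul
      (Lp.aestronglyMeasurable u)
  have h1 : HasDerivAt (fun t => ∫ x, f (rotation t x) * u x)
      (∫ x, rotationField f (rotation 0 x) * u x) 0 := by
    refine (hasDerivAt_integral_of_dominated_loc_of_deriv_le (s := univ)
      (F := fun t x => f (rotation t x) * u x)
      (F' := fun t x => rotationField f (rotation t x) * u x)
      (bound := fun x => C' * (1 + ‖x‖) ^ (-2 : ℝ) * ‖u x‖) univ_mem
      (Eventually.of_forall fun t => hm f t) ?_ (hm _ 0) ?_ (integrable_decay_mul C' u) ?_).2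
    · refine (integrable_decay_mul C u).mono' (hm f 0) (ae_of_all _ fun x => ?_)
      rw [norm_mul]
      gcongr
      simpa using hC (rotation 0 x)
    · refine ae_of_all _ fun x t _ => ?_
      rw [norm_mul]
      gcongr
      simpa using hC' (rotation t x)
    · exact ae_of_all _ fun x t _ => (hasDerivAt_comp_rotation f x t).mul_const _
  have h2 : ∀ t, ∫ x, f (rotation t x) * u x =
      Complex.exp (-(m * t * Complex.I)) * ∫ x, f x * u x := by
    intro t
    have e1 : ∫ x, f x * u x = ∫ x, f (rotation t x) * u (rotation t x) :=
      ((measurePreserving_rotation t).integral_comp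
        (rotation t).toHomeomorph.measurableEmbedding (fun x => f x * u x)).symm
    rw [e1, ← integral_const_mul]
    apply integral_congr_ae
    have e2 := coeFn_rotationL2 t u
    rw [hu t] at e2
    filter_upwards [e2, Lp.coeFn_smul (Complex.exp (m * t * Complex.I)) u] with x hx hx2
    rw [← hx, hx2, Pi.smul_apply, smul_eq_mul]
    have : Complex.exp (-(m * t * Complex.I)) * Complex.exp (m * t * Complex.I) = 1 := by
      rw [← Complex.exp_add]; simp
    linear_combination -(f (rotation t x) * u x) * this
  have h3 : HasDerivAt (fun t : ℝ => Complex.exp (-(m * t * Complex.I)) * ∫ x, f x * u x)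
      (-(m * Complex.I) * ∫ x, f x * u x) 0 := by
    have : HasDerivAt (fun t : ℝ => -((m : ℂ) * (t : ℂ) * Complex.I)) (-(m * Complex.I)) 0 := by
      have := (((hasDerivAt_id (0 : ℝ)).ofReal_comp).const_mul (m : ℂ)).mul_const Complex.I
      simp only [id_eq, Complex.ofReal_one, mul_one] at this
      exact this.neg
    simpa using (this.cexp).mul_const (∫ x, f x * u x)
  simp only [h2, rotation_zero] at h1
  exact h1.unique h3

/-- On `azimuthal m` the angular momentum acts as multiplication by `m`. -/
theorem angularMomentum_azimuthal {m : ℤ} {u : L2} (hu : u ∈ azimuthal m) :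
    angularMomentum (u : 𝓢'(Space, ℂ)) = ((m : ℂ) • u : L2) := by
  ext f
  have h0 := integral_rotationField_mul hu f
  -- Each distributional derivative carries a minus sign, which turns the prefactor `-i` into `i`.
  have h1 : angularMomentum (u : 𝓢'(Space, ℂ)) f =
      Complex.I * (u : 𝓢'(Space, ℂ)) (rotationField f) := by
    simp only [angularMomentum, rotationField]
    change (-Complex.I) * ((u : 𝓢'(Space, ℂ)) (-∂_{e 1} (SchwartzMap.smulLeftCLM ℂ
        (fun x : Space => ((x 0 : ℝ) : ℂ)) f)) - (u : 𝓢'(Space, ℂ)) (-∂_{e 0}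
          (SchwartzMap.smulLeftCLM ℂ (fun x : Space => ((x 1 : ℝ) : ℂ)) f))) = _
    rw [lineDerivOp_smulLeftCLM_coord (by decide), lineDerivOp_smulLeftCLM_coord (by decide)]
    simp only [map_neg, map_sub]
    ring
  rw [h1]
  have h2 : (((m : ℂ) • u : L2) : 𝓢'(Space, ℂ)) f = m * (u : 𝓢'(Space, ℂ)) f := by
    change toDist ((m : ℂ) • u) f = _
    rw [map_smul]
    rfl
  rw [h2, Lp.toTemperedDistribution_apply, Lp.toTemperedDistribution_apply]
  simp only [smul_eq_mul]
  rw [h0]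
  linear_combination -(m * ∫ x, f x * u x) * Complex.I_mul_I

theorem mem_azimuthal_of_ae_eq {l : ℕ} {m : ℤ} {χ : ℝ → ℂ} {u : L2}
    (h : (u : Space → ℂ) =ᵐ[volume] fun x => χ ‖x‖ * sphericalHarmonic l m x) :
    u ∈ azimuthal m := by
  intro t
  apply Lp.ext
  filter_upwards [coeFn_rotationL2 t u, Lp.coeFn_smul (Complex.exp (m * t * Complex.I)) u, h,
    (measurePreserving_rotation t).quasiMeasurePreserving.ae h] with x h1 h2 h3 h4
  rw [h1, h2, Pi.smul_apply, h3, h4, sphericalHarmonic_rotation, (rotation t).norm_map, smul_eq_mul]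
  ring

theorem starProjection_azimuthal_of_mem {m n : ℤ} {u : L2} (hu : u ∈ azimuthal m) :
    (azimuthal n).starProjection u = if m = n then u else 0 := by
  split_ifs with h
  · subst h
    exact Submodule.starProjection_eq_self_iff.mpr hu
  · rw [Submodule.starProjection_apply_eq_zero_iff]
    exact (azimuthal_isOrtho h) hu

/-- An induction principle: the range of `Π_L` is the closed span of vectors that each belong to a
single azimuthal subspace with `|m| ≤ L`, so closed conditions need checking only on those. -/
theorem lowAngularMomentum_le {L : ℕ} {N : Submodule ℂ L2} (hN : _root_.IsClosed (N : Set L2))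
    (h : ∀ m ∈ Finset.Icc (-(L : ℤ)) L, ∀ u ∈ azimuthal m, u ∈ lowAngularMomentum L → u ∈ N) :
    lowAngularMomentum L ≤ N := by
  refine Submodule.topologicalClosure_minimal _ (Submodule.span_le.mpr ?_) hN
  rintro u ⟨l, hl, m, hm, χ, hu⟩
  refine h m ?_ u (mem_azimuthal_of_ae_eq hu) ?_
  · rw [Finset.mem_Icc] at hm ⊢
    omega
  · exact Submodule.le_topologicalClosure _ (Submodule.subset_span ⟨l, hl, m, hm, χ, hu⟩)

/-- On each generator exactly one azimuthal projector acts as the identity and the others annihilate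
it. This finite decomposition is the reason why `J` is bounded on the range of `Π_L`. -/
theorem sum_starProjection_azimuthal {L : ℕ} {u : L2} (hu : u ∈ lowAngularMomentum L) :
    ∑ m ∈ Finset.Icc (-(L : ℤ)) L, (azimuthal m).starProjection u = u := by
  have : lowAngularMomentum L ≤ LinearMap.ker
      ((∑ m ∈ Finset.Icc (-(L : ℤ)) L, (azimuthal m).starProjection -
        ContinuousLinearMap.id ℂ L2 : L2 →L[ℂ] L2) : L2 →ₗ[ℂ] L2) := by
    refine lowAngularMomentum_le (ContinuousLinearMap.isClosed_ker _) fun m hm v hv _ => ?_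
    rw [LinearMap.mem_ker]
    simp only [ContinuousLinearMap.coe_coe, sub_apply,
      sum_apply, ContinuousLinearMap.id_apply,
      starProjection_azimuthal_of_mem hv]
    rw [Finset.sum_ite_eq, if_pos hm, sub_self]
  have h2 := this hu
  rw [LinearMap.mem_ker] at h2
  simp only [ContinuousLinearMap.coe_coe, sub_apply,
    sum_apply, ContinuousLinearMap.id_apply] at h2
  exact sub_eq_zero.mp h2

theorem starProjection_azimuthal_mem {L : ℕ} {u : L2} (n : ℤ) (hu : u ∈ lowAngularMomentum L) :
    (azimuthal n).starProjection u ∈ lowAngularMomentum L := by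
  have : lowAngularMomentum L ≤
      (lowAngularMomentum L).comap ((azimuthal n).starProjection : L2 →ₗ[ℂ] L2) := by
    refine lowAngularMomentum_le ?_ fun m _ v hv hv' => ?_
    · exact (Submodule.isClosed_topologicalClosure _).preimage
        (azimuthal n).starProjection.continuous
    · rw [Submodule.mem_comap]
      change (azimuthal n).starProjection v ∈ _
      rw [starProjection_azimuthal_of_mem hv]
      split_ifs
      · exact hv'
      · exact Submodule.zero_mem _
  exact this hu

/-- The bounded operator `J Π_L`. -/
def cutoffAngular (L : ℕ) : L2 →L[ℂ] L2 :=
  ∑ m ∈ Finset.Icc (-(L : ℤ)) L, (m : ℂ) • (azimuthal m).starProjection ∘L cutoffProjector L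

theorem cutoffAngular_apply (L : ℕ) (u : L2) : cutoffAngular L u =
    ∑ m ∈ Finset.Icc (-(L : ℤ)) L, (m : ℂ) • (azimuthal m).starProjection (cutoffProjector L u) := by
  simp [cutoffAngular]

theorem cutoffProjector_mem (L : ℕ) (u : L2) : cutoffProjector L u ∈ lowAngularMomentum L :=
  Submodule.starProjection_apply_mem _ _

/-- `Π_L u` splits into finitely many azimuthal components, on each of which the distribution `J` is
multiplication by `m`. The Hamiltonian thereby becomes a bounded perturbation of `-Δ`. -/
theorem angularMomentum_cutoffProjector (L : ℕ) (u : L2) :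
    angularMomentum (cutoffProjector L u : 𝓢'(Space, ℂ)) = (cutoffAngular L u : 𝓢'(Space, ℂ)) := by
  let J : 𝓢'(Space, ℂ) →ₗ[ℂ] 𝓢'(Space, ℂ) := (-Complex.I) •
    ((TemperedDistribution.smulLeftCLM ℂ (fun x : Space => ((x 0 : ℝ) : ℂ)) ∘L
      LineDeriv.lineDerivOpCLM ℂ 𝓢'(Space, ℂ) (e 1) -
      TemperedDistribution.smulLeftCLM ℂ (fun x : Space => ((x 1 : ℝ) : ℂ)) ∘L
      LineDeriv.lineDerivOpCLM ℂ 𝓢'(Space, ℂ) (e 0) : 𝓢'(Space, ℂ) →L[ℂ] 𝓢'(Space, ℂ)) :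
        𝓢'(Space, ℂ) →ₗ[ℂ] 𝓢'(Space, ℂ))
  have hJ : ∀ v : L2, J (toDist v) = angularMomentum (v : 𝓢'(Space, ℂ)) := fun v => rfl
  rw [← hJ]
  conv_lhs => rw [← sum_starProjection_azimuthal (cutoffProjector_mem L u)]
  change _ = toDist (cutoffAngular L u)
  rw [cutoffAngular_apply, map_sum, map_sum, map_sum]
  refine Finset.sum_congr rfl fun m _ => ?_
  rw [hJ, angularMomentum_azimuthal (Submodule.starProjection_apply_mem _ _)]
  rfl

/-- Write `P_m` for the azimuthal projectors. They preserve the range of `Π_L`, so `P_m Π_L = Π_L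
P_m Π_L`, a product that is manifestly self-adjoint, and the coefficients `m` are real. -/
theorem inner_cutoffAngular (L : ℕ) (u v : L2) :
    inner ℂ (cutoffAngular L u) v = inner ℂ u (cutoffAngular L v) := by
  rw [cutoffAngular_apply, cutoffAngular_apply, sum_inner, inner_sum]
  refine Finset.sum_congr rfl fun m _ => ?_
  rw [inner_smul_left, inner_smul_right]
  have h : ∀ w, (azimuthal m).starProjection (cutoffProjector L w) =
      cutoffProjector L ((azimuthal m).starProjection (cutoffProjector L w)) := fun w =>
    (Submodule.starProjection_eq_self_iff.mpr
      (starProjection_azimuthal_mem m (cutoffProjector_mem L w))).symm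
  have hs : ∀ w w', inner ℂ (cutoffProjector L w) w' = inner ℂ w (cutoffProjector L w') :=
    fun w w' => Submodule.inner_starProjection_left_eq_right _ w w'
  rw [h u, hs, Submodule.inner_starProjection_left_eq_right, hs, ← h v]
  simp

/-! ### The Sobolev space `H¹`, gradient and trace -/

/-- The Sobolev space `H¹(ℝ³)` as a subspace of `L²(ℝ³)`. -/
def sobolevOne : Submodule ℂ L2 where
  carrier := {u | MemH 1 u}
  add_mem' := fun {a b} ha hb => by
    rw [mem_ofPred_eq, memH_one_iff] at *
    intro i
    obtain ⟨v, hv⟩ := ha i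
    obtain ⟨w, hw⟩ := hb i
    exact ⟨_, hv.add hw⟩
  zero_mem' := by
    rw [mem_ofPred_eq, memH_one_iff]
    refine fun i => ⟨0, ?_⟩
    have := (isWeakDeriv_toLp i 0).smul 0
    simpa using this
  smul_mem' := fun c u hu => by
    rw [mem_ofPred_eq, memH_one_iff] at *
    intro i
    obtain ⟨v, hv⟩ := hu i
    exact ⟨_, hv.smul c⟩

theorem mem_sobolevOne {u : L2} : u ∈ sobolevOne ↔ MemH 1 u := Iff.rfl

theorem exists_isWeakDeriv (i : Fin 3) (u : sobolevOne) : ∃ v, IsWeakDeriv i (u : L2) v :=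
  (memH_one_iff _).mp u.2 i

/-- The weak partial derivative on `H¹`. -/
def weakDeriv (i : Fin 3) : sobolevOne →ₗ[ℂ] L2 where
  toFun u := (exists_isWeakDeriv i u).choose
  map_add' u v := (exists_isWeakDeriv i (u + v)).choose_spec.unique
    ((exists_isWeakDeriv i u).choose_spec.add (exists_isWeakDeriv i v).choose_spec)
  map_smul' c u := (exists_isWeakDeriv i (c • u)).choose_spec.unique
    ((exists_isWeakDeriv i u).choose_spec.smul c)

theorem isWeakDeriv_weakDeriv (i : Fin 3) (u : sobolevOne) :
    IsWeakDeriv i (u : L2) (weakDeriv i u) :=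
  (exists_isWeakDeriv i u).choose_spec

theorem weakDeriv_eq {i : Fin 3} {u v : L2} (hu : u ∈ sobolevOne) (h : IsWeakDeriv i u v) :
    weakDeriv i ⟨u, hu⟩ = v :=
  (isWeakDeriv_weakDeriv i ⟨u, hu⟩).unique h

/-- A sequence in `H¹` that converges in `L²` and whose gradients form a Cauchy sequence converges
in `H¹`. -/
theorem exists_tendsto_weakDeriv {u : ℕ → sobolevOne} {Ψ : L2}
    (hu : Tendsto (fun n => (u n : L2)) atTop (𝓝 Ψ))
    (hd : Tendsto (fun p : ℕ × ℕ => ∑ i, ‖weakDeriv i (u p.1 - u p.2)‖ ^ 2) atTop (𝓝 0)) :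
    ∃ h : Ψ ∈ sobolevOne, ∀ i, Tendsto (fun n => weakDeriv i (u n)) atTop
      (𝓝 (weakDeriv i ⟨Ψ, h⟩)) := by
  have hc : ∀ i, CauchySeq fun n => weakDeriv i (u n) := by
    intro i
    rw [cauchySeq_iff_tendsto_dist_atTop_0]
    have h1 : Tendsto (fun p : ℕ × ℕ => ‖weakDeriv i (u p.1 - u p.2)‖ ^ 2) atTop (𝓝 0) :=
      squeeze_zero (fun _ => by positivity) (fun p => Finset.single_le_sum
        (f := fun i => ‖weakDeriv i (u p.1 - u p.2)‖ ^ 2) (fun j _ => by positivity)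
        (Finset.mem_univ i)) hd
    have h2 := h1.sqrt
    simp only [Real.sqrt_sq (norm_nonneg _), Real.sqrt_zero, map_sub] at h2
    simpa only [dist_eq_norm] using h2
  choose v hv using fun i => cauchySeq_tendsto_of_complete (hc i)
  have hw : ∀ i, IsWeakDeriv i Ψ (v i) := fun i =>
    IsWeakDeriv.of_tendsto (fun n => isWeakDeriv_weakDeriv i (u n)) hu (hv i)
  have hΨ : Ψ ∈ sobolevOne := mem_sobolevOne.mpr ((memH_one_iff Ψ).mpr fun i => ⟨v i, hw i⟩)
  refine ⟨hΨ, fun i => ?_⟩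
  rw [weakDeriv_eq hΨ (hw i)]
  exact hv i

theorem exists_schwartz_tendsto_weakDeriv (u : sobolevOne) :
    ∃ f : ℕ → 𝓢(Space, ℂ), Tendsto (fun n => (f n).toLp 2 volume) atTop (𝓝 (u : L2)) ∧
      ∀ i, Tendsto (fun n => (∂_{e i} (f n) : 𝓢(Space, ℂ)).toLp 2 volume) atTop
        (𝓝 (weakDeriv i u)) :=
  exists_schwartz_tendsto fun i => isWeakDeriv_weakDeriv i u

theorem isBladeTrace_iff {A : ℝ} {Ψ : L2} {τ : BladeL2 A} :
    IsBladeTrace A Ψ τ ↔ ∃ h : Ψ ∈ sobolevOne, ∃ f : ℕ → 𝓢(Space, ℂ),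
      Tendsto (fun n => (f n).toLp 2 volume) atTop (𝓝 Ψ) ∧
      (∀ i, Tendsto (fun n => (∂_{e i} (f n) : 𝓢(Space, ℂ)).toLp 2 volume) atTop
        (𝓝 (weakDeriv i ⟨Ψ, h⟩))) ∧
      Tendsto (fun n => bladeRestrict A (f n)) atTop (𝓝 τ) := by
  have key : ∀ f : ℕ → 𝓢(Space, ℂ),
      Tendsto (fun n => eLpNorm (fun x => f n x - τ x) 2 (bladeMeasure A)) atTop (𝓝 0) ↔
        Tendsto (fun n => bladeRestrict A (f n)) atTop (𝓝 τ) := by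
    intro f
    rw [Lp.tendsto_Lp_iff_tendsto_eLpNorm']
    refine tendsto_congr fun n => eLpNorm_congr_ae ?_
    filter_upwards [(f n).coeFn_toLp 2 (bladeMeasure A)] with x hx
    rw [Pi.sub_apply, hx]
  constructor
  · rintro ⟨f, h1, h2, h3⟩
    choose v hv using h2
    have hΨ : Ψ ∈ sobolevOne :=
      mem_sobolevOne.mpr ((memH_one_iff Ψ).mpr fun i => ⟨v i, (hv i).1⟩)
    refine ⟨hΨ, f, h1, fun i => ?_, (key f).mp h3⟩
    rw [weakDeriv_eq hΨ (hv i).1]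
    exact (hv i).2
  · rintro ⟨h, f, h1, h2, h3⟩
    exact ⟨f, h1, fun i => ⟨_, isWeakDeriv_weakDeriv i ⟨Ψ, h⟩, h2 i⟩, (key f).mpr h3⟩

theorem bladeRestrict_sub (A : ℝ) (f g : 𝓢(Space, ℂ)) :
    bladeRestrict A (f - g) = bladeRestrict A f - bladeRestrict A g :=
  (SchwartzMap.toLpCLM ℂ ℂ 2 (bladeMeasure A)).map_sub f g

theorem toLp_sub (f g : 𝓢(Space, ℂ)) :
    (f - g).toLp 2 (volume : Measure Space) = f.toLp 2 volume - g.toLp 2 volume :=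
  (SchwartzMap.toLpCLM ℂ ℂ 2 (volume : Measure Space)).map_sub f g

theorem norm_bladeRestrict_sub_sq_le {A : ℝ} (hA : 0 ≤ A) (f g : 𝓢(Space, ℂ)) :
    ‖bladeRestrict A f - bladeRestrict A g‖ ^ 2 ≤ 2 * A *
      (‖f.toLp 2 volume - g.toLp 2 volume‖ * ‖(∂_{e 1} f : 𝓢(Space, ℂ)).toLp 2 volume -
        (∂_{e 1} g : 𝓢(Space, ℂ)).toLp 2 volume‖) := by
  have h := norm_bladeRestrict_sq_le hA (f - g)
  have h2 : (∂_{e 1} (f - g) : 𝓢(Space, ℂ)) = ∂_{e 1} f - ∂_{e 1} g :=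
    (LineDeriv.lineDerivOpCLM ℂ 𝓢(Space, ℂ) (e 1)).map_sub f g
  rwa [bladeRestrict_sub, toLp_sub, h2, toLp_sub] at h

/-- Two approximating sequences differ by a sequence that tends to `0` in `H¹`, hence on the blade
by the trace inequality. -/
theorem IsBladeTrace.unique {A : ℝ} (hA : 0 ≤ A) {Ψ : L2} {τ τ' : BladeL2 A}
    (h : IsBladeTrace A Ψ τ) (h' : IsBladeTrace A Ψ τ') : τ = τ' := by
  obtain ⟨hΨ, f, h1, h2, h3⟩ := isBladeTrace_iff.mp h
  obtain ⟨_, f', h1', h2', h3'⟩ := isBladeTrace_iff.mp h'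
  have hl := ((h3.sub h3').norm).pow 2
  have hr := ((h1.sub h1').norm.mul ((h2 1).sub (h2' 1)).norm).const_mul (2 * A)
  have := le_of_tendsto_of_tendsto' hl hr fun n => norm_bladeRestrict_sub_sq_le hA (f n) (f' n)
  simp only [sub_self, norm_zero, mul_zero] at this
  have h0 : ‖τ - τ'‖ = 0 := by nlinarith [norm_nonneg (τ - τ')]
  exact sub_eq_zero.mp (norm_eq_zero.mp h0)

/-- The trace inequality makes the restrictions of an `H¹`-approximating Schwartz sequence Cauchy on
the blade, so the trace condition does not shrink the form domain. -/
theorem exists_isBladeTrace {A : ℝ} (hA : 0 ≤ A) (u : sobolevOne) :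
    ∃ τ, IsBladeTrace A (u : L2) τ := by
  obtain ⟨f, h1, h2⟩ := exists_schwartz_tendsto_weakDeriv u
  have hc : CauchySeq fun n => bladeRestrict A (f n) := by
    rw [cauchySeq_iff_tendsto_dist_atTop_0]
    have c1 := cauchySeq_iff_tendsto_dist_atTop_0.mp h1.cauchySeq
    have c2 := cauchySeq_iff_tendsto_dist_atTop_0.mp (h2 1).cauchySeq
    have c3 := ((c1.mul c2).const_mul (2 * A)).sqrt
    simp only [mul_zero, Real.sqrt_zero] at c3
    refine squeeze_zero (fun _ => dist_nonneg) (fun p => Real.le_sqrt_of_sq_le ?_) c3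
    simpa only [dist_eq_norm] using norm_bladeRestrict_sub_sq_le hA (f p.1) (f p.2)
  obtain ⟨τ, hτ⟩ := cauchySeq_tendsto_of_complete hc
  exact ⟨τ, isBladeTrace_iff.mpr ⟨u.2, f, h1, h2, hτ⟩⟩

theorem IsBladeTrace.add {A : ℝ} {u v : L2} {τ σ : BladeL2 A} (h : IsBladeTrace A u τ)
    (h' : IsBladeTrace A v σ) : IsBladeTrace A (u + v) (τ + σ) := by
  obtain ⟨hΨ, f, h1, h2, h3⟩ := isBladeTrace_iff.mp h
  obtain ⟨hΨ', f', h1', h2', h3'⟩ := isBladeTrace_iff.mp h'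
  refine isBladeTrace_iff.mpr ⟨add_mem hΨ hΨ', fun n => f n + f' n, ?_, fun i => ?_, ?_⟩
  · exact (h1.add h1').congr fun n =>
      ((SchwartzMap.toLpCLM ℂ ℂ 2 (volume : Measure Space)).map_add _ _).symm
  · have : weakDeriv i ⟨u + v, add_mem hΨ hΨ'⟩ = weakDeriv i ⟨u, hΨ⟩ + weakDeriv i ⟨v, hΨ'⟩ :=
      (weakDeriv i).map_add ⟨u, hΨ⟩ ⟨v, hΨ'⟩
    rw [this]
    refine ((h2 i).add (h2' i)).congr fun n => ?_
    rw [LineDeriv.lineDerivOp_add]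
    exact ((SchwartzMap.toLpCLM ℂ ℂ 2 (volume : Measure Space)).map_add _ _).symm
  · exact (h3.add h3').congr fun n =>
      ((SchwartzMap.toLpCLM ℂ ℂ 2 (bladeMeasure A)).map_add _ _).symm

theorem IsBladeTrace.smul {A : ℝ} (c : ℂ) {u : L2} {τ : BladeL2 A} (h : IsBladeTrace A u τ) :
    IsBladeTrace A (c • u) (c • τ) := by
  obtain ⟨hΨ, f, h1, h2, h3⟩ := isBladeTrace_iff.mp h
  refine isBladeTrace_iff.mpr ⟨Submodule.smul_mem _ c hΨ, fun n => c • f n, ?_, fun i => ?_, ?_⟩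
  · exact (h1.const_smul c).congr fun n =>
      ((SchwartzMap.toLpCLM ℂ ℂ 2 (volume : Measure Space)).map_smul _ _).symm
  · have : weakDeriv i ⟨c • u, Submodule.smul_mem _ c hΨ⟩ = c • weakDeriv i ⟨u, hΨ⟩ :=
      (weakDeriv i).map_smul c ⟨u, hΨ⟩
    rw [this]
    refine ((h2 i).const_smul c).congr fun n => ?_
    rw [LineDeriv.lineDerivOp_smul]
    exact ((SchwartzMap.toLpCLM ℂ ℂ 2 (volume : Measure Space)).map_smul _ _).symm
  · exact (h3.const_smul c).congr fun n =>
      ((SchwartzMap.toLpCLM ℂ ℂ 2 (bladeMeasure A)).map_smul _ _).symm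

/-- The trace on the blade, `H¹(ℝ³) → L²(D, dμ_D)`. -/
def bladeTrace {A : ℝ} (hA : 0 ≤ A) : sobolevOne →ₗ[ℂ] BladeL2 A where
  toFun u := (exists_isBladeTrace hA u).choose
  map_add' u v := (exists_isBladeTrace hA (u + v)).choose_spec.unique hA
    ((exists_isBladeTrace hA u).choose_spec.add (exists_isBladeTrace hA v).choose_spec)
  map_smul' c u := (exists_isBladeTrace hA (c • u)).choose_spec.unique hA
    ((exists_isBladeTrace hA u).choose_spec.smul c)

theorem isBladeTrace_bladeTrace {A : ℝ} (hA : 0 ≤ A) (u : sobolevOne) :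
    IsBladeTrace A (u : L2) (bladeTrace hA u) :=
  (exists_isBladeTrace hA u).choose_spec

theorem norm_bladeTrace_sq_le {A : ℝ} (hA : 0 ≤ A) (u : sobolevOne) :
    ‖bladeTrace hA u‖ ^ 2 ≤ 2 * A * (‖(u : L2)‖ * ‖weakDeriv 1 u‖) := by
  obtain ⟨hΨ, f, h1, h2, h3⟩ := isBladeTrace_iff.mp (isBladeTrace_bladeTrace hA u)
  exact le_of_tendsto_of_tendsto' (h3.norm.pow 2) ((h1.norm.mul (h2 1).norm).const_mul (2 * A))
    fun n => norm_bladeRestrict_sq_le hA (f n)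

/-! ### The form of the cutoff Hamiltonian -/

theorem cutoffHamiltonian_iff {ω : ℝ} {L : ℕ} {u w : L2} : cutoffHamiltonian ω L u w ↔
    MemH 2 u ∧ toDist (-(w + (ω : ℂ) • cutoffAngular L u)) = Δ (u : 𝓢'(Space, ℂ)) := by
  rw [cutoffHamiltonian, angularMomentum_cutoffProjector]
  refine and_congr_right fun _ => ?_
  rw [map_neg, map_add, map_smul]
  simp only [Lp.toTemperedDistributionCLM_apply]
  constructor
  · intro h; rw [h]; abel
  · intro h; rw [← h]; abel

theorem cutoffHamiltonian.sub {ω : ℝ} {L : ℕ} {u w u' w' : L2} (h : cutoffHamiltonian ω L u w)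
    (h' : cutoffHamiltonian ω L u' w') : cutoffHamiltonian ω L (u - u') (w - w') := by
  rw [cutoffHamiltonian_iff] at *
  constructor
  · have := h.1.sub h'.1
    rwa [← Lp.toTemperedDistributionCLM_apply, ← Lp.toTemperedDistributionCLM_apply,
      ← map_sub] at this
  · have h1 : Δ ((u - u' : L2) : 𝓢'(Space, ℂ)) =
        Δ (u : 𝓢'(Space, ℂ)) - Δ (u' : 𝓢'(Space, ℂ)) := by
      rw [← TemperedDistribution.laplacianCLM_apply, ← TemperedDistribution.laplacianCLM_apply,
        ← TemperedDistribution.laplacianCLM_apply, ← map_sub]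
      congr 1
      exact toDist.map_sub u u'
    rw [h1, ← h.2, ← h'.2, ← map_sub, map_sub (cutoffAngular L), smul_sub]
    congr 1
    abel

theorem cutoffHamiltonian.mem_sobolevOne {ω : ℝ} {L : ℕ} {u w : L2}
    (h : cutoffHamiltonian ω L u w) : u ∈ sobolevOne :=
  TemperedDistribution.MemSobolev.mono (by norm_num) h.1

theorem cutoffHamiltonian.inner_eq {ω : ℝ} {L : ℕ} {u w : L2} {v : Fin 3 → L2}
    (h : cutoffHamiltonian ω L u w) (hv : ∀ i, IsWeakDeriv i u (v i)) : inner ℂ u w =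
      ((∑ i, ‖v i‖ ^ 2 : ℝ) : ℂ) - ω * inner ℂ u (cutoffAngular L u) := by
  rw [cutoffHamiltonian_iff] at h
  have h1 := inner_laplacian_eq h.1 h.2 hv
  rw [inner_neg_right, inner_add_right, inner_smul_right] at h1
  linear_combination -h1

theorem cutoffHamiltonian_toLp (ω : ℝ) (L : ℕ) (f : 𝓢(Space, ℂ)) :
    cutoffHamiltonian ω L (f.toLp 2 volume)
      (-(Δ f : 𝓢(Space, ℂ)).toLp 2 volume - (ω : ℂ) • cutoffAngular L (f.toLp 2 volume)) := by
  rw [cutoffHamiltonian_iff]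
  constructor
  · rw [MemH, Lp.toTemperedDistribution_toLp_eq]
    exact f.memSobolev
  · rw [sub_add_cancel, neg_neg, Lp.toTemperedDistributionCLM_apply,
      Lp.toTemperedDistribution_toLp_eq, Lp.toTemperedDistribution_toLp_eq]
    exact (TemperedDistribution.laplacian_toTemperedDistributionCLM_eq f).symm

theorem inner_cutoffAngular_self (L : ℕ) (u : L2) :
    inner ℂ u (cutoffAngular L u) = ((inner ℂ u (cutoffAngular L u)).re : ℂ) := by
  refine (Complex.conj_eq_iff_re.mp ?_).symm
  rw [inner_conj_symm, inner_cutoffAngular]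

theorem tendsto_sub_zero_of_tendsto {E : Type*} [NormedAddCommGroup E] {u : ℕ → E} {a : E}
    (h : Tendsto u atTop (𝓝 a)) : Tendsto (fun p : ℕ × ℕ => u p.1 - u p.2) atTop (𝓝 0) := by
  rw [← prod_atTop_atTop_eq]
  have := (h.comp tendsto_fst).sub (h.comp tendsto_snd)
  simpa using this

theorem continuous_inner_cutoffAngular (L : ℕ) :
    Continuous fun u : L2 => inner ℂ u (cutoffAngular L u) := by
  fun_prop

/-- The bounded term `ω ⟪u, J Π_L u⟫` is continuous in `L²`, so a sequence that is Cauchy for the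
form has Cauchy gradients. Its limit is then in `H¹` and the values converge to the explicit
expression. -/
theorem IsAssociatedFormValue.exists_eq {ω : ℝ} {L : ℕ} {Ψ : L2} {w : ℝ}
    (H : IsAssociatedFormValue (cutoffHamiltonian ω L) Ψ w) : ∃ h : Ψ ∈ sobolevOne,
      w = ∑ i, ‖weakDeriv i ⟨Ψ, h⟩‖ ^ 2 - ω * (inner ℂ Ψ (cutoffAngular L Ψ)).re := by
  have hB := continuous_inner_cutoffAngular L
  obtain ⟨u, w', hT, hu, hd, hv⟩ := H
  let U : ℕ → sobolevOne := fun n => ⟨u n, (hT n).mem_sobolevOne⟩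
  have hU : ∀ n i, IsWeakDeriv i (u n) (weakDeriv i (U n)) := fun n i =>
    isWeakDeriv_weakDeriv i (U n)
  have e2 := tendsto_sub_zero_of_tendsto hu
  have e3 : Tendsto (fun p : ℕ × ℕ => ((∑ i, ‖weakDeriv i (U p.1) - weakDeriv i (U p.2)‖ ^ 2 : ℝ) :
      ℂ)) atTop (𝓝 0) := by
    have := hd.add (((hB.tendsto 0).comp e2).const_mul (ω : ℂ))
    rw [inner_zero_left, mul_zero, add_zero] at this
    refine this.congr fun p => ?_
    rw [((hT p.1).sub (hT p.2)).inner_eq fun i => (hU p.1 i).sub (hU p.2 i)]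
    exact sub_add_cancel _ _
  have e4 : Tendsto (fun p : ℕ × ℕ => ∑ i, ‖weakDeriv i (U p.1 - U p.2)‖ ^ 2) atTop (𝓝 0) := by
    have := (Complex.continuous_re.tendsto _).comp e3
    simp only [map_sub]
    exact this
  obtain ⟨h, hw⟩ := exists_tendsto_weakDeriv (u := U) hu e4
  refine ⟨h, ?_⟩
  have e5 : Tendsto (fun n => inner ℂ (u n) (w' n)) atTop
      (𝓝 (((∑ i, ‖weakDeriv i ⟨Ψ, h⟩‖ ^ 2 : ℝ) : ℂ) - ω * inner ℂ Ψ (cutoffAngular L Ψ))) := by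
    have h5 : ∀ n, inner ℂ (u n) (w' n) = ((∑ i, ‖weakDeriv i (U n)‖ ^ 2 : ℝ) : ℂ) -
        ω * inner ℂ (u n) (cutoffAngular L (u n)) := fun n => (hT n).inner_eq (hU n)
    simp only [h5]
    refine Tendsto.sub ?_ (((hB.tendsto Ψ).comp hu).const_mul _)
    exact (Complex.continuous_ofReal.tendsto _).comp
      (tendsto_finsetSum _ fun i _ => (hw i).norm.pow 2)
  have h6 := congrArg Complex.re (tendsto_nhds_unique hv e5)
  rw [Complex.sub_re, Complex.ofReal_re, Complex.ofReal_re, Complex.re_ofReal_mul] at h6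
  exact h6

/-- Schwartz functions lie in the operator domain and are dense in `H¹`, so they serve as the
approximating sequence. -/
theorem isAssociatedFormValue_of_mem {ω : ℝ} {L : ℕ} {Ψ : L2} (h : Ψ ∈ sobolevOne) :
    IsAssociatedFormValue (cutoffHamiltonian ω L) Ψ
      (∑ i, ‖weakDeriv i ⟨Ψ, h⟩‖ ^ 2 - ω * (inner ℂ Ψ (cutoffAngular L Ψ)).re) := by
  have hB := continuous_inner_cutoffAngular L
  obtain ⟨f, h1, h2⟩ := exists_schwartz_tendsto_weakDeriv ⟨Ψ, h⟩
  have hH := fun n => cutoffHamiltonian_toLp ω L (f n)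
  refine ⟨fun n => (f n).toLp 2 volume, _, hH, h1, ?_, ?_⟩
  · have e2 := tendsto_sub_zero_of_tendsto h1
    have e4 := ((Complex.continuous_ofReal.tendsto _).comp
      (tendsto_finsetSum Finset.univ fun i _ =>
        (tendsto_sub_zero_of_tendsto (h2 i)).norm.pow 2)).sub
      (((hB.tendsto 0).comp e2).const_mul (ω : ℂ))
    simp only [norm_zero, ne_eq, OfNat.ofNat_ne_zero, not_false_eq_true, zero_pow,
      Finset.sum_const_zero, Complex.ofReal_zero, inner_zero_left, mul_zero, sub_zero] at e4
    refine e4.congr fun p => ?_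
    exact (((hH p.1).sub (hH p.2)).inner_eq fun i =>
      (isWeakDeriv_toLp i (f p.1)).sub (isWeakDeriv_toLp i (f p.2))).symm
  · rw [Complex.ofReal_sub, Complex.ofReal_mul, ← inner_cutoffAngular_self]
    have e4 := ((Complex.continuous_ofReal.tendsto _).comp
      (tendsto_finsetSum Finset.univ fun i _ => (h2 i).norm.pow 2)).sub
      (((hB.tendsto Ψ).comp h1).const_mul (ω : ℂ))
    exact e4.congr fun n => ((hH n).inner_eq fun i => isWeakDeriv_toLp i (f n)).symm

/-! ### The form of the blade -/

/-- Multiplication by a bounded real function on `L²(D, dμ_D)`. -/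
def bladeMul {A : ℝ} {α : Space → ℝ} (hα : MemLp α ∞ (bladeMeasure A)) :
    BladeL2 A →L[ℂ] BladeL2 A :=
  (ContinuousLinearMap.lsmul ℂ ℂ).holderL (bladeMeasure A) ∞ 2 2 (hα.ofReal (K := ℂ)).toLp

theorem coeFn_bladeMul {A : ℝ} {α : Space → ℝ} (hα : MemLp α ∞ (bladeMeasure A)) (τ : BladeL2 A) :
    (bladeMul hα τ : Space → ℂ) =ᵐ[bladeMeasure A] fun x => (α x : ℂ) * τ x := by
  have h := (ContinuousLinearMap.lsmul ℂ ℂ).coeFn_holder (r := 2)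
    (hα.ofReal (K := ℂ)).toLp τ
  filter_upwards [h, (hα.ofReal (K := ℂ)).coeFn_toLp] with x h1 h2
  refine h1.trans ?_
  rw [h2]
  rfl

theorem inner_bladeMul_left {A : ℝ} {α : Space → ℝ} (hα : MemLp α ∞ (bladeMeasure A))
    (τ σ : BladeL2 A) : inner ℂ (bladeMul hα τ) σ = inner ℂ τ (bladeMul hα σ) := by
  rw [L2.inner_def, L2.inner_def]
  apply integral_congr_ae
  filter_upwards [coeFn_bladeMul hα τ, coeFn_bladeMul hα σ] with x h1 h2
  rw [h1, h2]
  simp only [RCLike.inner_apply, map_mul, Complex.conj_ofReal]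
  ring

theorem inner_bladeMul_self {A : ℝ} {α : Space → ℝ} (hα : MemLp α ∞ (bladeMeasure A))
    (τ : BladeL2 A) :
    (inner ℂ τ (bladeMul hα τ)).re = ∫ x, α x * ‖τ x‖ ^ 2 ∂(bladeMeasure A) := by
  have : inner ℂ τ (bladeMul hα τ) = ((∫ x, α x * ‖τ x‖ ^ 2 ∂(bladeMeasure A) : ℝ) : ℂ) := by
    rw [L2.inner_def, ← integral_complex_ofReal]
    apply integral_congr_ae
    filter_upwards [coeFn_bladeMul hα τ] with x h1
    rw [h1]
    simp only [RCLike.inner_apply]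
    push_cast
    rw [← Complex.mul_conj']
    ring
  rw [this, Complex.ofReal_re]

/-- The sesquilinear form of the rotating blade, with domain `H¹`. -/
def bladeForm {A : ℝ} (hA : 0 ≤ A) (ω : ℝ) (L : ℕ) {α : Space → ℝ}
    (hα : MemLp α ∞ (bladeMeasure A)) : HermitianForm L2 where
  dom := sobolevOne
  form := LinearMap.mk₂'ₛₗ (starRingEnd ℂ) (RingHom.id ℂ)
    (fun u v => ∑ i, inner ℂ (weakDeriv i u) (weakDeriv i v) -
      ω * inner ℂ (u : L2) (cutoffAngular L (v : L2)) -
      inner ℂ (bladeTrace hA u) (bladeMul hα (bladeTrace hA v)))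
    (fun u u' v => by
      simp only [map_add, inner_add_left, Submodule.coe_add, Finset.sum_add_distrib]; ring)
    (fun c u v => by
      simp only [map_smul, inner_smul_left, Submodule.coe_smul, ← Finset.mul_sum, smul_eq_mul]
      ring)
    (fun u v v' => by
      simp only [map_add, inner_add_right, Submodule.coe_add, Finset.sum_add_distrib]; ring)
    (fun c u v => by
      simp only [map_smul, inner_smul_right, Submodule.coe_smul, ← Finset.mul_sum, smul_eq_mul,
        RingHom.id_apply]
      ring)
  hermitian u v := by
    simp only [LinearMap.mk₂'ₛₗ_apply, star_sub, star_sum, star_mul', Complex.star_def,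
      inner_conj_symm, Complex.conj_ofReal]
    rw [inner_cutoffAngular, inner_bladeMul_left]

theorem bladeForm_quad {A : ℝ} (hA : 0 ≤ A) (ω : ℝ) (L : ℕ) {α : Space → ℝ}
    (hα : MemLp α ∞ (bladeMeasure A)) (u : sobolevOne) :
    (bladeForm hA ω L hα).quad u = ∑ i, ‖weakDeriv i u‖ ^ 2 -
      ω * (inner ℂ (u : L2) (cutoffAngular L (u : L2))).re -
      (inner ℂ (bladeTrace hA u) (bladeMul hα (bladeTrace hA u))).re := by
  change (∑ i, inner ℂ (weakDeriv i u) (weakDeriv i u) -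
      ω * inner ℂ (u : L2) (cutoffAngular L (u : L2)) -
      inner ℂ (bladeTrace hA u) (bladeMul hα (bladeTrace hA u))).re = _
  rw [Complex.sub_re, Complex.sub_re, Complex.re_ofReal_mul, Complex.re_sum]
  congr 3
  ext i
  exact (inner_self_eq_norm_sq (𝕜 := ℂ) _)

theorem isBladeFormValue_iff {A : ℝ} (hA : 0 ≤ A) (ω : ℝ) (L : ℕ) {α : Space → ℝ}
    (hα : MemLp α ∞ (bladeMeasure A)) (Ψ : L2) (v : ℝ) :
    IsBladeFormValue A ω L α Ψ v ↔
      ∃ h : Ψ ∈ (bladeForm hA ω L hα).dom, v = (bladeForm hA ω L hα).quad ⟨Ψ, h⟩ := by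
  constructor
  · rintro ⟨w, τ, hw, hτ, rfl⟩
    obtain ⟨h, rfl⟩ := hw.exists_eq
    refine ⟨h, ?_⟩
    have h1 : τ = bladeTrace hA ⟨Ψ, h⟩ := hτ.unique hA (isBladeTrace_bladeTrace hA ⟨Ψ, h⟩)
    exact (by rw [h1, inner_bladeMul_self hα] :
      _ - ∫ x, α x * ‖τ x‖ ^ 2 ∂(bladeMeasure A) =
        _ - (inner ℂ (bladeTrace hA ⟨Ψ, h⟩) (bladeMul hα (bladeTrace hA ⟨Ψ, h⟩))).re).trans
      (bladeForm_quad hA ω L hα ⟨Ψ, h⟩).symm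
  · rintro ⟨h, rfl⟩
    refine ⟨_, _, isAssociatedFormValue_of_mem h, isBladeTrace_bladeTrace hA ⟨Ψ, h⟩, ?_⟩
    rw [← inner_bladeMul_self hα]
    exact bladeForm_quad hA ω L hα ⟨Ψ, h⟩

/-! ### Lower bound and closedness of the blade form -/

theorem abs_inner_cutoffAngular_le (L : ℕ) (u : L2) :
    |(inner ℂ u (cutoffAngular L u)).re| ≤ ‖cutoffAngular L‖ * ‖u‖ ^ 2 := by
  calc _ ≤ ‖inner ℂ u (cutoffAngular L u)‖ := Complex.abs_re_le_norm _
    _ ≤ ‖u‖ * ‖cutoffAngular L u‖ := norm_inner_le_norm _ _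
    _ ≤ ‖u‖ * (‖cutoffAngular L‖ * ‖u‖) := by gcongr; exact (cutoffAngular L).le_opNorm u
    _ = _ := by ring

theorem abs_inner_bladeMul_le {A : ℝ} (hA : 0 ≤ A) {α : Space → ℝ}
    (hα : MemLp α ∞ (bladeMeasure A)) (u : sobolevOne) :
    |(inner ℂ (bladeTrace hA u) (bladeMul hα (bladeTrace hA u))).re| ≤
      ‖bladeMul hα‖ * (2 * A * (‖(u : L2)‖ * ‖weakDeriv 1 u‖)) := by
  set τ := bladeTrace hA u
  calc _ ≤ ‖inner ℂ τ (bladeMul hα τ)‖ := Complex.abs_re_le_norm _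
    _ ≤ ‖τ‖ * ‖bladeMul hα τ‖ := norm_inner_le_norm _ _
    _ ≤ ‖τ‖ * (‖bladeMul hα‖ * ‖τ‖) := by gcongr; exact (bladeMul hα).le_opNorm τ
    _ = ‖bladeMul hα‖ * ‖τ‖ ^ 2 := by ring
    _ ≤ _ := by gcongr; exact norm_bladeTrace_sq_le hA u

/-- The Gårding inequality for the form of the blade. -/
theorem exists_garding {A : ℝ} (hA : 0 ≤ A) (ω : ℝ) (L : ℕ) {α : Space → ℝ}
    (hα : MemLp α ∞ (bladeMeasure A)) : ∃ C : ℝ, ∀ u : sobolevOne,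
      (∑ i, ‖weakDeriv i u‖ ^ 2) / 2 ≤ (bladeForm hA ω L hα).quad u + C * ‖(u : L2)‖ ^ 2 := by
  set M := ‖bladeMul hα‖ * (2 * A) with hM
  -- The blade term is at most `M ‖u‖ ‖∂_y u‖ ≤ M²/2 ‖u‖² + ½ ‖∂_y u‖²`; the last term is absorbed
  -- by half of the gradient.
  refine ⟨|ω| * ‖cutoffAngular L‖ + M ^ 2 / 2, fun u => ?_⟩
  have h1 := abs_inner_cutoffAngular_le L (u : L2)
  have h2 := abs_inner_bladeMul_le hA hα u
  have h0 : ‖bladeMul hα‖ * (2 * A * (‖(u : L2)‖ * ‖weakDeriv 1 u‖)) =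
      M * ‖(u : L2)‖ * ‖weakDeriv 1 u‖ := by rw [hM]; ring
  rw [h0] at h2
  rw [bladeForm_quad]
  have h3 : ω * (inner ℂ (u : L2) (cutoffAngular L (u : L2))).re ≤
      |ω| * (‖cutoffAngular L‖ * ‖(u : L2)‖ ^ 2) := by
    refine (le_abs_self _).trans ?_
    rw [abs_mul]
    gcongr
  have h4 : ‖weakDeriv 1 u‖ ^ 2 ≤ ∑ i, ‖weakDeriv i u‖ ^ 2 :=
    Finset.single_le_sum (f := fun i => ‖weakDeriv i u‖ ^ 2) (fun j _ => by positivity)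
      (Finset.mem_univ 1)
  have h5 := (le_abs_self _).trans h2
  nlinarith [sq_nonneg (M * ‖(u : L2)‖ - ‖weakDeriv 1 u‖)]

theorem bladeForm_isBoundedBelow {A : ℝ} (hA : 0 ≤ A) (ω : ℝ) (L : ℕ) {α : Space → ℝ}
    (hα : MemLp α ∞ (bladeMeasure A)) : (bladeForm hA ω L hα).IsBoundedBelow := by
  obtain ⟨C, hC⟩ := exists_garding hA ω L hα
  refine ⟨-C, fun u => ?_⟩
  have h1 := hC u
  have h2 : 0 ≤ (∑ i, ‖weakDeriv i u‖ ^ 2) / 2 := by positivity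
  change -C * ‖(u : L2)‖ ^ 2 ≤ _
  linarith

theorem tendsto_bladeForm_quad_zero {A : ℝ} (hA : 0 ≤ A) (ω : ℝ) (L : ℕ) {α : Space → ℝ}
    (hα : MemLp α ∞ (bladeMeasure A)) {d : ℕ → sobolevOne}
    (hd0 : Tendsto (fun n => (d n : L2)) atTop (𝓝 0))
    (hd : ∀ i, Tendsto (fun n => weakDeriv i (d n)) atTop (𝓝 0)) :
    Tendsto (fun n => (bladeForm hA ω L hα).quad (d n)) atTop (𝓝 0) := by
  have hb : Tendsto (fun n => (inner ℂ (bladeTrace hA (d n))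
      (bladeMul hα (bladeTrace hA (d n)))).re) atTop (𝓝 0) := by
    have h1 := ((hd0.norm.mul (hd 1).norm).const_mul (2 * A)).const_mul ‖bladeMul hα‖
    simp only [norm_zero, mul_zero] at h1
    exact squeeze_zero_norm (fun n => abs_inner_bladeMul_le hA hα _) h1
  have hB := ((Complex.continuous_re.tendsto _).comp
    (((continuous_inner_cutoffAngular L).tendsto 0).comp hd0)).const_mul ω
  have hs := ((tendsto_finsetSum Finset.univ fun i _ => (hd i).norm.pow 2).sub hB).sub hb
  simp only [norm_zero, ne_eq, OfNat.ofNat_ne_zero, not_false_eq_true, zero_pow,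
    Finset.sum_const_zero, inner_zero_left, Complex.zero_re, mul_zero, sub_zero] at hs
  exact hs.congr fun n => (bladeForm_quad hA ω L hα (d n)).symm

theorem exists_tendsto_weakDeriv_of_quad {A : ℝ} (hA : 0 ≤ A) (ω : ℝ) (L : ℕ) {α : Space → ℝ}
    (hα : MemLp α ∞ (bladeMeasure A)) {U : ℕ → sobolevOne} {Ψ : L2}
    (hu : Tendsto (fun n => (U n : L2)) atTop (𝓝 Ψ))
    (hq : Tendsto (fun p : ℕ × ℕ => (bladeForm hA ω L hα).quad (U p.1 - U p.2 : sobolevOne)) atTop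
      (𝓝 0)) :
    ∃ h : Ψ ∈ sobolevOne, ∀ i, Tendsto (fun n => weakDeriv i (U n)) atTop
      (𝓝 (weakDeriv i ⟨Ψ, h⟩)) := by
  obtain ⟨C, hC⟩ := exists_garding hA ω L hα
  refine exists_tendsto_weakDeriv hu ?_
  have h1 := ((tendsto_sub_zero_of_tendsto hu).norm.pow 2).const_mul C
  have h2 := (hq.add h1).const_mul 2
  simp only [norm_zero, ne_eq, OfNat.ofNat_ne_zero, not_false_eq_true, zero_pow, mul_zero,
    add_zero] at h2
  refine squeeze_zero (fun p => by positivity) (fun p => ?_) h2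
  have h3 := hC (U p.1 - U p.2)
  rw [div_le_iff₀ (by norm_num), mul_comm] at h3
  exact h3

/-- By the Gårding inequality, Cauchy in the form and convergent in `L²` means convergent in `H¹`;
conversely every term of the form is continuous for the `H¹` norm. -/
theorem bladeForm_isClosed {A : ℝ} (hA : 0 ≤ A) (ω : ℝ) (L : ℕ) {α : Space → ℝ}
    (hα : MemLp α ∞ (bladeMeasure A)) : (bladeForm hA ω L hα).IsClosed := by
  intro (u : ℕ → sobolevOne) Ψ hu hq
  obtain ⟨h, hw⟩ := exists_tendsto_weakDeriv_of_quad hA ω L hα hu hq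
  have hΨ : ∃ Φ : sobolevOne, Φ = ⟨Ψ, h⟩ := ⟨_, rfl⟩
  obtain ⟨Φ, hΦ⟩ := hΨ
  have hd : ∀ i, Tendsto (fun n => weakDeriv i (u n - Φ)) atTop (𝓝 0) := by
    intro i
    simp only [map_sub]
    rw [← sub_self (weakDeriv i Φ)]
    refine Tendsto.sub_const ?_ _
    rw [hΦ]
    exact hw i
  have hd0 : Tendsto (fun n => ((u n - Φ : sobolevOne) : L2)) atTop (𝓝 0) := by
    have h1 : (Φ : L2) = Ψ := by rw [hΦ]
    rw [← sub_self Ψ, ← h1]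
    rw [← h1] at hu
    exact hu.sub_const (Φ : L2)
  refine ⟨h, ?_⟩
  have := tendsto_bladeForm_quad_zero hA ω L hα hd0 hd
  rw [hΦ] at this
  exact this

/-! ### Spherical Bessel functions -/

/-- The entire even function `j_l(s) / s^l`. -/
def reducedBessel (l : ℕ) (s : ℝ) : ℝ :=
  1 / (2 ^ (l + 1) * l.factorial) * ∫ t in (-1 : ℝ)..1, Real.cos (s * t) * (1 - t ^ 2) ^ l

theorem sphericalBessel_eq (l : ℕ) (s : ℝ) : sphericalBessel l s = s ^ l * reducedBessel l s := by
  rw [sphericalBessel, reducedBessel]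
  ring

/-- Integration by parts, with `t (1-t²)^l` as the derivative of `-(1-t²)^{l+1} / (2(l+1))`, which
vanishes at `±1`. -/
theorem integral_sin_mul_eq (l : ℕ) (s : ℝ) :
    ∫ t in (-1 : ℝ)..1, Real.sin (s * t) * (t * (1 - t ^ 2) ^ l) =
      s / (2 * (l + 1)) * ∫ t in (-1 : ℝ)..1, Real.cos (s * t) * (1 - t ^ 2) ^ (l + 1) := by
  have hu : ∀ t ∈ uIcc (-1 : ℝ) 1, HasDerivAt (fun t => Real.sin (s * t)) (Real.cos (s * t) * s) t :=
    fun t _ => by simpa using ((hasDerivAt_id t).const_mul s).sin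
  have hv : ∀ t ∈ uIcc (-1 : ℝ) 1,
      HasDerivAt (fun t : ℝ => -(1 - t ^ 2) ^ (l + 1) / (2 * (l + 1))) (t * (1 - t ^ 2) ^ l) t := by
    intro t _
    have h := (((((hasDerivAt_id t).pow 2).const_sub 1).pow (l + 1)).neg).div_const
      (2 * ((l : ℝ) + 1))
    have hl : (2 * ((l : ℝ) + 1)) ≠ 0 := by positivity
    refine h.congr_deriv ?_
    simp
    field_simp
  rw [intervalIntegral.integral_mul_deriv_eq_deriv_mul hu hv
    (Continuous.intervalIntegrable (by fun_prop) _ _)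
    (Continuous.intervalIntegrable (by fun_prop) _ _), ← intervalIntegral.integral_const_mul]
  simp only [one_pow, sub_self, ne_eq, Nat.add_eq_zero_iff, one_ne_zero, and_false,
    not_false_eq_true, zero_pow, neg_zero, zero_div, mul_zero, even_two, Even.neg_pow, zero_sub]
  rw [← intervalIntegral.integral_neg]
  congr 1
  ext t
  ring

/-- Differentiating Poisson's integral produces `-t sin(st)`, and the integration by parts above
turns it into the integral of order `l + 1`. This recurrence drives the induction behind the
Bochner–Hecke formula. -/
theorem hasDerivAt_reducedBessel (l : ℕ) (s : ℝ) :
    HasDerivAt (reducedBessel l) (-s * reducedBessel (l + 1) s) s := by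
  have h := (intervalIntegral.hasDerivAt_integral_of_dominated_loc_of_deriv_le (μ := volume)
    (a := -1) (b := 1) (s := univ) (x₀ := s) (bound := fun _ => 1)
    (F := fun s t => Real.cos (s * t) * (1 - t ^ 2) ^ l)
    (F' := fun s t => -Real.sin (s * t) * t * (1 - t ^ 2) ^ l) univ_mem
    (Eventually.of_forall fun s => Continuous.aestronglyMeasurable (by fun_prop))
    (Continuous.intervalIntegrable (by fun_prop) _ _)
    (Continuous.aestronglyMeasurable (by fun_prop)) ?_ intervalIntegrable_const ?_).2
  · have h2 := h.const_mul (1 / (2 ^ (l + 1) * (l.factorial : ℝ)))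
    have h3 : 1 / (2 ^ (l + 1) * (l.factorial : ℝ)) *
        (∫ t in (-1 : ℝ)..1, -Real.sin (s * t) * t * (1 - t ^ 2) ^ l) =
        -s * reducedBessel (l + 1) s := by
      have : (∫ t in (-1 : ℝ)..1, -Real.sin (s * t) * t * (1 - t ^ 2) ^ l) =
          -∫ t in (-1 : ℝ)..1, Real.sin (s * t) * (t * (1 - t ^ 2) ^ l) := by
        rw [← intervalIntegral.integral_neg]
        congr 1
        ext t
        ring
      rw [this, integral_sin_mul_eq, reducedBessel, Nat.factorial_succ]
      push_cast
      field_simp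
      ring
    rw [h3] at h2
    exact h2
  · refine ae_of_all _ fun t ht s _ => ?_
    rw [uIoc_of_le (by norm_num)] at ht
    rw [norm_mul, norm_mul, norm_neg, norm_pow]
    have h1 : ‖Real.sin (s * t)‖ ≤ 1 := Real.abs_sin_le_one _
    have h2 : ‖t‖ ≤ 1 := abs_le.mpr ⟨ht.1.le, ht.2⟩
    have h3 : ‖1 - t ^ 2‖ ≤ 1 := by
      rw [Real.norm_eq_abs, abs_le]
      constructor <;> nlinarith [ht.1, ht.2]
    exact mul_le_one₀ (mul_le_one₀ h1 (norm_nonneg _) h2) (by positivity)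
      (pow_le_one₀ (norm_nonneg _) h3)
  · refine ae_of_all _ fun t _ s _ => ?_
    have h1 : HasDerivAt (fun s => Real.cos (s * t)) (-Real.sin (s * t) * t) s := by
      simpa using ((hasDerivAt_id s).mul_const t).cos
    exact h1.mul_const _

theorem continuous_reducedBessel (l : ℕ) : Continuous (reducedBessel l) :=
  continuous_iff_continuousAt.mpr fun s => (hasDerivAt_reducedBessel l s).continuousAt

theorem exists_reducedBessel_bound (l : ℕ) : ∃ C, ∀ s, |reducedBessel l s| ≤ C := by
  refine ⟨|1 / (2 ^ (l + 1) * (l.factorial : ℝ))| * 2, fun s => ?_⟩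
  rw [reducedBessel, abs_mul]
  gcongr
  have := intervalIntegral.norm_integral_le_of_norm_le_const (a := -1) (b := 1) (C := 1)
    (f := fun t => Real.cos (s * t) * (1 - t ^ 2) ^ l) ?_
  · norm_num at this
    exact this
  · intro t ht
    rw [uIoc_of_le (by norm_num)] at ht
    rw [norm_mul, norm_pow]
    have h1 : ‖Real.cos (s * t)‖ ≤ 1 := Real.abs_cos_le_one _
    have h3 : ‖1 - t ^ 2‖ ≤ 1 := by
      rw [Real.norm_eq_abs, abs_le]
      constructor <;> nlinarith [ht.1, ht.2]
    exact mul_le_one₀ h1 (by positivity) (pow_le_one₀ (norm_nonneg _) h3)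

/-! ### Decay of spherical Bessel functions -/

/-- The Fourier integral of a polynomial over `[-1, 1]`. -/
def polynomialFourier (q : Polynomial ℂ) (s : ℝ) : ℂ :=
  ∫ t in (-1 : ℝ)..1, Complex.exp (s * t * Complex.I) * q.eval (t : ℂ)

theorem polynomialFourier_by_parts (q : Polynomial ℂ) (s : ℝ) :
    s * Complex.I * polynomialFourier q s = Complex.exp (s * Complex.I) * q.eval 1 -
      Complex.exp (-(s * Complex.I)) * q.eval (-1) - polynomialFourier q.derivative s := by
  have hd : ∀ t ∈ uIcc (-1 : ℝ) 1, HasDerivAt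
      (fun t : ℝ => Complex.exp (s * t * Complex.I) * q.eval (t : ℂ))
      (s * Complex.I * (Complex.exp (s * t * Complex.I) * q.eval (t : ℂ)) +
        Complex.exp (s * t * Complex.I) * q.derivative.eval (t : ℂ)) t := by
    intro t _
    have h1 : HasDerivAt (fun t : ℝ => (s : ℂ) * (t : ℂ) * Complex.I) (s * Complex.I) t := by
      have := ((hasDerivAt_id t).ofReal_comp.const_mul (s : ℂ)).mul_const Complex.I
      simp only [id_eq, Complex.ofReal_one, mul_one] at this
      exact this
    have h2 : HasDerivAt (fun t : ℝ => q.eval (t : ℂ)) (q.derivative.eval (t : ℂ)) t :=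
      (q.hasDerivAt (t : ℂ)).comp_ofReal
    have := h1.cexp.mul h2
    refine this.congr_deriv ?_
    ring
  have hc1 : Continuous fun t : ℝ => Complex.exp (s * t * Complex.I) * q.eval (t : ℂ) := by fun_prop
  have hc2 : Continuous fun t : ℝ => Complex.exp (s * t * Complex.I) * q.derivative.eval (t : ℂ) := by
    fun_prop
  have h := intervalIntegral.integral_eq_sub_of_hasDerivAt hd
    (((continuous_const.mul hc1).add hc2).intervalIntegrable _ _)
  have hc3 : Continuous fun t : ℝ =>
      s * Complex.I * (Complex.exp (s * t * Complex.I) * q.eval (t : ℂ)) := by fun_prop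
  rw [intervalIntegral.integral_add (hc3.intervalIntegrable _ _)
    (hc2.intervalIntegrable _ _), intervalIntegral.integral_const_mul] at h
  simp only [Complex.ofReal_one, mul_one, Complex.ofReal_neg, mul_neg, neg_mul] at h
  rw [polynomialFourier, polynomialFourier]
  linear_combination h

theorem exists_polynomialFourier_bound_zero (q : Polynomial ℂ) :
    ∃ C, ∀ s, ‖polynomialFourier q s‖ ≤ C := by
  obtain ⟨C, hC⟩ := (isCompact_Icc (a := (-1 : ℝ)) (b := 1)).exists_bound_of_continuousOn
    (f := fun t : ℝ => q.eval (t : ℂ)) (by fun_prop)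
  refine ⟨C * |1 - (-1)|, fun s => intervalIntegral.norm_integral_le_of_norm_le_const fun t ht => ?_⟩
  rw [uIoc_of_le (by norm_num)] at ht
  rw [norm_mul, ← Complex.ofReal_mul, Complex.norm_exp_ofReal_mul_I, one_mul]
  exact hC t ⟨ht.1.le, ht.2⟩

/-- Each integration by parts gains a factor `1/s`. The boundary terms vanish as long as a factor `1
- t²` remains, and the last step, without it, gains one more power. The cofactor `q` is arbitrary
because the derivative changes it. -/
theorem exists_polynomialFourier_bound (n : ℕ) : ∀ q : Polynomial ℂ, ∃ C, ∀ s : ℝ,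
    ‖(s : ℂ) ^ (n + 1) * polynomialFourier ((1 - Polynomial.X ^ 2) ^ n * q) s‖ ≤ C := by
  have hexp : ∀ s : ℝ, ‖Complex.exp (-(s * Complex.I))‖ = 1 := fun s => by
    have := Complex.norm_exp_ofReal_mul_I (-s)
    simpa using this
  induction n with
  | zero =>
    intro q
    obtain ⟨C, hC⟩ := exists_polynomialFourier_bound_zero q.derivative
    refine ⟨‖q.eval 1‖ + ‖q.eval (-1)‖ + C, fun s => ?_⟩
    have h := polynomialFourier_by_parts q s
    have h2 : ‖(s : ℂ) * polynomialFourier q s‖ = ‖s * Complex.I * polynomialFourier q s‖ := by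
      simp
    rw [pow_zero, one_mul, zero_add, pow_one, h2, h]
    refine (norm_sub_le _ _).trans (add_le_add ((norm_sub_le _ _).trans ?_) (hC s))
    rw [norm_mul, norm_mul, Complex.norm_exp_ofReal_mul_I, hexp, one_mul, one_mul]
  | succ n ih =>
    intro q
    obtain ⟨C, hC⟩ := ih (-2 * (n + 1 : Polynomial ℂ) * Polynomial.X * q +
      (1 - Polynomial.X ^ 2) * q.derivative)
    refine ⟨C, fun s => ?_⟩
    have h := polynomialFourier_by_parts ((1 - Polynomial.X ^ 2) ^ (n + 1) * q) s
    have hd : Polynomial.derivative ((1 - Polynomial.X ^ 2) ^ (n + 1) * q) =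
        (1 - Polynomial.X ^ 2) ^ n * (-2 * (n + 1 : Polynomial ℂ) * Polynomial.X * q +
          (1 - Polynomial.X ^ 2) * q.derivative) := by
      simp only [Polynomial.derivative_mul, Polynomial.derivative_pow, Polynomial.derivative_sub,
        Polynomial.derivative_one, Polynomial.derivative_X, add_tsub_cancel_right, Nat.cast_add,
        Nat.cast_one, map_add, map_natCast, map_one, Nat.cast_ofNat, map_ofNat]
      ring
    rw [hd] at h
    simp only [Polynomial.eval_mul, Polynomial.eval_pow, Polynomial.eval_sub, Polynomial.eval_one,
      Polynomial.eval_X, one_pow, sub_self, ne_eq, Nat.add_eq_zero_iff, one_ne_zero, and_false,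
      not_false_eq_true, zero_pow, zero_mul, mul_zero, even_two, Even.neg_pow, zero_sub] at h
    have h2 : ‖(s : ℂ) ^ (n + 1 + 1) * polynomialFourier ((1 - Polynomial.X ^ 2) ^ (n + 1) * q) s‖ =
        ‖(s : ℂ) ^ (n + 1) *
          (s * Complex.I * polynomialFourier ((1 - Polynomial.X ^ 2) ^ (n + 1) * q) s)‖ := by
      simp only [norm_mul, norm_pow, Complex.norm_I]
      ring
    rw [h2, h, mul_neg, norm_neg]
    exact hC s

/-- `s j_l(s)` is bounded. -/
theorem exists_mul_sphericalBessel_bound (l : ℕ) :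
    ∃ C, 0 ≤ C ∧ ∀ s, |s * sphericalBessel l s| ≤ C := by
  obtain ⟨C, hC⟩ := exists_polynomialFourier_bound l 1
  have hC0 : 0 ≤ C := (norm_nonneg _).trans (hC 0)
  refine ⟨1 / (2 ^ (l + 1) * (l.factorial : ℝ)) * C, by positivity, fun s => ?_⟩
  -- Poisson's integral is the real part of the Fourier integral of `(1-t²)^l`, so the decay of
  -- order `l + 1` cancels the factor `s · s^l`.
  have h1 : (polynomialFourier ((1 - Polynomial.X ^ 2) ^ l * 1) s).re =
      ∫ t in (-1 : ℝ)..1, Real.cos (s * t) * (1 - t ^ 2) ^ l := by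
    have hc : Continuous fun t : ℝ => Complex.exp (s * t * Complex.I) *
        Polynomial.eval (t : ℂ) ((1 - Polynomial.X ^ 2) ^ l * 1) := by fun_prop
    have := (Complex.reCLM.intervalIntegral_comp_comm (hc.intervalIntegrable (μ := volume) (-1) 1))
    rw [polynomialFourier, ← Complex.reCLM_apply, ← this]
    congr 1
    ext t
    have h2 : Polynomial.eval (t : ℂ) ((1 - Polynomial.X ^ 2) ^ l * 1) =
        (((1 - t ^ 2) ^ l : ℝ) : ℂ) := by simp
    rw [h2, Complex.reCLM_apply, Complex.re_mul_ofReal, ← Complex.ofReal_mul,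
      Complex.exp_ofReal_mul_I_re]
  rw [sphericalBessel_eq, reducedBessel, ← h1]
  have h3 : s * (s ^ l * (1 / (2 ^ (l + 1) * (l.factorial : ℝ)) *
      (polynomialFourier ((1 - Polynomial.X ^ 2) ^ l * 1) s).re)) =
      1 / (2 ^ (l + 1) * (l.factorial : ℝ)) *
        ((s : ℂ) ^ (l + 1) * polynomialFourier ((1 - Polynomial.X ^ 2) ^ l * 1) s).re := by
    rw [← Complex.ofReal_pow, Complex.re_ofReal_mul]
    ring
  rw [h3, abs_mul, abs_of_nonneg (by positivity)]
  gcongr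
  exact (Complex.abs_re_le_norm _).trans (hC s)

/-! ### The Fourier transform of radial functions times null powers -/

theorem norm_insertCoord (i : Fin 3) (z : ℝ) (q : ℝ × ℝ) :
    ‖insertCoord i (z, q)‖ = √(z ^ 2 + (q.1 ^ 2 + q.2 ^ 2)) := by
  rw [EuclideanSpace.norm_eq]
  congr 1
  rw [Fin.sum_univ_succAbove _ i, Fin.sum_univ_two]
  simp [insertCoord]

/-- Polar coordinates `ρ` in the slice at height `z`, then `r = √(z² + ρ²)`, for which `r dr = ρ
dρ`. -/
theorem integral_prod_radial (z : ℝ) (h : ℝ → ℂ) :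
    ∫ q : ℝ × ℝ, h √(z ^ 2 + (q.1 ^ 2 + q.2 ^ 2)) =
      2 * Real.pi * ∫ r in Ioi |z|, r * h r := by
  rw [← integral_comp_polarCoord_symm]
  have h1 : ∫ p in polarCoord.target, p.1 • h √(z ^ 2 + ((polarCoord.symm p).1 ^ 2 +
      (polarCoord.symm p).2 ^ 2)) =
      ∫ p in Ioi (0 : ℝ) ×ˢ Ioo (-Real.pi) Real.pi, (p.1 * h √(z ^ 2 + p.1 ^ 2)) * (1 : ℂ) := by
    rw [polarCoord_target]
    refine setIntegral_congr_fun (measurableSet_Ioi.prod measurableSet_Ioo) fun p _ => ?_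
    simp only [polarCoord_symm_apply, Complex.real_smul, mul_one]
    have : (p.1 * Real.cos p.2) ^ 2 + (p.1 * Real.sin p.2) ^ 2 = p.1 ^ 2 := by
      linear_combination p.1 ^ 2 * Real.sin_sq_add_cos_sq p.2
    rw [this]
  rw [h1, Measure.volume_eq_prod, setIntegral_prod_mul (fun r : ℝ => (r : ℂ) * h √(z ^ 2 + r ^ 2))
    (fun _ => (1 : ℂ))]
  have h2 : ∫ _ in Ioo (-Real.pi) Real.pi, (1 : ℂ) = 2 * Real.pi := by
    rw [setIntegral_const, Real.volume_real_Ioo_of_le (by linarith [Real.pi_pos])]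
    simp
    ring
  have himg : (fun ρ : ℝ => √(z ^ 2 + ρ ^ 2)) '' Ioi 0 = Ioi |z| := by
    ext r
    simp only [mem_image, mem_Ioi]
    constructor
    · rintro ⟨ρ, hρ, rfl⟩
      apply Real.lt_sqrt_of_sq_lt
      rw [sq_abs]
      nlinarith
    · intro hr
      have hr0 : 0 < r := (abs_nonneg z).trans_lt hr
      have hlt : z ^ 2 < r ^ 2 := by
        rw [← sq_abs z]
        exact pow_lt_pow_left₀ hr (abs_nonneg z) (by norm_num)
      refine ⟨√(r ^ 2 - z ^ 2), Real.sqrt_pos.mpr (by linarith), ?_⟩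
      rw [Real.sq_sqrt (by linarith), add_sub_cancel, Real.sqrt_sq hr0.le]
  have h3 : ∫ r in Ioi |z|, (r : ℂ) * h r = ∫ ρ in Ioi 0, ρ * h √(z ^ 2 + ρ ^ 2) := by
    rw [← himg, integral_image_eq_integral_abs_deriv_smul (f' := fun ρ => ρ / √(z ^ 2 + ρ ^ 2))
      measurableSet_Ioi]
    · refine setIntegral_congr_fun measurableSet_Ioi fun ρ hρ => ?_
      have hρ0 : 0 < ρ := hρ
      have hs : 0 < √(z ^ 2 + ρ ^ 2) := Real.sqrt_pos.mpr (by positivity)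
      simp only [Complex.real_smul]
      rw [abs_of_pos (by positivity)]
      push_cast
      have : ((√(z ^ 2 + ρ ^ 2) : ℝ) : ℂ) ≠ 0 := by exact_mod_cast hs.ne'
      field_simp
    · intro ρ hρ
      have hρ0 : 0 < ρ := hρ
      have hd : HasDerivAt (fun ρ : ℝ => z ^ 2 + ρ ^ 2) (2 * ρ) ρ := by
        simpa using ((hasDerivAt_id ρ).pow 2).const_add (z ^ 2)
      have := (hd.sqrt (by positivity)).hasDerivWithinAt (s := Ioi 0)
      refine this.congr_deriv ?_
      field_simp
    · intro x hx y hy hxy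
      have hx0 : 0 < x := hx
      have hy0 : 0 < y := hy
      have := (Real.sqrt_inj (by positivity) (by positivity)).mp hxy
      nlinarith
  rw [h2, h3]
  ring

theorem integral_exp_symm_interval {s r : ℝ} (hs : s ≠ 0) (hr : r ≠ 0) :
    ∫ z in (-r)..r, Complex.exp (s * z * Complex.I) = 2 * r * reducedBessel 0 (s * r) := by
  have h1 : reducedBessel 0 (s * r) = Real.sin (s * r) / (s * r) := by
    have hd : ∀ t ∈ uIcc (-1 : ℝ) 1, HasDerivAt (fun t => Real.sin (s * r * t) / (s * r))
        (Real.cos (s * r * t) * (1 - t ^ 2) ^ 0) t := by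
      intro t _
      have := (((hasDerivAt_id t).const_mul (s * r)).sin).div_const (s * r)
      refine this.congr_deriv ?_
      simp
      field_simp
    rw [reducedBessel, intervalIntegral.integral_eq_sub_of_hasDerivAt hd
      (Continuous.intervalIntegrable (by fun_prop) _ _)]
    simp
    field_simp
    ring
  have hs' : (s : ℂ) ≠ 0 := by exact_mod_cast hs
  have hr' : (r : ℂ) ≠ 0 := by exact_mod_cast hr
  have h2 : ∫ z in (-r)..r, Complex.exp (s * z * Complex.I) =
      (Complex.exp (s * r * Complex.I) - Complex.exp (-(s * r * Complex.I))) / (s * Complex.I) := by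
    have := integral_exp_mul_complex (a := -r) (b := r) (c := s * Complex.I)
      (mul_ne_zero hs' Complex.I_ne_zero)
    have e : ∀ z : ℝ, Complex.exp (s * z * Complex.I) = Complex.exp (s * Complex.I * z) := by
      intro z; congr 1; ring
    simp only [e]
    rw [this]
    push_cast
    congr 3
    ring_nf
  rw [h2, h1]
  push_cast
  rw [Complex.sin]
  field_simp
  rw [Complex.I_sq]
  ring_nf

/-- Bounded functions of a radius with bounded support. -/
structure IsBoundedRadial (h : ℝ → ℂ) : Prop where
  measurable : Measurable h
  exists_bound : ∃ M, 0 ≤ M ∧ ∀ r, ‖h r‖ ≤ M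
  exists_support : ∃ R, 0 ≤ R ∧ ∀ r, R < r → h r = 0

theorem IsBoundedRadial.integrable_mul {h : ℝ → ℂ} (hh : IsBoundedRadial h) {g : Space → ℂ}
    (hg : Continuous g) : Integrable fun x : Space => h ‖x‖ * g x := by
  obtain ⟨M, hM, hb⟩ := hh.exists_bound
  obtain ⟨R, hR, hs⟩ := hh.exists_support
  obtain ⟨C, hC⟩ := (isCompact_closedBall (0 : Space) R).exists_bound_of_continuousOn
    hg.continuousOn
  have hm : AEStronglyMeasurable (fun x : Space => h ‖x‖ * g x) volume :=
    ((hh.measurable.comp measurable_norm).mul hg.measurable).aestronglyMeasurable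
  have h1 : IntegrableOn (fun x : Space => h ‖x‖ * g x) (Metric.closedBall 0 R) := by
    refine Measure.integrableOn_of_bounded (M := M * C)
      (isCompact_closedBall (0 : Space) R).measure_lt_top.ne hm ?_
    filter_upwards [ae_restrict_mem measurableSet_closedBall] with x hx
    rw [norm_mul]
    exact mul_le_mul (hb _) (hC x hx) (norm_nonneg _) hM
  refine (integrableOn_iff_integrable_of_support_subset ?_).mp h1
  intro x hx
  by_contra hc
  apply hx
  rw [mem_closedBall_zero_iff, not_le] at hc
  simp [hs _ hc]

theorem IsBoundedRadial.integrableOn_mul {h : ℝ → ℂ} (hh : IsBoundedRadial h) {g : ℝ → ℂ}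
    (hg : Continuous g) : IntegrableOn (fun r => h r * g r) (Ioi 0) := by
  obtain ⟨M, hM, hb⟩ := hh.exists_bound
  obtain ⟨R, hR, hs⟩ := hh.exists_support
  obtain ⟨C, hC⟩ := (isCompact_Icc (a := (0 : ℝ)) (b := R)).exists_bound_of_continuousOn
    hg.continuousOn
  have hm : AEStronglyMeasurable (fun r => h r * g r) volume :=
    (hh.measurable.mul hg.measurable).aestronglyMeasurable
  have h1 : IntegrableOn (fun r => h r * g r) (Icc 0 R) := by
    refine Measure.integrableOn_of_bounded (M := M * C)
      (isCompact_Icc (a := (0 : ℝ)) (b := R)).measure_lt_top.ne hm ?_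
    filter_upwards [ae_restrict_mem measurableSet_Icc] with x hx
    rw [norm_mul]
    exact mul_le_mul (hb _) (hC x hx) (norm_nonneg _) hM
  refine h1.of_forall_sdiff_eq_zero measurableSet_Ioi fun r hr => ?_
  have : R < r := by
    by_contra hc
    exact hr.2 ⟨le_of_lt hr.1, not_lt.mp hc⟩
  simp [hs _ this]

/-- The radial part of the Fourier transform of a radial function times a solid harmonic. -/
def radialTransform (h : ℝ → ℂ) (l : ℕ) (s : ℝ) : ℂ :=
  ∫ r in Ioi (0 : ℝ), h r * (r ^ (2 * l + 2) * reducedBessel l (s * r) : ℝ)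

/-- Slicing perpendicular to the axis leaves `2π r h(r)` integrated over `r > |z|`; exchanging the
integrals gives `∫ e^{isz} dz` over `|z| < r`, which is elementary. -/
theorem integral_exp_mul_radial_axis {h : ℝ → ℂ} (hh : IsBoundedRadial h) {s : ℝ} (hs : s ≠ 0) :
    ∫ x : Space, h ‖x‖ * Complex.exp (s * (x 2 : ℝ) * Complex.I) =
      4 * Real.pi * radialTransform h 0 s := by
  have hint : Integrable fun x : Space => h ‖x‖ * Complex.exp (s * (x 2 : ℝ) * Complex.I) :=
    hh.integrable_mul (by fun_prop)
  have hmp := measurePreserving_insertCoord 2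
  have hint2 : Integrable (fun q : ℝ × ℝ × ℝ => h ‖insertCoord 2 q‖ *
      Complex.exp (s * (insertCoord 2 q 2 : ℝ) * Complex.I)) (volume.prod volume) :=
    hmp.integrable_comp_of_integrable hint
  have e1 : ∫ x : Space, h ‖x‖ * Complex.exp (s * (x 2 : ℝ) * Complex.I) =
      ∫ q : ℝ × ℝ × ℝ, h ‖insertCoord 2 q‖ *
        Complex.exp (s * (insertCoord 2 q 2 : ℝ) * Complex.I) := by
    rw [← hmp.map_eq, integral_map hmp.measurable.aemeasurable]
    rw [hmp.map_eq]
    exact hint.aestronglyMeasurable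
  rw [e1, Measure.volume_eq_prod, integral_prod _ hint2]
  have e2 : ∀ z : ℝ, ∫ q : ℝ × ℝ, h ‖insertCoord 2 (z, q)‖ *
      Complex.exp (s * (insertCoord 2 (z, q) 2 : ℝ) * Complex.I) =
      ∫ r in Ioi (0 : ℝ), 2 * Real.pi * (Ioo (-r) r).indicator
        (fun z => r * h r * Complex.exp (s * z * Complex.I)) z := by
    intro z
    have hz : ∀ q, (insertCoord 2 (z, q)) 2 = z := fun q => by simp [insertCoord]
    simp only [norm_insertCoord, hz]
    rw [integral_mul_const, integral_prod_radial, integral_const_mul, mul_assoc,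
      ← integral_mul_const, ← integral_indicator measurableSet_Ioi,
      ← integral_indicator measurableSet_Ioi]
    congr 2
    ext r
    by_cases hr : r ∈ Ioi |z|
    · have h0 : r ∈ Ioi (0 : ℝ) := (abs_nonneg z).trans_lt hr
      have h1 : z ∈ Ioo (-r) r := abs_lt.mp hr
      rw [indicator_of_mem hr, indicator_of_mem h0, indicator_of_mem h1]
    · have h1 : z ∉ Ioo (-r) r := fun h => hr (abs_lt.mpr h)
      rw [indicator_of_notMem hr, indicator_apply]
      split_ifs
      · rw [indicator_of_notMem h1]
      · rfl
  simp only [e2]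
  rw [integral_integral_swap]
  · rw [radialTransform, ← integral_const_mul]
    refine setIntegral_congr_fun measurableSet_Ioi fun r hr => ?_
    have hr0 : 0 < r := hr
    rw [integral_const_mul, integral_indicator measurableSet_Ioo, integral_const_mul,
      ← integral_Ioc_eq_integral_Ioo, ← intervalIntegral.integral_of_le (by linarith),
      integral_exp_symm_interval hs hr0.ne']
    push_cast
    ring
  · obtain ⟨M, hM, hb⟩ := hh.exists_bound
    obtain ⟨R, hR, hsup⟩ := hh.exists_support
    have hms : MeasurableSet {p : ℝ × ℝ | p.1 ∈ Ioo (-p.2) p.2} :=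
      (measurableSet_lt (f := fun p : ℝ × ℝ => -p.2) (g := Prod.fst) (by fun_prop)
        (by fun_prop)).inter (measurableSet_lt (f := Prod.fst) (g := Prod.snd) (by fun_prop)
        (by fun_prop))
    have hmeas : Measurable fun p : ℝ × ℝ => 2 * (Real.pi : ℂ) * (Ioo (-p.2) p.2).indicator
        (fun z => p.2 * h p.2 * Complex.exp (s * z * Complex.I)) p.1 := by
      have h0 : (fun p : ℝ × ℝ => (Ioo (-p.2) p.2).indicator
          (fun z => p.2 * h p.2 * Complex.exp (s * z * Complex.I)) p.1) =
          {p : ℝ × ℝ | p.1 ∈ Ioo (-p.2) p.2}.indicator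
            (fun p => p.2 * h p.2 * Complex.exp (s * p.1 * Complex.I)) := rfl
      refine Measurable.const_mul ?_ _
      rw [h0]
      refine Measurable.indicator ?_ hms
      have := hh.measurable
      fun_prop
    have hμ : (volume : Measure ℝ).prod (volume.restrict (Ioi (0 : ℝ))) =
        (volume.prod volume).restrict (univ ×ˢ Ioi 0) := by
      rw [← Measure.prod_restrict, Measure.restrict_univ]
    rw [hμ]
    have h1 : IntegrableOn (fun p : ℝ × ℝ => 2 * (Real.pi : ℂ) * (Ioo (-p.2) p.2).indicator
        (fun z => p.2 * h p.2 * Complex.exp (s * z * Complex.I)) p.1) (Icc (-R) R ×ˢ Icc 0 R)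
        (volume.prod volume) := by
      refine Measure.integrableOn_of_bounded (M := 2 * Real.pi * (R * M))
        (isCompact_Icc.prod isCompact_Icc).measure_lt_top.ne hmeas.aestronglyMeasurable ?_
      filter_upwards [ae_restrict_mem (measurableSet_Icc.prod measurableSet_Icc)] with p hp
      rw [norm_mul, norm_mul, Complex.norm_real, Complex.norm_ofNat,
        Real.norm_of_nonneg Real.pi_pos.le]
      gcongr
      refine (norm_indicator_le_norm_self _ _).trans ?_
      rw [norm_mul, ← Complex.ofReal_mul, Complex.norm_exp_ofReal_mul_I, mul_one, norm_mul,
        Complex.norm_real, Real.norm_of_nonneg hp.2.1]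
      exact mul_le_mul hp.2.2 (hb _) (norm_nonneg _) hR
    refine h1.of_forall_sdiff_eq_zero (MeasurableSet.univ.prod measurableSet_Ioi) fun p hp => ?_
    rw [indicator_apply]
    split_ifs with hmem
    · have hp2 : R < p.2 := by
        by_contra hc
        push Not at hc
        refine hp.2 ⟨⟨?_, ?_⟩, ?_, hc⟩
        · linarith [hmem.1]
        · linarith [hmem.2]
        · exact le_of_lt hp.1.2
      simp [hsup _ hp2]
    · simp

/-- The reflection in the hyperplane orthogonal to `p - ‖p‖ e₂` exchanges two vectors of equal norm.
-/
theorem exists_isometry_axis (p : Space) : ∃ T : Space ≃ₗᵢ[ℝ] Space, T p = ‖p‖ • e 2 := by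
  refine ⟨(ℝ ∙ (p - ‖p‖ • e 2))ᗮ.reflection, Submodule.reflection_sub ?_⟩
  simp [norm_smul]

theorem integral_radial_mul_exp {h : ℝ → ℂ} (hh : IsBoundedRadial h) {p : Space} (hp : p ≠ 0) :
    ∫ x : Space, h ‖x‖ * Complex.exp ((inner ℝ p x : ℝ) * Complex.I) =
      4 * Real.pi * radialTransform h 0 ‖p‖ := by
  obtain ⟨T, hT⟩ := exists_isometry_axis p
  rw [← integral_exp_mul_radial_axis hh (norm_ne_zero_iff.mpr hp),
    ← T.measurePreserving.integral_comp T.toHomeomorph.measurableEmbedding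
      (fun x : Space => h ‖x‖ * Complex.exp (‖p‖ * (x 2 : ℝ) * Complex.I))]
  congr 1
  ext x
  have : (inner ℝ p x : ℝ) = ‖p‖ * (T x) 2 := by
    rw [← T.inner_map_map p x, hT, inner_smul_left, EuclideanSpace.inner_single_left]
    simp
  rw [this, T.norm_map]
  push_cast
  ring_nf

/-- The Bessel recurrence brings down `-s r²`, and the weight `r^{2l+2}` is chosen so that this `r²`
raises `l` by one. -/
theorem hasDerivAt_radialTransform {h : ℝ → ℂ} (hh : IsBoundedRadial h) (l : ℕ) (s : ℝ) :
    HasDerivAt (radialTransform h l) (-s * radialTransform h (l + 1) s) s := by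
  obtain ⟨C, hC⟩ := exists_reducedBessel_bound (l + 1)
  have hψ := continuous_reducedBessel
  have hC0 : 0 ≤ C := (abs_nonneg _).trans (hC 0)
  have key := (hasDerivAt_integral_of_dominated_loc_of_deriv_le (μ := volume.restrict (Ioi (0 : ℝ)))
    (s := Metric.ball s 1) (x₀ := s)
    (F := fun s r => h r * (r ^ (2 * l + 2) * reducedBessel l (s * r) : ℝ))
    (F' := fun s r => h r * (r ^ (2 * l + 2) * (-(s * r) * reducedBessel (l + 1) (s * r) * r) : ℝ))
    (bound := fun r => ‖h r * (((|s| + 1) * C * |r| ^ (2 * l + 4) : ℝ) : ℂ)‖)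
    (Metric.ball_mem_nhds s one_pos) ?_ ?_ ?_ ?_ ?_ ?_).2
  · refine key.congr_deriv ?_
    rw [radialTransform, ← integral_const_mul]
    refine setIntegral_congr_fun measurableSet_Ioi fun r _ => ?_
    push_cast
    ring
  · refine Eventually.of_forall fun s => (hh.integrableOn_mul ?_).aestronglyMeasurable
    have := hψ l
    fun_prop
  · refine hh.integrableOn_mul ?_
    have := hψ l
    fun_prop
  · refine (hh.integrableOn_mul (g := fun r => (r ^ (2 * l + 2) *
      (-(s * r) * reducedBessel (l + 1) (s * r) * r) : ℝ)) ?_).aestronglyMeasurable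
    have := hψ (l + 1)
    fun_prop
  · refine ae_of_all _ fun r s' hs' => ?_
    rw [norm_mul, norm_mul]
    gcongr
    rw [Complex.norm_real, Complex.norm_real, Real.norm_eq_abs, Real.norm_of_nonneg (by positivity)]
    have h1 : |s'| ≤ |s| + 1 := by
      rw [Metric.mem_ball, Real.dist_eq] at hs'
      have := abs_sub_abs_le_abs_sub s' s
      linarith
    simp only [abs_mul, abs_neg, abs_pow]
    calc |r| ^ (2 * l + 2) * (|s'| * |r| * |reducedBessel (l + 1) (s' * r)| * |r|)
        = |s'| * |reducedBessel (l + 1) (s' * r)| * |r| ^ (2 * l + 4) := by ring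
      _ ≤ _ := by gcongr; exact hC _
  · refine (hh.integrableOn_mul ?_).norm
    fun_prop
  · refine ae_of_all _ fun r s' _ => ?_
    have h1 : HasDerivAt (fun s => reducedBessel l (s * r))
        (-(s' * r) * reducedBessel (l + 1) (s' * r) * r) s' :=
      HasDerivAt.comp (h₂ := reducedBessel l) (h := fun s => s * r) s'
        (hasDerivAt_reducedBessel l (s' * r)) (by simpa using (hasDerivAt_id s').mul_const r)
    exact ((h1.const_mul (r ^ (2 * l + 2))).ofReal_comp).const_mul (h r)

/-- The complex bilinear pairing of a complex vector with a real one. -/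
def cdot (a : Fin 3 → ℂ) (x : Space) : ℂ := ∑ i, a i * (x i : ℂ)

theorem continuous_cdot (a : Fin 3 → ℂ) : Continuous (cdot a) := by
  unfold cdot
  fun_prop

theorem hasDerivAt_cdot (a : Fin 3 → ℂ) (p : Space) (j : Fin 3) (t : ℝ) :
    HasDerivAt (fun t : ℝ => cdot a (p + t • e j)) (a j) t := by
  have h : (fun t : ℝ => cdot a (p + t • e j)) = fun t : ℝ => cdot a p + (t : ℂ) * a j := by
    ext t
    simp only [cdot, PiLp.add_apply, PiLp.smul_apply, Complex.ofReal_add, mul_add,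
      Finset.sum_add_distrib, smul_eq_mul, Complex.ofReal_mul]
    congr 1
    rw [Finset.sum_eq_single j]
    · simp; ring
    · intro i _ hi; simp [hi]
    · simp
  rw [h]
  have := ((hasDerivAt_id t).ofReal_comp.mul_const (a j)).const_add (cdot a p)
  refine this.congr_deriv ?_
  simp

theorem hasDerivAt_norm_line {p : Space} (hp : p ≠ 0) (j : Fin 3) :
    HasDerivAt (fun t : ℝ => ‖p + t • e j‖) (p j / ‖p‖) 0 := by
  have h1 : HasDerivAt (fun t : ℝ => p + t • e j) (e j) 0 := by
    simpa using ((hasDerivAt_id (0 : ℝ)).smul_const (e j)).const_add p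
  have h2 := h1.norm_sq.sqrt (by simpa using hp)
  simp only [zero_smul, add_zero, Real.sqrt_sq (norm_nonneg _)] at h2
  refine h2.congr_deriv ?_
  rw [EuclideanSpace.inner_single_right]
  simp
  field_simp

/-- The Bochner–Hecke formula for the powers of a null vector. -/
theorem integral_radial_mul_cdot_pow {h : ℝ → ℂ} (hh : IsBoundedRadial h) {a : Fin 3 → ℂ}
    (ha : ∑ i, a i ^ 2 = 0) (l : ℕ) : ∀ {p : Space}, p ≠ 0 →
    ∫ x : Space, h ‖x‖ * (cdot a x ^ l * Complex.exp ((inner ℝ p x : ℝ) * Complex.I)) =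
      4 * Real.pi * Complex.I ^ l * cdot a p ^ l * radialTransform h l ‖p‖ := by
  have hca := continuous_cdot a
  induction l with
  | zero =>
    intro p hp
    have := integral_radial_mul_exp hh hp
    simpa using this
  | succ l ih =>
    intro p hp
    -- The induction hypothesis is differentiated in `p` along `e_j`: on the left this brings down
    -- `i x_j`, on the right it acts on `(a·p)^l` and on the radial factor.
    have key : ∀ j : Fin 3, ∫ x : Space, h ‖x‖ * (cdot a x ^ l * (((x j : ℝ) : ℂ) * Complex.I *
        Complex.exp ((inner ℝ p x : ℝ) * Complex.I))) =
        4 * Real.pi * Complex.I ^ l * (l * cdot a p ^ (l - 1) * a j * radialTransform h l ‖p‖ -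
          cdot a p ^ l * (p j * radialTransform h (l + 1) ‖p‖)) := by
      intro j
      have hi : ∀ (x : Space) (t : ℝ), (inner ℝ (p + t • e j) x : ℝ) = inner ℝ p x + t * x j := by
        intro x t
        rw [inner_add_left, inner_smul_left, EuclideanSpace.inner_single_left]
        simp
      have hl : HasDerivAt (fun t : ℝ => ∫ x : Space, h ‖x‖ * (cdot a x ^ l *
          Complex.exp ((inner ℝ (p + t • e j) x : ℝ) * Complex.I)))
          (∫ x : Space, h ‖x‖ * (cdot a x ^ l * (((x j : ℝ) : ℂ) * Complex.I *
            Complex.exp ((inner ℝ (p + (0 : ℝ) • e j) x : ℝ) * Complex.I)))) 0 := by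
        refine (hasDerivAt_integral_of_dominated_loc_of_deriv_le (s := univ)
          (F' := fun t x => h ‖x‖ * (cdot a x ^ l * (((x j : ℝ) : ℂ) * Complex.I *
            Complex.exp ((inner ℝ (p + t • e j) x : ℝ) * Complex.I))))
          (bound := fun x => ‖h ‖x‖ * (cdot a x ^ l * ((x j : ℝ) : ℂ))‖) univ_mem
          (Eventually.of_forall fun t => (hh.integrable_mul (by fun_prop)).aestronglyMeasurable)
          (hh.integrable_mul (by fun_prop)) (hh.integrable_mul (by fun_prop)).aestronglyMeasurable
          (ae_of_all _ fun x t _ => ?_) (hh.integrable_mul (by fun_prop)).norm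
          (ae_of_all _ fun x t _ => ?_)).2
        · simp only [norm_mul, Complex.norm_exp_ofReal_mul_I, Complex.norm_I, mul_one]
          exact le_rfl
        · have h1 : HasDerivAt (fun t : ℝ => ((inner ℝ (p + t • e j) x : ℝ) : ℂ) * Complex.I)
              (((x j : ℝ) : ℂ) * Complex.I) t := by
            simp only [hi]
            have := ((((hasDerivAt_id t).mul_const (x j)).const_add
              (inner ℝ p x)).ofReal_comp).mul_const Complex.I
            refine this.congr_deriv ?_
            simp
          have h2 := ((h1.cexp).const_mul (cdot a x ^ l)).const_mul (h ‖x‖)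
          refine h2.congr_deriv ?_
          ring
      have hr : HasDerivAt (fun t : ℝ => 4 * Real.pi * Complex.I ^ l * cdot a (p + t • e j) ^ l *
          radialTransform h l ‖p + t • e j‖)
          (4 * Real.pi * Complex.I ^ l * (l * cdot a p ^ (l - 1) * a j * radialTransform h l ‖p‖ -
          cdot a p ^ l * (p j * radialTransform h (l + 1) ‖p‖))) 0 := by
        have d1 := (hasDerivAt_cdot a p j 0).pow l
        have d2 : HasDerivAt (fun t : ℝ => radialTransform h l ‖p + t • e j‖)
            ((p j / ‖p‖ : ℝ) • (-(‖p‖ : ℂ) * radialTransform h (l + 1) ‖p‖)) 0 := by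
          refine HasDerivAt.scomp (h := fun t : ℝ => ‖p + t • e j‖) (g₁ := radialTransform h l)
            (0 : ℝ) ?_ (hasDerivAt_norm_line hp j)
          have := hasDerivAt_radialTransform hh l ‖p‖
          simpa using this
        have d3 := ((d1.const_mul (4 * Real.pi * Complex.I ^ l)).mul d2)
        refine d3.congr_deriv ?_
        have hp' : ((‖p‖ : ℝ) : ℂ) ≠ 0 := by exact_mod_cast norm_ne_zero_iff.mpr hp
        simp only [zero_smul, add_zero, Complex.real_smul, Pi.pow_apply]
        push_cast
        field_simp
        ring
      -- The formula of order `l` is known only off the origin, which is enough near `p ≠ 0`.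
      have hne : ∀ᶠ t : ℝ in 𝓝 0, p + t • e j ≠ 0 := by
        have hc : Continuous fun t : ℝ => p + t • e j := by fun_prop
        exact hc.continuousAt.eventually_ne (by simpa using hp)
      have heq := hr.congr_of_eventuallyEq (hne.mono fun t ht => ih ht)
      have := hl.unique heq
      simpa using this
    have hsum : Complex.I * ∫ x : Space, h ‖x‖ * (cdot a x ^ (l + 1) *
        Complex.exp ((inner ℝ p x : ℝ) * Complex.I)) =
        ∑ j, a j * ∫ x : Space, h ‖x‖ * (cdot a x ^ l * (((x j : ℝ) : ℂ) * Complex.I *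
          Complex.exp ((inner ℝ p x : ℝ) * Complex.I))) := by
      simp only [← integral_const_mul]
      rw [← integral_finsetSum]
      · congr 1
        ext x
        rw [pow_succ]
        nth_rewrite 2 [cdot]
        simp only [Fin.sum_univ_three]
        ring
      · exact fun j _ => (hh.integrable_mul (by fun_prop)).const_mul _
    -- Contracting with `a_j` kills the derivative of `(a·p)^l`, which is proportional to `a·a = 0`,
    -- and turns the radial term into one more factor `a·p`.
    have h3 : ∑ j, a j * (4 * Real.pi * Complex.I ^ l *
        (l * cdot a p ^ (l - 1) * a j * radialTransform h l ‖p‖ -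
          cdot a p ^ l * (p j * radialTransform h (l + 1) ‖p‖))) =
        -(4 * Real.pi * Complex.I ^ l * cdot a p ^ (l + 1) * radialTransform h (l + 1) ‖p‖) := by
      have e1 : cdot a p ^ (l + 1) = cdot a p ^ l * ∑ i, a i * (p i : ℂ) := by
        rw [pow_succ]; rfl
      rw [e1]
      simp only [Fin.sum_univ_three] at ha ⊢
      linear_combination
        4 * Real.pi * Complex.I ^ l * l * cdot a p ^ (l - 1) * radialTransform h l ‖p‖ * ha
    simp only [key] at hsum
    rw [h3] at hsum
    have h4 := congrArg (fun w => -Complex.I * w) hsum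
    rw [← mul_assoc, neg_mul, Complex.I_mul_I, neg_neg, one_mul] at h4
    rw [h4]
    ring

/-! ### Spherical harmonics as combinations of powers of null vectors -/

open Polynomial in
/-- The `l`-th power of the null linear form `2 τ z + τ² (x + i y) - (x - i y)`, as a polynomial
in `τ`. -/
def nullPower (l : ℕ) (x : Space) : ℂ[X] :=
  (C (2 * (x 2 : ℂ)) * X + C ((x 0 : ℂ) + Complex.I * (x 1 : ℂ)) * X ^ 2 -
    C ((x 0 : ℂ) - Complex.I * (x 1 : ℂ))) ^ l

/-- The null vector with parameter `τ`. -/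
def nullVector (τ : ℂ) : Fin 3 → ℂ := ![τ ^ 2 - 1, Complex.I * (τ ^ 2 + 1), 2 * τ]

theorem sum_sq_nullVector (τ : ℂ) : ∑ i, nullVector τ i ^ 2 = 0 := by
  simp only [nullVector, Fin.sum_univ_three, Matrix.cons_val]
  linear_combination (τ ^ 2 + 1) ^ 2 * Complex.I_sq

theorem eval_nullPower (l : ℕ) (x : Space) (τ : ℂ) :
    (nullPower l x).eval τ = cdot (nullVector τ) x ^ l := by
  simp only [nullPower, cdot, nullVector, Fin.sum_univ_three, Matrix.cons_val, Polynomial.eval_pow,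
    Polynomial.eval_sub, Polynomial.eval_add, Polynomial.eval_mul, Polynomial.eval_C,
    Polynomial.eval_X]
  congr 1
  ring

theorem degree_nullPower_lt (l : ℕ) (x : Space) :
    (nullPower l x).degree < ((2 * l + 1 : ℕ) : WithBot ℕ) := by
  have h : (nullPower l x).natDegree ≤ l * 2 := by
    refine Polynomial.natDegree_pow_le_of_le l ?_
    compute_degree
  refine Polynomial.degree_le_natDegree.trans_lt ?_
  exact_mod_cast (by omega : (nullPower l x).natDegree < 2 * l + 1)

/-- The coefficients of `nullPower` are fixed combinations of powers of null vectors. -/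
theorem coeff_nullPower (l n : ℕ) (x : Space) : (nullPower l x).coeff n =
    ∑ j ∈ Finset.range (2 * l + 1), (Lagrange.basis (Finset.range (2 * l + 1))
      (fun j : ℕ => (j : ℂ)) j).coeff n * cdot (nullVector j) x ^ l := by
  -- The degree in `τ` is at most `2l`, so interpolation at the `2l + 1` nodes `0, …, 2l` recovers
  -- every coefficient from values, and the values are powers of null forms.
  have hinj : Set.InjOn (fun j : ℕ => (j : ℂ)) (Finset.range (2 * l + 1)) :=
    fun a _ b _ h => Nat.cast_injective h
  have h := Lagrange.eq_interpolate hinj (f := nullPower l x)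
    (by simpa using degree_nullPower_lt l x)
  conv_lhs => rw [h]
  rw [Lagrange.interpolate_apply, Polynomial.finsetSum_coeff]
  refine Finset.sum_congr rfl fun j _ => ?_
  rw [Polynomial.coeff_C_mul, eval_nullPower, mul_comm]

theorem norm_sq_coord (x : Space) : ‖x‖ ^ 2 = x 0 ^ 2 + x 1 ^ 2 + x 2 ^ 2 := by
  rw [EuclideanSpace.norm_sq_eq]
  simp [Fin.sum_univ_three]

open Polynomial in
-- With `u = x + i y` and `r = |x|`, one has `u ū = r² - z²`, hence `u (2τz + τ²u - ū) = (z + τu)² -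
-- r²`. The `l`-th power is `r^{2l} (t² - 1)^l` at `t = z/r + τu/r`, which is Rodrigues' polynomial
-- expanded about `cos θ`.
theorem plane_pow_mul_nullPower (l : ℕ) {x : Space} (hx : x ≠ 0) :
    C (((x 0 : ℂ) + Complex.I * (x 1 : ℂ)) ^ l) * nullPower l x =
      C ((‖x‖ : ℂ) ^ (2 * l)) *
        (taylor ((x 2 : ℂ) / ‖x‖) (((X ^ 2 - 1 : ℝ[X]) ^ l).map Complex.ofRealHom)).comp
          (C (((x 0 : ℂ) + Complex.I * (x 1 : ℂ)) / ‖x‖) * X) := by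
  have hr : (‖x‖ : ℂ) ≠ 0 := by exact_mod_cast norm_ne_zero_iff.mpr hx
  have hn : (‖x‖ : ℂ) ^ 2 = (x 0 : ℂ) ^ 2 + (x 1 : ℂ) ^ 2 + (x 2 : ℂ) ^ 2 := by
    exact_mod_cast congrArg (Complex.ofReal) (norm_sq_coord x)
  refine Polynomial.funext fun τ => ?_
  rw [nullPower, taylor_apply]
  simp only [eval_mul, eval_C, eval_pow, eval_sub, eval_add, eval_X, eval_comp, Polynomial.map_pow,
    Polynomial.map_sub, map_X, Polynomial.map_one, eval_one]
  rw [pow_mul, ← mul_pow, ← mul_pow]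
  congr 1
  field_simp
  rw [hn]
  linear_combination (x 1 : ℂ) ^ 2 * Complex.I_sq

/-- The coefficient of `τ^{l+m}` on the Rodrigues side is the `(l+m)`-th derivative over `(l+m)!`,
times `(u/r)^{l+m}`; cancelling `u^l`, legitimate off the third axis, leaves `r^l (u/r)^m`. -/
theorem coeff_nullPower_eq {l m : ℕ} {x : Space} (hx : (x 0 : ℂ) + Complex.I * (x 1 : ℂ) ≠ 0) :
    (nullPower l x).coeff (l + m) * (l + m).factorial =
      (‖x‖ : ℂ) ^ l * (((x 0 : ℂ) + Complex.I * (x 1 : ℂ)) / (‖x‖ : ℂ)) ^ m *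
        (((Polynomial.derivative^[l + m] ((Polynomial.X ^ 2 - 1 : Polynomial ℝ) ^ l)).eval
          (x 2 / ‖x‖) : ℝ) : ℂ) := by
  have hx0 : x ≠ 0 := by
    rintro rfl
    simp at hx
  have hr : (‖x‖ : ℂ) ≠ 0 := by exact_mod_cast norm_ne_zero_iff.mpr hx0
  have h := congrArg (fun q => Polynomial.coeff q (l + m)) (plane_pow_mul_nullPower l hx0)
  simp only [Polynomial.coeff_C_mul, Polynomial.comp_C_mul_X_coeff, Polynomial.taylor_coeff] at h
  have hD : (((Polynomial.derivative^[l + m] ((Polynomial.X ^ 2 - 1 : Polynomial ℝ) ^ l)).eval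
      (x 2 / ‖x‖) : ℝ) : ℂ) = (l + m).factorial * Polynomial.eval ((x 2 : ℂ) / ‖x‖)
        (Polynomial.hasseDeriv (l + m)
          (((Polynomial.X ^ 2 - 1 : Polynomial ℝ) ^ l).map Complex.ofRealHom)) := by
    have h1 := Polynomial.eval_map_apply (p := Polynomial.derivative^[l + m]
      ((Polynomial.X ^ 2 - 1 : Polynomial ℝ) ^ l)) Complex.ofRealHom (x 2 / ‖x‖)
    rw [← Polynomial.iterate_derivative_map, ← Polynomial.factorial_smul_hasseDeriv] at h1
    rw [LinearMap.smul_apply, Polynomial.eval_smul, nsmul_eq_mul] at h1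
    rw [Complex.ofRealHom_eq_coe, Complex.ofRealHom_eq_coe] at h1
    rw [← h1]
    push_cast
    rfl
  rw [hD]
  have hul : ((x 0 : ℂ) + Complex.I * (x 1 : ℂ)) ^ l ≠ 0 := pow_ne_zero _ hx
  apply mul_left_cancel₀ hul
  rw [← mul_assoc, h, div_pow, div_pow]
  field_simp
  ring

/-- `r^l Y_l^m` is a combination of `l`-th powers of null linear forms. -/
def IsNullCombination (l : ℕ) (Y : Space → ℂ) : Prop :=
  ∃ (s : Finset ℕ) (c : ℕ → ℂ) (a : ℕ → Fin 3 → ℂ), (∀ j, ∑ i, a j i ^ 2 = 0) ∧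
    ∀ x : Space, (x 0 : ℂ) + Complex.I * (x 1 : ℂ) ≠ 0 →
      (‖x‖ : ℂ) ^ l * Y x = ∑ j ∈ s, c j * cdot (a j) x ^ l

theorem isNullCombination_sphericalHarmonicNat (l m : ℕ) :
    IsNullCombination l (sphericalHarmonicNat l m) := by
  set K : ℂ := (-1) ^ m *
    (√((2 * l + 1) / (4 * Real.pi) * ((l - m).factorial / (l + m).factorial)) : ℝ) *
    ((l + m).factorial / (2 ^ l * l.factorial)) with hK
  refine ⟨Finset.range (2 * l + 1), fun j => K * (Lagrange.basis (Finset.range (2 * l + 1))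
      (fun j : ℕ => (j : ℂ)) j).coeff (l + m), fun j => nullVector j,
      fun j => sum_sq_nullVector j, fun x hx => ?_⟩
  have h := coeff_nullPower_eq (l := l) (m := m) hx
  simp only [mul_assoc, ← Finset.mul_sum]
  simp only [← coeff_nullPower]
  rw [sphericalHarmonicNat, hK]
  push_cast
  linear_combination -((-1) ^ m *
    ((√((2 * l + 1) / (4 * Real.pi) * ((l - m).factorial / (l + m).factorial)) : ℝ) : ℂ) /
      (2 ^ l * l.factorial)) * h

/-- The complex conjugate of a null vector is null, and the position vector is real. This covers
negative `m`. -/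
theorem IsNullCombination.const_mul_conj {l : ℕ} {Y : Space → ℂ} (h : IsNullCombination l Y) (k : ℂ) :
    IsNullCombination l fun x => k * star (Y x) := by
  obtain ⟨s, c, a, ha, hY⟩ := h
  refine ⟨s, fun j => k * star (c j), fun j i => star (a j i), fun j => ?_, fun x hx => ?_⟩
  · have := congrArg star (ha j)
    simpa only [star_sum, star_pow, star_zero] using this
  · have h1 := congrArg star (hY x hx)
    have h2 : ∀ j, star (cdot (a j) x) = cdot (fun i => star (a j i)) x := by
      intro j
      simp only [cdot, star_sum, star_mul', Complex.star_def, Complex.conj_ofReal]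
    simp only [star_mul', star_pow, star_sum, h2] at h1
    rw [Complex.star_def, Complex.conj_ofReal] at h1
    simp only [mul_assoc, ← Finset.mul_sum, Complex.star_def]
    rw [← h1]
    ring

theorem isNullCombination_sphericalHarmonic (l : ℕ) (m : ℤ) :
    IsNullCombination l (sphericalHarmonic l m) := by
  have h := isNullCombination_sphericalHarmonicNat l m.natAbs
  by_cases hm : 0 ≤ m
  · have : sphericalHarmonic l m = sphericalHarmonicNat l m.natAbs := by
      ext x; rw [sphericalHarmonic, if_pos hm]
    rwa [this]
  · have : sphericalHarmonic l m =
        fun x => (-1) ^ m.natAbs * star (sphericalHarmonicNat l m.natAbs x) := by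
      ext x; rw [sphericalHarmonic, if_neg hm]
    rw [this]
    exact h.const_mul_conj _

theorem measurable_sphericalHarmonic (l : ℕ) (m : ℤ) : Measurable (sphericalHarmonic l m) := by
  have h : ∀ k : ℕ, Measurable (sphericalHarmonicNat l k) := by
    intro k
    unfold sphericalHarmonicNat
    have h1 : ∀ i : Fin 3, Measurable fun x : Space => x i := fun i => by fun_prop
    have h2 : Measurable fun x : Space => (Polynomial.derivative^[l + k]
        ((Polynomial.X ^ 2 - 1 : Polynomial ℝ) ^ l)).eval (x 2 / ‖x‖) :=
      (Polynomial.continuous _).measurable.comp ((h1 2).div measurable_norm)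
    have h3 := h1 0
    have h4 := h1 1
    fun_prop
  unfold sphericalHarmonic
  split_ifs
  · exact h _
  · exact measurable_const.mul (continuous_star.measurable.comp (h _))

theorem norm_plane_le (x : Space) : ‖(x 0 : ℂ) + Complex.I * (x 1 : ℂ)‖ ≤ ‖x‖ := by
  rw [← abs_of_nonneg (norm_nonneg x), ← abs_of_nonneg (norm_nonneg ((x 0 : ℂ) + _)), ← sq_le_sq,
    norm_sq_coord, ← Complex.normSq_eq_norm_sq, mul_comm, Complex.normSq_add_mul_I]
  nlinarith [sq_nonneg (x 2)]

theorem exists_sphericalHarmonic_bound (l : ℕ) (m : ℤ) :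
    ∃ C, 0 ≤ C ∧ ∀ x, ‖sphericalHarmonic l m x‖ ≤ C := by
  have h : ∀ k : ℕ, ∃ C, 0 ≤ C ∧ ∀ x, ‖sphericalHarmonicNat l k x‖ ≤ C := by
    intro k
    obtain ⟨C, hC⟩ := (isCompact_Icc (a := (-1 : ℝ)) (b := 1)).exists_bound_of_continuousOn
      (f := fun t => (Polynomial.derivative^[l + k]
        ((Polynomial.X ^ 2 - 1 : Polynomial ℝ) ^ l)).eval t / (2 ^ l * l.factorial)) (by fun_prop)
    have hC0 : 0 ≤ C := (norm_nonneg _).trans (hC 0 ⟨by norm_num, by norm_num⟩)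
    refine ⟨|√((2 * l + 1) / (4 * Real.pi) * ((l - k).factorial / (l + k).factorial))| * C,
      by positivity, fun x => ?_⟩
    rw [sphericalHarmonicNat, norm_mul, norm_mul, norm_mul, norm_pow, norm_neg, norm_one, one_pow,
      one_mul, Complex.norm_real, Real.norm_eq_abs, norm_pow, norm_div, Complex.norm_real,
      norm_norm, Complex.norm_real]
    have h1 : (‖(x 0 : ℂ) + Complex.I * (x 1 : ℂ)‖ / ‖x‖) ^ k ≤ 1 :=
      pow_le_one₀ (by positivity) (div_le_one_of_le₀ (norm_plane_le x) (norm_nonneg x))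
    have h2 := hC (x 2 / ‖x‖) (abs_le.mp (by
      rw [abs_div, abs_norm]
      exact div_le_one_of_le₀ (abs_coord_le_norm x 2) (norm_nonneg x)))
    rw [mul_assoc]
    gcongr
    calc _ ≤ 1 * C := mul_le_mul h1 h2 (norm_nonneg _) zero_le_one
      _ = C := one_mul C
  obtain ⟨C, hC0, hC⟩ := h m.natAbs
  refine ⟨C, hC0, fun x => ?_⟩
  rw [sphericalHarmonic]
  split_ifs
  · exact hC x
  · rw [norm_mul, norm_pow, norm_neg, norm_one, one_pow, one_mul, norm_star]
    exact hC x

/-! ### Superpositions of spherical waves -/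

/-- The third axis lies in the plane `x₀ = 0`, a proper subspace, which has measure zero. -/
theorem ae_plane_ne_zero : ∀ᵐ x : Space, (x 0 : ℂ) + Complex.I * (x 1 : ℂ) ≠ 0 := by
  set S : Submodule ℝ Space := LinearMap.ker
    (EuclideanSpace.proj (0 : Fin 3) : Space →L[ℝ] ℝ).toLinearMap with hS
  have hne : S ≠ ⊤ := by
    intro h
    have : e 0 ∈ S := h ▸ Submodule.mem_top
    simp [hS] at this
  have h0 := Measure.addHaar_submodule (volume : Measure Space) S hne
  filter_upwards [measure_eq_zero_iff_ae_notMem.mp h0] with x hx h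
  apply hx
  have := congrArg Complex.re h
  simpa [hS] using this

theorem sphericalWave_eq {k : ℝ} (hk : 0 < k) (l : ℕ) (m : ℤ) (x : Space) :
    sphericalWave k l m x =
      (√(2 / Real.pi) * (k * sphericalBessel l (k * ‖x‖)) : ℝ) * sphericalHarmonic l m x := by
  rw [sphericalWave, mul_div_right_comm, Real.sqrt_mul (by positivity), Real.sqrt_sq hk.le,
    mul_assoc]

/-- `k j_l(k|x|) = |x|⁻¹ · s j_l(s)` at `s = k|x|`, and `s j_l(s)` is bounded. The uniformity in `k`
later makes the coefficients of a density bounded. -/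
theorem exists_sphericalWave_bound (l : ℕ) (m : ℤ) : ∃ C, 0 ≤ C ∧ ∀ (k : ℝ) (x : Space), 0 < k →
    x ≠ 0 → ‖sphericalWave k l m x‖ ≤ C * ‖x‖⁻¹ := by
  obtain ⟨C₁, h1, hC₁⟩ := exists_mul_sphericalBessel_bound l
  obtain ⟨C₂, h2, hC₂⟩ := exists_sphericalHarmonic_bound l m
  refine ⟨√(2 / Real.pi) * C₁ * C₂, by positivity, fun k x hk hx => ?_⟩
  have hx' : 0 < ‖x‖ := norm_pos_iff.mpr hx
  have h3 : |k * sphericalBessel l (k * ‖x‖)| ≤ C₁ * ‖x‖⁻¹ := by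
    rw [← div_eq_mul_inv, le_div_iff₀ hx']
    have := hC₁ (k * ‖x‖)
    rw [mul_right_comm, abs_mul, abs_norm] at this
    exact this
  rw [sphericalWave_eq hk, norm_mul, Complex.norm_real, Real.norm_eq_abs, abs_mul,
    abs_of_nonneg (Real.sqrt_nonneg _)]
  calc _ ≤ √(2 / Real.pi) * (C₁ * ‖x‖⁻¹) * C₂ := by gcongr; exact hC₂ x
    _ = _ := by ring

theorem measurable_sphericalWave (l : ℕ) (m : ℤ) :
    Measurable fun p : ℝ × Space => sphericalWave p.1 l m p.2 := by
  unfold sphericalWave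
  simp only [sphericalBessel_eq]
  have h1 := continuous_reducedBessel l
  have h2 : Measurable fun p : ℝ × Space => sphericalHarmonic l m p.2 :=
    (measurable_sphericalHarmonic l m).comp measurable_snd
  have h3 : Continuous fun p : ℝ × Space => ((√(2 * p.1 ^ 2 / Real.pi) *
      ((p.1 * ‖p.2‖) ^ l * reducedBessel l (p.1 * ‖p.2‖)) : ℝ) : ℂ) := by fun_prop
  exact h3.measurable.mul h2

theorem measurable_sphericalWave_left (l : ℕ) (m : ℤ) (x : Space) :
    Measurable fun k : ℝ => sphericalWave k l m x := by
  unfold sphericalWave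
  simp only [sphericalBessel_eq]
  have h1 := continuous_reducedBessel l
  have h2 : Continuous fun k : ℝ => ((√(2 * k ^ 2 / Real.pi) *
      ((k * ‖x‖) ^ l * reducedBessel l (k * ‖x‖)) : ℝ) : ℂ) := by fun_prop
  exact h2.measurable.mul_const _

/-- Off the third axis the solid harmonic is a combination of powers of null forms, so the
Bochner–Hecke formula applies term by term at the point `2πx`. -/
theorem fourierInv_radial_mul {l : ℕ} {Y : Space → ℂ} (hY : IsNullCombination l Y) {h : ℝ → ℂ}
    (hh : IsBoundedRadial h) {x : Space} (hx : (x 0 : ℂ) + Complex.I * (x 1 : ℂ) ≠ 0) :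
    𝓕⁻ (fun p : Space => h ‖p‖ * ((‖p‖ : ℂ) ^ l * Y p)) x =
      4 * Real.pi * Complex.I ^ l * (2 * Real.pi * ‖x‖) ^ l * Y x *
        radialTransform h l (2 * Real.pi * ‖x‖) := by
  obtain ⟨s, c, a, ha, hsum⟩ := hY
  have hx0 : x ≠ 0 := by
    rintro rfl
    simp at hx
  have hpi : (2 * Real.pi) ≠ 0 := by positivity
  have hp : (2 * Real.pi) • x ≠ 0 := smul_ne_zero hpi hx0
  have hn : ‖(2 * Real.pi) • x‖ = 2 * Real.pi * ‖x‖ := by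
    rw [norm_smul, Real.norm_of_nonneg (by positivity)]
  have hcd : ∀ j, cdot (a j) ((2 * Real.pi) • x) = 2 * Real.pi * cdot (a j) x := by
    intro j
    simp only [cdot, Finset.mul_sum]
    refine Finset.sum_congr rfl fun i _ => ?_
    simp only [PiLp.smul_apply, smul_eq_mul]
    push_cast
    ring
  rw [Real.fourierInv_eq']
  have h1 : ∫ v : Space, Complex.exp (((2 * Real.pi * inner ℝ v x : ℝ) : ℂ) * Complex.I) •
      (h ‖v‖ * ((‖v‖ : ℂ) ^ l * Y v)) = ∫ v : Space, ∑ j ∈ s, c j * (h ‖v‖ * (cdot (a j) v ^ l *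
        Complex.exp ((inner ℝ ((2 * Real.pi) • x) v : ℝ) * Complex.I))) := by
    refine integral_congr_ae ?_
    filter_upwards [ae_plane_ne_zero] with v hv
    rw [hsum v hv, real_inner_smul_left, real_inner_comm v x, smul_eq_mul, Finset.mul_sum,
      Finset.mul_sum]
    refine Finset.sum_congr rfl fun j _ => ?_
    ring
  rw [h1, integral_finsetSum]
  · simp only [integral_const_mul, integral_radial_mul_cdot_pow hh (ha _) l hp, hn, hcd]
    have h2 := hsum x hx
    rw [mul_pow _ (‖x‖ : ℂ)]
    calc _ = 4 * Real.pi * Complex.I ^ l * (2 * Real.pi) ^ l *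
          (∑ j ∈ s, c j * cdot (a j) x ^ l) * radialTransform h l (2 * Real.pi * ‖x‖) := by
          rw [Finset.mul_sum, Finset.sum_mul]
          refine Finset.sum_congr rfl fun j _ => ?_
          ring
      _ = _ := by
          rw [← h2]
          ring
  · intro j _
    have hca := continuous_cdot (a j)
    exact (hh.integrable_mul (by fun_prop)).const_mul _

/-- The Fourier transform of the superposition of the waves `φ_{klm}` with amplitude `g(k)`. -/
def waveSymbol (l : ℕ) (m : ℤ) (g : ℝ → ℂ) (p : Space) : ℂ :=
  Real.pi * (√(2 / Real.pi) : ℝ) * (Complex.I ^ l)⁻¹ *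
    ((‖p‖⁻¹ : ℝ) * g (2 * Real.pi * ‖p‖)) * sphericalHarmonic l m p

theorem measurable_waveSymbol (l : ℕ) (m : ℤ) {g : ℝ → ℂ} (hg : Measurable g) :
    Measurable (waveSymbol l m g) := by
  have h1 := measurable_sphericalHarmonic l m
  have h2 : Measurable fun p : Space => g (2 * Real.pi * ‖p‖) := hg.comp (by fun_prop)
  unfold waveSymbol
  fun_prop

theorem exists_waveSymbol_bound (l : ℕ) (m : ℤ) {g : ℝ → ℂ} {M : ℝ} (hM0 : 0 ≤ M)
    (hM : ∀ k, 0 < k → ‖g k‖ ≤ M * (1 + k ^ 2)⁻¹) :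
    ∃ C, 0 ≤ C ∧ ∀ p, ‖waveSymbol l m g p‖ ≤ C * (‖p‖⁻¹ * (1 + ‖p‖ ^ 2)⁻¹) := by
  obtain ⟨C, h0, hC⟩ := exists_sphericalHarmonic_bound l m
  refine ⟨Real.pi * √(2 / Real.pi) * M * C, by positivity, fun p => ?_⟩
  rcases eq_or_ne p 0 with rfl | hp
  · simp [waveSymbol]
  have hp' : 0 < ‖p‖ := norm_pos_iff.mpr hp
  have h1 : ‖g (2 * Real.pi * ‖p‖)‖ ≤ M * (1 + ‖p‖ ^ 2)⁻¹ := by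
    refine (hM _ (by positivity)).trans ?_
    have : ‖p‖ ≤ 2 * Real.pi * ‖p‖ := by nlinarith [Real.two_le_pi]
    gcongr
  have h2 := hC p
  have hpi : ‖(Real.pi : ℂ)‖ = Real.pi := by
    rw [Complex.norm_real, Real.norm_of_nonneg Real.pi_pos.le]
  rw [waveSymbol]
  simp only [norm_mul, hpi, Complex.norm_real, norm_inv, norm_pow, Complex.norm_I, one_pow, inv_one,
    mul_one, norm_norm, Real.norm_of_nonneg (Real.sqrt_nonneg _)]
  calc _ ≤ Real.pi * √(2 / Real.pi) * (‖p‖⁻¹ * (M * (1 + ‖p‖ ^ 2)⁻¹)) * C := by gcongr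
    _ = _ := by ring

/-- On a momentum shell away from `0` and `∞` the radial profile is bounded with bounded support, so
its transform is an absolutely convergent integral; the substitution `k = 2π|p|` makes it a
superposition of waves. -/
theorem fourierInv_indicator_waveSymbol (l : ℕ) (m : ℤ) {g : ℝ → ℂ} (hg : Measurable g) {M : ℝ}
    (hM0 : 0 ≤ M) (hM : ∀ k, 0 < k → ‖g k‖ ≤ M * (1 + k ^ 2)⁻¹) {a b : ℝ} (ha : 0 < a)
    {x : Space} (hx : (x 0 : ℂ) + Complex.I * (x 1 : ℂ) ≠ 0) :
    𝓕⁻ ({p : Space | ‖p‖ ∈ Icc a b}.indicator (waveSymbol l m g)) x =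
      ∫ k in Ioi (0 : ℝ), (Icc (2 * Real.pi * a) (2 * Real.pi * b)).indicator
        (fun k => sphericalWave k l m x * g k) k := by
  have hpi : 0 < 2 * Real.pi := by positivity
  obtain ⟨κ, hκ⟩ : ∃ κ : ℂ, κ = Real.pi * (√(2 / Real.pi) : ℝ) * (Complex.I ^ l)⁻¹ := ⟨_, rfl⟩
  -- One power of `r⁻¹` belongs to the symbol; the other `l` compensate the factor `r^l` of the
  -- solid harmonic.
  set h : ℝ → ℂ := (Icc a b).indicator
    fun r => κ * (((r ^ (l + 1))⁻¹ : ℝ) * g (2 * Real.pi * r)) with hh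
  have hb : IsBoundedRadial h := by
    refine ⟨?_, ⟨‖κ‖ * ((a ^ (l + 1))⁻¹ * M), by positivity, fun r => ?_⟩,
      ⟨max b 0, le_max_right _ _, fun r hr => ?_⟩⟩
    · have h2 : Measurable fun r : ℝ => g (2 * Real.pi * r) := hg.comp (by fun_prop)
      refine Measurable.indicator ?_ measurableSet_Icc
      fun_prop
    · by_cases hr : r ∈ Icc a b
      · have hr0 : 0 < r := ha.trans_le hr.1
        rw [hh, indicator_of_mem hr, norm_mul, norm_mul, Complex.norm_real,
          Real.norm_of_nonneg (by positivity)]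
        have h1 : ‖g (2 * Real.pi * r)‖ ≤ M := by
          refine (hM _ (by positivity)).trans (mul_le_of_le_one_right hM0 ?_)
          exact inv_le_one_of_one_le₀ (by nlinarith [sq_nonneg (2 * Real.pi * r)])
        have := hr.1
        gcongr
      · rw [hh, indicator_of_notMem hr, norm_zero]
        positivity
    · exact indicator_of_notMem (fun hc => absurd hc.2 (not_le.mpr
        ((le_max_left _ _).trans_lt hr))) _
  have hI : Complex.I ^ l ≠ 0 := pow_ne_zero _ Complex.I_ne_zero
  have h1 : {p : Space | ‖p‖ ∈ Icc a b}.indicator (waveSymbol l m g) =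
      fun p => h ‖p‖ * ((‖p‖ : ℂ) ^ l * sphericalHarmonic l m p) := by
    ext p
    by_cases hp : ‖p‖ ∈ Icc a b
    · have hp0 : (‖p‖ : ℂ) ≠ 0 := by exact_mod_cast (ha.trans_le hp.1).ne'
      rw [indicator_of_mem (show p ∈ {p : Space | ‖p‖ ∈ Icc a b} from hp), hh,
        indicator_of_mem hp, waveSymbol, ← hκ]
      push_cast
      field_simp
      ring
    · rw [indicator_of_notMem (show p ∉ {p : Space | ‖p‖ ∈ Icc a b} from hp), hh,
        indicator_of_notMem hp, zero_mul]
  rw [h1, fourierInv_radial_mul (isNullCombination_sphericalHarmonic l m) hb hx, radialTransform]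
  set G : ℝ → ℂ := (Icc (2 * Real.pi * a) (2 * Real.pi * b)).indicator
        (fun k => sphericalWave k l m x * g k) with hG
  have h2 := integral_comp_mul_left_Ioi G 0 hpi
  rw [mul_zero] at h2
  have h3 : ∫ k in Ioi 0, G k = ∫ r in Ioi 0, 2 * Real.pi * G (2 * Real.pi * r) := by
    rw [integral_const_mul, h2, Complex.real_smul]
    push_cast
    field_simp
  rw [h3, ← integral_const_mul]
  refine setIntegral_congr_fun measurableSet_Ioi fun r hr => ?_
  have hr0 : 0 < r := hr
  have hmem : 2 * Real.pi * r ∈ Icc (2 * Real.pi * a) (2 * Real.pi * b) ↔ r ∈ Icc a b := by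
    simp only [mem_Icc, mul_le_mul_iff_right₀ hpi]
  by_cases hri : r ∈ Icc a b
  · simp only [hG, hh, indicator_of_mem (hmem.mpr hri), indicator_of_mem hri]
    rw [sphericalWave_eq (by positivity), sphericalBessel_eq, hκ,
      show 2 * Real.pi * r * ‖x‖ = 2 * Real.pi * ‖x‖ * r by ring]
    have hr1 : (r : ℂ) ≠ 0 := by exact_mod_cast hr0.ne'
    push_cast
    field_simp
    ring
  · simp only [hG, hh, indicator_of_notMem (mt hmem.mp hri), indicator_of_notMem hri, zero_mul,
      mul_zero]

/-- In polar coordinates the Jacobian `r²` cancels the singularity and `1/(1+r²)` remains. -/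
theorem integrable_inv_norm_sq_mul :
    Integrable fun x : Space => (‖x‖ ^ 2)⁻¹ * (1 + ‖x‖ ^ 2)⁻¹ := by
  refine (integrable_fun_norm_addHaar (volume : Measure Space)
    (f := fun r : ℝ => (r ^ 2)⁻¹ * (1 + r ^ 2)⁻¹)).mpr ?_
  refine (integrable_inv_one_add_sq.integrableOn (s := Ioi 0)).congr_fun (fun r hr => ?_)
    measurableSet_Ioi
  have hr0 : (0 : ℝ) < r := hr
  rw [finrank_euclideanSpace_fin, smul_eq_mul]
  simp only [Nat.add_one_sub_one]
  field_simp

theorem locallyIntegrable_inv_norm : LocallyIntegrable fun x : Space => ‖x‖⁻¹ := by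
  rw [locallyIntegrable_iff]
  intro K hK
  obtain ⟨R, hR⟩ := hK.isBounded.exists_norm_le
  refine ((integrable_inv_norm_sq_mul.const_mul (R * (1 + R ^ 2))).integrableOn (s := K)).mono'
    (by fun_prop) ?_
  filter_upwards [ae_restrict_mem hK.measurableSet] with x hx
  rcases eq_or_ne x 0 with rfl | h0
  · simp
  have hx0 : 0 < ‖x‖ := norm_pos_iff.mpr h0
  have h1 := hR x hx
  rw [norm_inv, norm_norm]
  calc ‖x‖⁻¹ = ‖x‖ * (1 + ‖x‖ ^ 2) * ((‖x‖ ^ 2)⁻¹ * (1 + ‖x‖ ^ 2)⁻¹) := by field_simp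
    _ ≤ R * (1 + R ^ 2) * ((‖x‖ ^ 2)⁻¹ * (1 + ‖x‖ ^ 2)⁻¹) := by gcongr; exact hx0.le.trans h1

/-- The symbol is `O(|p|⁻¹ (1+|p|²)⁻¹)`, so the square of the weighted symbol is `O(|p|⁻²
(1+|p|²)⁻¹)`. This is the `H¹` bound for the potential. -/
theorem memLp_japanese_mul_waveSymbol (l : ℕ) (m : ℤ) {g : ℝ → ℂ} (hg : Measurable g) {M : ℝ}
    (hM0 : 0 ≤ M) (hM : ∀ k, 0 < k → ‖g k‖ ≤ M * (1 + k ^ 2)⁻¹) :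
    MemLp (fun p => (((1 + ‖p‖ ^ 2) ^ ((1 : ℝ) / 2) : ℝ) : ℂ) * waveSymbol l m g p) 2 := by
  obtain ⟨C, hC0, hC⟩ := exists_waveSymbol_bound l m hM0 hM
  have hm := measurable_waveSymbol l m hg
  have hj : Measurable fun p : Space => (((1 + ‖p‖ ^ 2) ^ ((1 : ℝ) / 2) : ℝ) : ℂ) := by fun_prop
  have hjm : Measurable fun p : Space =>
      (((1 + ‖p‖ ^ 2) ^ ((1 : ℝ) / 2) : ℝ) : ℂ) * waveSymbol l m g p := hj.mul hm
  rw [memLp_two_iff_integrable_sq_norm hjm.aestronglyMeasurable]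
  refine (integrable_inv_norm_sq_mul.const_mul (C ^ 2)).mono'
    (hjm.norm.pow_const 2).aestronglyMeasurable (ae_of_all _ fun p => ?_)
  have hpos : 0 < 1 + ‖p‖ ^ 2 := by positivity
  have h1 : ((1 + ‖p‖ ^ 2) ^ ((1 : ℝ) / 2)) ^ 2 = 1 + ‖p‖ ^ 2 := by
    rw [← Real.sqrt_eq_rpow, Real.sq_sqrt hpos.le]
  rw [Real.norm_of_nonneg (by positivity), norm_mul, mul_pow, Complex.norm_real,
    Real.norm_of_nonneg (by positivity), h1]
  calc _ ≤ (1 + ‖p‖ ^ 2) * (C * (‖p‖⁻¹ * (1 + ‖p‖ ^ 2)⁻¹)) ^ 2 := by gcongr; exact hC p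
    _ = _ := by
      rw [mul_pow, mul_pow, inv_pow, inv_pow]
      field_simp

theorem memLp_waveSymbol (l : ℕ) (m : ℤ) {g : ℝ → ℂ} (hg : Measurable g) {M : ℝ}
    (hM0 : 0 ≤ M) (hM : ∀ k, 0 < k → ‖g k‖ ≤ M * (1 + k ^ 2)⁻¹) :
    MemLp (waveSymbol l m g) 2 := by
  refine (memLp_japanese_mul_waveSymbol l m hg hM0 hM).mono
    (measurable_waveSymbol l m hg).aestronglyMeasurable (ae_of_all _ fun p => ?_)
  rw [norm_mul, Complex.norm_real, Real.norm_of_nonneg (by positivity)]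
  exact le_mul_of_one_le_left (norm_nonneg _) (one_le_japanese p)

theorem integral_mul_fourierInv (f : 𝓢(Space, ℂ)) {V : Space → ℂ} (hV : Integrable V) :
    ∫ x, f x * 𝓕⁻ V x = ∫ p, (𝓕⁻ f : 𝓢(Space, ℂ)) p * V p := by
  have h := VectorFourier.integral_fourierIntegral_smul_eq_flip (μ := (volume : Measure Space))
    (ν := (volume : Measure Space)) (L := -innerₗ Space) Real.continuous_fourierChar
    (continuous_inner (𝕜 := ℝ) (E := Space)).neg f.integrable hV
  have hf : (-innerₗ Space).flip = -innerₗ Space := by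
    ext x y
    simp [real_inner_comm]
  rw [hf] at h
  rw [SchwartzMap.fourierInv_coe]
  exact h.symm

/-- A superposition of spherical waves `φ_{klm}`. -/
def waveSuperposition (l : ℕ) (m : ℤ) (g : ℝ → ℂ) (x : Space) : ℂ :=
  ∫ k in Ioi (0 : ℝ), sphericalWave k l m x * g k

section Superposition

variable {l : ℕ} {m : ℤ} {g : ℝ → ℂ} {M C : ℝ}

theorem norm_indicator_wave_le (hM : ∀ k, 0 < k → ‖g k‖ ≤ M * (1 + k ^ 2)⁻¹)
    (hC0 : 0 ≤ C) (hC : ∀ (k : ℝ) (x : Space), 0 < k → x ≠ 0 → ‖sphericalWave k l m x‖ ≤ C * ‖x‖⁻¹)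
    (S : Set ℝ) {x : Space} (hx : x ≠ 0) {k : ℝ} (hk : 0 < k) :
    ‖S.indicator (fun k => sphericalWave k l m x * g k) k‖ ≤ C * ‖x‖⁻¹ * (M * (1 + k ^ 2)⁻¹) := by
  refine (norm_indicator_le_norm_self _ _).trans ?_
  rw [norm_mul]
  exact mul_le_mul (hC k x hk hx) (hM k hk) (norm_nonneg _) (by positivity)

theorem integrableOn_amplitude_bound (D M : ℝ) :
    IntegrableOn (fun k : ℝ => D * (M * (1 + k ^ 2)⁻¹)) (Ioi 0) :=
  ((integrable_inv_one_add_sq.const_mul M).const_mul D).integrableOn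

theorem norm_integral_indicator_wave_le
    (hM : ∀ k, 0 < k → ‖g k‖ ≤ M * (1 + k ^ 2)⁻¹) (hC0 : 0 ≤ C)
    (hC : ∀ (k : ℝ) (x : Space), 0 < k → x ≠ 0 → ‖sphericalWave k l m x‖ ≤ C * ‖x‖⁻¹)
    (S : Set ℝ) {x : Space} (hx : x ≠ 0) :
    ‖∫ k in Ioi (0 : ℝ), S.indicator (fun k => sphericalWave k l m x * g k) k‖ ≤
      (C * ∫ k in Ioi (0 : ℝ), M * (1 + k ^ 2)⁻¹) * ‖x‖⁻¹ := by
  refine (norm_integral_le_of_norm_le (integrableOn_amplitude_bound (C * ‖x‖⁻¹) M) ?_).trans ?_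
  · filter_upwards [ae_restrict_mem measurableSet_Ioi] with k hk
    exact norm_indicator_wave_le hM hC0 hC S hx hk
  · rw [integral_const_mul]
    exact le_of_eq (by ring)

theorem stronglyMeasurable_integral_indicator_wave (hg : Measurable g) {S : Set ℝ}
    (hS : MeasurableSet S) : StronglyMeasurable fun x : Space =>
      ∫ k in Ioi (0 : ℝ), S.indicator (fun k => sphericalWave k l m x * g k) k := by
  refine StronglyMeasurable.integral_prod_right' (f := fun p : Space × ℝ =>
    S.indicator (fun k => sphericalWave k l m p.1 * g k) p.2) ?_
  have h1 : Measurable fun p : Space × ℝ => sphericalWave p.2 l m p.1 * g p.2 :=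
    ((measurable_sphericalWave l m).comp measurable_swap).mul (hg.comp measurable_snd)
  have h2 : (fun p : Space × ℝ => S.indicator (fun k => sphericalWave k l m p.1 * g k) p.2) =
      (Prod.snd ⁻¹' S).indicator fun p : Space × ℝ => sphericalWave p.2 l m p.1 * g p.2 := by
    ext p
    rfl
  rw [h2]
  exact (h1.indicator (measurable_snd hS)).stronglyMeasurable

theorem tendsto_indicator_exhaustion {E : Type*} [NormedAddCommGroup E] {c r : ℝ} (hc : 0 < c)
    (hr : 0 < r) (f : ℝ → E) : ∀ᶠ n : ℕ in atTop,
      (Icc (c * (1 / ((n : ℝ) + 1))) (c * ((n : ℝ) + 1))).indicator f r = f r := by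
  have h1 : Tendsto (fun n : ℕ => c * (1 / ((n : ℝ) + 1))) atTop (𝓝 (c * 0)) :=
    tendsto_one_div_add_atTop_nhds_zero_nat.const_mul c
  have h2 : Tendsto (fun n : ℕ => c * ((n : ℝ) + 1)) atTop atTop :=
    (tendsto_atTop_add_const_right _ _ tendsto_natCast_atTop_atTop).const_mul_atTop hc
  rw [mul_zero] at h1
  filter_upwards [h1.eventually (eventually_lt_nhds hr), h2.eventually_ge_atTop r] with n h3 h4
  exact indicator_of_mem (mem_Icc.mpr ⟨h3.le, h4⟩) f

theorem locallyIntegrable_waveSuperposition (hg : Measurable g)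
    (hM : ∀ k, 0 < k → ‖g k‖ ≤ M * (1 + k ^ 2)⁻¹) :
    LocallyIntegrable (waveSuperposition l m g) := by
  obtain ⟨C, hC0, hC⟩ := exists_sphericalWave_bound l m
  have hm := stronglyMeasurable_integral_indicator_wave (l := l) (m := m) hg MeasurableSet.univ
  simp only [indicator_univ] at hm
  refine (locallyIntegrable_inv_norm.smul (C * ∫ k in Ioi (0 : ℝ), M * (1 + k ^ 2)⁻¹)).mono
    hm.aestronglyMeasurable ?_
  filter_upwards [ae_plane_ne_zero] with x hx
  have hx0 : x ≠ 0 := by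
    rintro rfl
    simp at hx
  have := norm_integral_indicator_wave_le hM hC0 hC univ hx0
  simp only [indicator_univ] at this
  exact this.trans (le_abs_self _)

/-- The available bound on the symbol decays only like `|p|⁻³`, which does not give integrability,
so the duality formula is used on growing shells. Dominated convergence then applies with majorant
`|f(x)|/|x|` up to a constant on one side, and a product of two square integrable functions on the
other. -/
theorem integral_mul_waveSuperposition (hg : Measurable g) (hM0 : 0 ≤ M)
    (hM : ∀ k, 0 < k → ‖g k‖ ≤ M * (1 + k ^ 2)⁻¹) (f : 𝓢(Space, ℂ))
    (hf : HasCompactSupport f) :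
    ∫ x, f x * waveSuperposition l m g x =
      ∫ p, (𝓕⁻ f : 𝓢(Space, ℂ)) p * waveSymbol l m g p := by
  obtain ⟨C, hC0, hC⟩ := exists_sphericalWave_bound l m
  have hV := memLp_waveSymbol l m hg hM0 hM
  have hpi : 0 < 2 * Real.pi := by positivity
  set S : ℕ → Set ℝ := fun n => Icc (2 * Real.pi * (1 / ((n : ℝ) + 1)))
    (2 * Real.pi * ((n : ℝ) + 1)) with hS
  set T : ℕ → Set ℝ := fun n => Icc (1 / ((n : ℝ) + 1)) ((n : ℝ) + 1) with hT
  set W : ℕ → Space → ℂ := fun n x =>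
    ∫ k in Ioi (0 : ℝ), (S n).indicator (fun k => sphericalWave k l m x * g k) k with hW
  have hSm : ∀ n, MeasurableSet (S n) := fun n => measurableSet_Icc
  have hTm : ∀ n, MeasurableSet {p : Space | ‖p‖ ∈ T n} :=
    fun n => measurable_norm measurableSet_Icc
  have hne : ∀ᵐ x : Space, x ≠ 0 := by
    filter_upwards [ae_plane_ne_zero] with x hx
    rintro rfl
    simp at hx
  have heq : ∀ n, ∫ x, f x * W n x =
      ∫ p, (𝓕⁻ f : 𝓢(Space, ℂ)) p * {p : Space | ‖p‖ ∈ T n}.indicator (waveSymbol l m g) p := by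
    intro n
    have hi : Integrable ({p : Space | ‖p‖ ∈ T n}.indicator (waveSymbol l m g)) := by
      rw [integrable_indicator_iff (hTm n)]
      have hfin : volume {p : Space | ‖p‖ ∈ T n} < ⊤ := by
        refine (measure_mono fun p hp => ?_).trans_lt
          (isCompact_closedBall (0 : Space) ((n : ℝ) + 1)).measure_lt_top
        exact mem_closedBall_zero_iff.mpr hp.2
      have : IsFiniteMeasure (volume.restrict {p : Space | ‖p‖ ∈ T n}) := ⟨by simpa using hfin⟩
      exact (hV.restrict _).integrable (by norm_num)
    rw [← integral_mul_fourierInv f hi]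
    refine integral_congr_ae ?_
    filter_upwards [ae_plane_ne_zero] with x hx
    rw [fourierInv_indicator_waveSymbol l m hg hM0 hM (by positivity) hx]
  have hWlim : ∀ x : Space, x ≠ 0 → Tendsto (fun n => W n x) atTop
      (𝓝 (waveSuperposition l m g x)) := by
    intro x hx
    refine tendsto_integral_of_dominated_convergence (fun k => C * ‖x‖⁻¹ * (M * (1 + k ^ 2)⁻¹))
      (fun n => ?_) (integrableOn_amplitude_bound _ M) (fun n => ?_) ?_
    · have h1 : Measurable fun k => sphericalWave k l m x * g k :=
        (measurable_sphericalWave_left l m x).mul hg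
      exact (h1.indicator (hSm n)).aestronglyMeasurable
    · filter_upwards [ae_restrict_mem measurableSet_Ioi] with k hk
      exact norm_indicator_wave_le hM hC0 hC _ hx hk
    · filter_upwards [ae_restrict_mem measurableSet_Ioi] with k hk
      exact tendsto_const_nhds.congr' ((tendsto_indicator_exhaustion hpi hk _).mono
        fun n hn => hn.symm)
  have hlim1 : Tendsto (fun n => ∫ x, f x * W n x) atTop
      (𝓝 (∫ x, f x * waveSuperposition l m g x)) := by
    set D := C * ∫ k in Ioi (0 : ℝ), M * (1 + k ^ 2)⁻¹ with hD
    have hb : Integrable fun x : Space => ‖f x‖ • (D * ‖x‖⁻¹) :=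
      (locallyIntegrable_inv_norm.smul D).integrable_smul_left_of_hasCompactSupport
        f.continuous.norm hf.norm
    refine tendsto_integral_of_dominated_convergence (fun x => ‖f x‖ • (D * ‖x‖⁻¹))
      (fun n => ?_) hb (fun n => ?_) ?_
    · exact f.continuous.aestronglyMeasurable.mul
        (stronglyMeasurable_integral_indicator_wave hg (hSm n)).aestronglyMeasurable
    · filter_upwards [hne] with x hx
      rw [norm_mul, smul_eq_mul]
      gcongr
      exact norm_integral_indicator_wave_le hM hC0 hC _ hx
    · filter_upwards [hne] with x hx
      exact (hWlim x hx).const_mul _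
  have hlim2 : Tendsto (fun n => ∫ p, (𝓕⁻ f : 𝓢(Space, ℂ)) p *
      {p : Space | ‖p‖ ∈ T n}.indicator (waveSymbol l m g) p) atTop
      (𝓝 (∫ p, (𝓕⁻ f : 𝓢(Space, ℂ)) p * waveSymbol l m g p)) := by
    have hb : Integrable fun p => ‖(𝓕⁻ f : 𝓢(Space, ℂ)) p * waveSymbol l m g p‖ :=
      (((𝓕⁻ f : 𝓢(Space, ℂ)).memLp 2 volume).integrable_mul hV).norm
    refine tendsto_integral_of_dominated_convergence _ (fun n => ?_) hb (fun n => ?_) ?_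
    · exact (𝓕⁻ f : 𝓢(Space, ℂ)).continuous.aestronglyMeasurable.mul
        ((measurable_waveSymbol l m hg).indicator (hTm n)).aestronglyMeasurable
    · refine ae_of_all _ fun p => ?_
      rw [norm_mul, norm_mul]
      gcongr
      exact norm_indicator_le_norm_self _ _
    · filter_upwards [hne] with p hp
      refine Tendsto.const_mul _ (tendsto_const_nhds.congr' ?_)
      have := tendsto_indicator_exhaustion one_pos (norm_pos_iff.mpr hp)
        (fun _ => waveSymbol l m g p)
      filter_upwards [this] with n hn
      simp only [one_mul] at hn
      rw [← hn]
      simp only [indicator, mem_ofPred_eq, hT]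
  refine tendsto_nhds_unique hlim1 ?_
  simpa only [heq] using hlim2

/-- The `L²` inverse transform of the symbol and the pointwise superposition have the same pairing
with every test function, so they agree almost everywhere. -/
theorem exists_mem_sobolevOne_waveSuperposition (hg : Measurable g) (hM0 : 0 ≤ M)
    (hM : ∀ k, 0 < k → ‖g k‖ ≤ M * (1 + k ^ 2)⁻¹) :
    ∃ u : L2, u ∈ sobolevOne ∧ (u : Space → ℂ) =ᵐ[volume] waveSuperposition l m g := by
  have hV := memLp_waveSymbol l m hg hM0 hM
  set v : L2 := hV.toLp _ with hv
  have hva : (v : Space → ℂ) =ᵐ[volume] waveSymbol l m g := hV.coeFn_toLp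
  refine ⟨(𝓕⁻ v : L2), ?_, ?_⟩
  · rw [mem_sobolevOne, memH_iff, fourier_fourierInv_eq]
    refine (memLp_congr_ae ?_).mp (memLp_japanese_mul_waveSymbol l m hg hM0 hM)
    filter_upwards [hva] with p hp
    rw [hp]
  · apply ae_eq_of_integral_contDiff_smul_eq
    · exact (Lp.memLp _).locallyIntegrable (by norm_num)
    · exact locallyIntegrable_waveSuperposition hg hM
    · intro φ hφ hc
      have hg₁ : HasCompactSupport (Complex.ofRealCLM ∘ φ) := hc.comp_left rfl
      have hg₂ : ContDiff ℝ ((⊤ : ℕ∞) : WithTop ℕ∞) (Complex.ofRealCLM ∘ φ) := by fun_prop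
      set f : 𝓢(Space, ℂ) := hg₁.toSchwartzMap hg₂ with hf
      have hfx : ∀ x, f x = (φ x : ℂ) := fun x => rfl
      have h1 : ((𝓕⁻ v : L2) : 𝓢'(Space, ℂ)) f = (v : 𝓢'(Space, ℂ)) (𝓕⁻ f) := by
        rw [← Lp.fourierInv_toTemperedDistribution_eq, TemperedDistribution.fourierInv_apply]
      rw [Lp.toTemperedDistribution_apply, Lp.toTemperedDistribution_apply] at h1
      have h2 := integral_mul_waveSuperposition (l := l) (m := m) hg hM0 hM f hg₁
      simp only [hfx, smul_eq_mul, Complex.real_smul] at h1 h2 ⊢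
      rw [h1, h2]
      refine integral_congr_ae ?_
      filter_upwards [hva] with p hp
      rw [hp]

end Superposition

/-! ### The potential of a density on the blade -/

theorem norm_bladePoint_sq (p : ℝ × ℝ) : ‖bladePoint p‖ ^ 2 = p.1 ^ 2 := by
  rw [norm_sq_coord]
  simp only [bladePoint, PiLp.toLp_apply, Matrix.cons_val]
  linear_combination p.1 ^ 2 * Real.sin_sq_add_cos_sq p.2

theorem ae_bladeMeasure_ne_zero (A : ℝ) : ∀ᵐ x ∂(bladeMeasure A), x ≠ 0 := by
  have h : bladeMeasure A {0} = 0 := by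
    rw [← lintegral_indicator_one (measurableSet_singleton 0),
      lintegral_bladeMeasure A (measurable_one.indicator (measurableSet_singleton 0))]
    refine (lintegral_congr fun p => ?_).trans lintegral_zero
    by_cases hp : bladePoint p = 0
    · have := norm_bladePoint_sq p
      rw [hp, norm_zero] at this
      simp [← this]
    · simp [hp]
  filter_upwards [measure_eq_zero_iff_ae_notMem.mp h] with x hx
  simpa using hx

/-- The factor `r²` of the blade measure cancels `|x|⁻²`, leaving `sin θ ≤ 1` on a compact
rectangle. -/
theorem memLp_inv_norm_blade (A : ℝ) :
    MemLp (fun x : Space => ‖x‖⁻¹) 2 (bladeMeasure A) := by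
  have hm : Measurable fun x : Space => ‖x‖⁻¹ := by fun_prop
  rw [memLp_two_iff_integrable_sq_norm hm.aestronglyMeasurable]
  refine ⟨(hm.norm.pow_const 2).aestronglyMeasurable, ?_⟩
  rw [HasFiniteIntegral, lintegral_bladeMeasure A (by fun_prop)]
  calc _ ≤ ∫⁻ _ in Icc 0 A ×ˢ Icc 0 Real.pi, (1 : ℝ≥0∞) := by
        refine setLIntegral_mono measurable_const fun p hp => ?_
        rw [Real.enorm_of_nonneg (by positivity), norm_inv, norm_norm, inv_pow,
          norm_bladePoint_sq,
          ← ENNReal.ofReal_mul (mul_nonneg (sq_nonneg _)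
            (Real.sin_nonneg_of_nonneg_of_le_pi hp.2.1 hp.2.2)), ← ENNReal.ofReal_one]
        apply ENNReal.ofReal_le_ofReal
        rcases eq_or_ne p.1 0 with h | h
        · simp [h]
        · calc _ = Real.sin p.2 := by field_simp
            _ ≤ 1 := Real.sin_le_one _
    _ < ⊤ := by
        rw [setLIntegral_one]
        exact (isCompact_Icc.prod isCompact_Icc).measure_lt_top

theorem integrable_inv_norm_mul_blade {A : ℝ} (ξ : BladeL2 A) :
    Integrable (fun x => ‖x‖⁻¹ * ‖ξ x‖) (bladeMeasure A) :=
  (memLp_inv_norm_blade A).integrable_mul (Lp.memLp ξ).norm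

/-- `1 + k² ≤ |1 + ζ| + |k² - ζ|`, and `|k² - ζ| ≥ |Im ζ|` lets the first term be absorbed into a
multiple of the second. -/
theorem exists_resolvent_bound {ζ : ℂ} (hζ : ζ.im ≠ 0) :
    ∃ C, 0 ≤ C ∧ ∀ k : ℝ, ‖((k : ℂ) ^ 2 - ζ)⁻¹‖ ≤ C * (1 + k ^ 2)⁻¹ := by
  refine ⟨‖1 + ζ‖ / |ζ.im| + 1, by positivity, fun k => ?_⟩
  have him : |ζ.im| ≤ ‖(k : ℂ) ^ 2 - ζ‖ := by
    have := Complex.abs_im_le_norm ((k : ℂ) ^ 2 - ζ)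
    rw [Complex.sub_im, ← Complex.ofReal_pow, Complex.ofReal_im, zero_sub, abs_neg] at this
    exact_mod_cast this
  have hpos : 0 < |ζ.im| := abs_pos.mpr hζ
  have hd : 0 < ‖(k : ℂ) ^ 2 - ζ‖ := hpos.trans_le him
  have h1 : 1 + k ^ 2 ≤ ‖1 + ζ‖ + ‖(k : ℂ) ^ 2 - ζ‖ := by
    have h2 : ‖((1 + k ^ 2 : ℝ) : ℂ)‖ = 1 + k ^ 2 := by
      rw [Complex.norm_real, Real.norm_of_nonneg (by positivity)]
    rw [← h2]
    refine (le_of_eq ?_).trans (norm_add_le _ _)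
    congr 1
    push_cast
    ring
  rw [norm_inv, ← div_eq_mul_inv, le_div_iff₀ (by positivity), inv_mul_le_iff₀ hd]
  calc 1 + k ^ 2 ≤ ‖1 + ζ‖ + ‖(k : ℂ) ^ 2 - ζ‖ := h1
    _ ≤ ‖1 + ζ‖ * (‖(k : ℂ) ^ 2 - ζ‖ / |ζ.im|) + ‖(k : ℂ) ^ 2 - ζ‖ := by
        gcongr
        exact le_mul_of_one_le_right (norm_nonneg _) ((one_le_div hpos).mpr him)
    _ = _ := by ring

/-- The amplitude of the wave `φ_{klm}` in the density `ξ`. -/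
def waveCoefficient {A : ℝ} (l : ℕ) (m : ℤ) (ξ : BladeL2 A) (k : ℝ) : ℂ :=
  ∫ x, star (sphericalWave k l m x) * ξ x ∂(bladeMeasure A)

theorem measurable_waveCoefficient {A : ℝ} (l : ℕ) (m : ℤ) (ξ : BladeL2 A) :
    Measurable (waveCoefficient l m ξ) := by
  have h : StronglyMeasurable (waveCoefficient l m ξ) := by
    refine StronglyMeasurable.integral_prod_right' (f := fun p : ℝ × Space =>
      star (sphericalWave p.1 l m p.2) * ξ p.2) ?_
    exact ((continuous_star.measurable.comp (measurable_sphericalWave l m)).mul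
      ((Lp.stronglyMeasurable ξ).measurable.comp measurable_snd)).stronglyMeasurable
  exact h.measurable

/-- The waves are at most `C/|x|` for all `k > 0`, and `1/|x|` pairs with a square integrable
density by Cauchy–Schwarz. -/
theorem exists_waveCoefficient_bound {A : ℝ} (l : ℕ) (m : ℤ) (ξ : BladeL2 A) :
    ∃ C, 0 ≤ C ∧ ∀ k, 0 < k → ‖waveCoefficient l m ξ k‖ ≤ C := by
  obtain ⟨C, hC0, hC⟩ := exists_sphericalWave_bound l m
  refine ⟨∫ x, C * (‖x‖⁻¹ * ‖ξ x‖) ∂(bladeMeasure A),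
    integral_nonneg fun x => by positivity, fun k hk => ?_⟩
  refine norm_integral_le_of_norm_le ((integrable_inv_norm_mul_blade ξ).const_mul C) ?_
  filter_upwards [ae_bladeMeasure_ne_zero A] with x hx
  rw [norm_mul, norm_star, ← mul_assoc]
  gcongr
  exact hC k x hk hx

section Potential

variable {A : ℝ} (l : ℕ) (m : ℤ) {ζ : ℂ} (ξ : BladeL2 A) {x : Space}

theorem integrable_kernel (hζ : ζ.im ≠ 0) {x x' : Space} (hx : x ≠ 0) (hx' : x' ≠ 0) :
    IntegrableOn (fun k : ℝ => star (sphericalWave k l m x') * sphericalWave k l m x /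
      ((k : ℂ) ^ 2 - ζ)) (Ioi 0) := by
  obtain ⟨C, hC0, hC⟩ := exists_sphericalWave_bound l m
  obtain ⟨M, hM0, hM⟩ := exists_resolvent_bound hζ
  have hw := measurable_sphericalWave_left l m
  have h1 : Measurable fun k : ℝ => star (sphericalWave k l m x') * sphericalWave k l m x /
      ((k : ℂ) ^ 2 - ζ) :=
    ((continuous_star.measurable.comp (hw x')).mul (hw x)).div (by fun_prop)
  refine (integrableOn_amplitude_bound (C * ‖x'‖⁻¹ * (C * ‖x‖⁻¹)) M).mono'
    h1.aestronglyMeasurable ?_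
  filter_upwards [ae_restrict_mem measurableSet_Ioi] with k hk
  rw [div_eq_mul_inv, norm_mul, norm_mul, norm_star]
  have h2 := hC k x hk hx
  have h3 := hC k x' hk hx'
  have h4 := hM k
  gcongr

/-- The majorant factors into `|x'|⁻¹ |ξ(x')|`, integrable on the blade, and a constant times
`(1+k²)⁻¹`; this justifies exchanging the two integrals. -/
theorem integrable_kernel_mul (hζ : ζ.im ≠ 0) (hx : x ≠ 0) :
    Integrable (fun p : Space × ℝ => star (sphericalWave p.2 l m p.1) * sphericalWave p.2 l m x /
      ((p.2 : ℂ) ^ 2 - ζ) * ξ p.1) ((bladeMeasure A).prod (volume.restrict (Ioi 0))) := by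
  obtain ⟨C, hC0, hC⟩ := exists_sphericalWave_bound l m
  obtain ⟨M, hM0, hM⟩ := exists_resolvent_bound hζ
  have hw : Measurable fun p : Space × ℝ => sphericalWave p.2 l m p.1 := by
    have := measurable_sphericalWave l m
    fun_prop
  have hw' : Measurable fun p : Space × ℝ => sphericalWave p.2 l m x :=
    (measurable_sphericalWave_left l m x).comp measurable_snd
  have h1 : Measurable fun p : Space × ℝ => star (sphericalWave p.2 l m p.1) *
      sphericalWave p.2 l m x / ((p.2 : ℂ) ^ 2 - ζ) * ξ p.1 :=
    (((continuous_star.measurable.comp hw).mul hw').div (by fun_prop)).mul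
      ((Lp.stronglyMeasurable ξ).measurable.comp measurable_fst)
  refine ((integrable_inv_norm_mul_blade ξ).mul_prod
    (integrableOn_amplitude_bound (C * (C * ‖x‖⁻¹)) M)).mono' h1.aestronglyMeasurable ?_
  have h2 : ∀ᵐ p : Space × ℝ ∂((bladeMeasure A).prod (volume.restrict (Ioi 0))), p.1 ≠ 0 :=
    Measure.quasiMeasurePreserving_fst.ae (ae_bladeMeasure_ne_zero A)
  have h3 : ∀ᵐ p : Space × ℝ ∂((bladeMeasure A).prod (volume.restrict (Ioi 0))), p.2 ∈ Ioi (0 : ℝ) :=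
    Measure.quasiMeasurePreserving_snd.ae (ae_restrict_mem measurableSet_Ioi)
  filter_upwards [h2, h3] with p hp hk
  rw [div_eq_mul_inv, norm_mul, norm_mul, norm_mul, norm_star]
  have h4 := hC p.2 x hk hx
  have h5 := hC p.2 p.1 hk hp
  have h6 := hM p.2
  calc _ ≤ C * ‖p.1‖⁻¹ * (C * ‖x‖⁻¹) * (M * (1 + p.2 ^ 2)⁻¹) * ‖ξ p.1‖ := by gcongr
    _ = _ := by ring

theorem integral_kernel_mul (hζ : ζ.im ≠ 0) (hx : x ≠ 0) :
    ∫ x', (∫ k in Ioi (0 : ℝ), star (sphericalWave k l m x') * sphericalWave k l m x /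
      ((k : ℂ) ^ 2 - ζ)) * ξ x' ∂(bladeMeasure A) =
      waveSuperposition l m (fun k => waveCoefficient l m ξ k * ((k : ℂ) ^ 2 - ζ)⁻¹) x := by
  simp only [← integral_mul_const]
  rw [integral_integral_swap (integrable_kernel_mul l m ξ hζ hx), waveSuperposition]
  refine integral_congr_ae (ae_of_all _ fun k => ?_)
  simp only [waveCoefficient]
  rw [← integral_mul_const, ← integral_const_mul]
  refine integral_congr_ae (ae_of_all _ fun x' => ?_)
  simp only [div_eq_mul_inv]
  ring

end Potential

theorem bladePotential_eq {A : ℝ} (ω : ℝ) (L : ℕ) {z : ℂ} (hz : z.im ≠ 0) (ξ : BladeL2 A)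
    {x : Space} (hx : x ≠ 0) : bladePotential A ω L z ξ x =
      ∑ l ∈ Finset.range (L + 1), ∑ m ∈ Finset.Icc (-(l : ℤ)) l,
        waveSuperposition l m
          (fun k => waveCoefficient l m ξ k * ((k : ℂ) ^ 2 - (m * ω + z))⁻¹) x := by
  -- The shift `mω` is real, so every denominator keeps the imaginary part of `z`.
  have him : ∀ m : ℤ, ((m : ℂ) * ω + z).im ≠ 0 := by
    intro m
    simpa using hz
  have hker : ∀ x' : Space, x' ≠ 0 → cutoffGreen ω L z x x' * ξ x' =
      ∑ l ∈ Finset.range (L + 1), ∑ m ∈ Finset.Icc (-(l : ℤ)) l,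
        (∫ k in Ioi (0 : ℝ), star (sphericalWave k l m x') * sphericalWave k l m x /
          ((k : ℂ) ^ 2 - (m * ω + z))) * ξ x' := by
    intro x' hx'
    rw [cutoffGreen]
    simp only [sub_sub]
    rw [integral_finsetSum _ fun l _ => integrable_finsetSum _ fun m _ =>
      integrable_kernel l m (him m) hx hx', Finset.sum_mul]
    refine Finset.sum_congr rfl fun l _ => ?_
    rw [integral_finsetSum _ fun m _ => integrable_kernel l m (him m) hx hx', Finset.sum_mul]
  have hint : ∀ (l : ℕ) (m : ℤ), Integrable (fun x' => (∫ k in Ioi (0 : ℝ),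
      star (sphericalWave k l m x') * sphericalWave k l m x /
        ((k : ℂ) ^ 2 - (m * ω + z))) * ξ x') (bladeMeasure A) := by
    intro l m
    have := (integrable_kernel_mul l m ξ (him m) hx).integral_prod_left
    simpa only [integral_mul_const] using this
  rw [bladePotential]
  have h1 : ∫ x', cutoffGreen ω L z x x' * ξ x' ∂(bladeMeasure A) =
      ∫ x', ∑ l ∈ Finset.range (L + 1), ∑ m ∈ Finset.Icc (-(l : ℤ)) l,
        (∫ k in Ioi (0 : ℝ), star (sphericalWave k l m x') * sphericalWave k l m x /
          ((k : ℂ) ^ 2 - (m * ω + z))) * ξ x' ∂(bladeMeasure A) := by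
    refine integral_congr_ae ?_
    filter_upwards [ae_bladeMeasure_ne_zero A] with x' hx' using hker x' hx'
  rw [h1, integral_finsetSum _ fun l _ => integrable_finsetSum _ fun m _ => hint l m]
  refine Finset.sum_congr rfl fun l _ => ?_
  rw [integral_finsetSum _ fun m _ => hint l m]
  exact Finset.sum_congr rfl fun m _ => integral_kernel_mul l m ξ (him m) hx

/-- The potential of a square integrable density on the blade is in `H¹`. -/
theorem exists_mem_sobolevOne_bladePotential {A : ℝ} (ω : ℝ) (L : ℕ) {z : ℂ} (hz : z.im ≠ 0)
    (ξ : BladeL2 A) :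
    ∃ u : L2, u ∈ sobolevOne ∧ (u : Space → ℂ) =ᵐ[volume] bladePotential A ω L z ξ := by
  have h : ∀ (l : ℕ) (m : ℤ), ∃ u : L2, u ∈ sobolevOne ∧ (u : Space → ℂ) =ᵐ[volume]
      waveSuperposition l m
        (fun k => waveCoefficient l m ξ k * ((k : ℂ) ^ 2 - (m * ω + z))⁻¹) := by
    intro l m
    have him : ((m : ℂ) * ω + z).im ≠ 0 := by simpa using hz
    obtain ⟨C, hC0, hC⟩ := exists_waveCoefficient_bound l m ξ
    obtain ⟨M, hM0, hM⟩ := exists_resolvent_bound him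
    refine exists_mem_sobolevOne_waveSuperposition
      ((measurable_waveCoefficient l m ξ).mul (by fun_prop)) (mul_nonneg hC0 hM0) fun k hk => ?_
    rw [norm_mul, mul_assoc]
    exact mul_le_mul (hC k hk) (hM k) (norm_nonneg _) hC0
  choose u hu huw using h
  refine ⟨∑ l ∈ Finset.range (L + 1), ∑ m ∈ Finset.Icc (-(l : ℤ)) l, u l m,
    Submodule.sum_mem _ fun l _ => Submodule.sum_mem _ fun m _ => hu l m, ?_⟩
  have h1 : ∀ᵐ x : Space, ∀ (l : ℕ) (m : ℤ), u l m x = waveSuperposition l m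
      (fun k => waveCoefficient l m ξ k * ((k : ℂ) ^ 2 - (m * ω + z))⁻¹) x :=
    ae_all_iff.mpr fun l => ae_all_iff.mpr fun m => huw l m
  have h2 : ∀ᵐ x : Space, ∀ l : ℕ, (∑ m ∈ Finset.Icc (-(l : ℤ)) l, u l m : L2) x =
      ∑ m ∈ Finset.Icc (-(l : ℤ)) l, u l m x :=
    ae_all_iff.mpr fun l => Lp.coeFn_fun_finsetSum _ _
  filter_upwards [h1, h2, ae_plane_ne_zero, Lp.coeFn_fun_finsetSum (Finset.range (L + 1))
    fun l => ∑ m ∈ Finset.Icc (-(l : ℤ)) l, u l m] with x h3 h4 h5 h6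
  have hx0 : x ≠ 0 := by
    rintro rfl
    simp at h5
  rw [h6, bladePotential_eq ω L hz ξ hx0]
  simp only [h4, h3]

end RotatingBlade

end

/-! ### The form of the rotating blade -/

theorem mainTheorem9 (A : ℝ) (hA : 0 < A) (ω : ℝ) (L : ℕ) (α : Space → ℝ)
    (hα : MemLp α ∞ (bladeMeasure A)) :
    ∃ q : HermitianForm L2,
      (∀ (Ψ : L2) (v : ℝ),
        IsBladeFormValue A ω L α Ψ v ↔ ∃ h : Ψ ∈ q.dom, v = q.quad ⟨Ψ, h⟩) ∧
      q.IsBoundedBelow ∧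
      q.IsClosed ∧
      ∀ z : ℂ, z.im ≠ 0 →
        (q.dom : Set L2) = {Ψ : L2 | ∃ (ξ : BladeL2 A) (φ : L2), MemH 1 φ ∧
          (φ : Space → ℂ) =ᵐ[volume] fun x => Ψ x - bladePotential A ω L z ξ x} := by
  refine ⟨bladeForm hA.le ω L hα, isBladeFormValue_iff hA.le ω L hα,
    bladeForm_isBoundedBelow hA.le ω L hα, bladeForm_isClosed hA.le ω L hα, fun z hz => ?_⟩
  have hdom : (bladeForm hA.le ω L hα).dom = sobolevOne := rfl
  rw [hdom]
  ext Ψ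
  constructor
  · intro hΨ
    -- The density `ξ = 0` already represents every element of `H¹`.
    refine ⟨0, Ψ, hΨ, ae_of_all _ fun x => ?_⟩
    have h0 : bladePotential A ω L z 0 x = 0 := by
      refine integral_eq_zero_of_ae ?_
      filter_upwards [Lp.coeFn_zero ℂ 2 (bladeMeasure A)] with x' hx'
      rw [hx', Pi.zero_apply, mul_zero]
    simp only [h0, sub_zero]
  · rintro ⟨ξ, φ, hφ, hφΨ⟩
    -- Since the potential of `ξ` is itself in `H¹`, adding it back does not leave `H¹`.
    obtain ⟨u, hu, hua⟩ := exists_mem_sobolevOne_bladePotential ω L hz ξ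
    have h : Ψ = φ + u := by
      refine Lp.ext ?_
      filter_upwards [hφΨ, hua, Lp.coeFn_add φ u] with x h1 h2 h3
      rw [h3, Pi.add_apply, h1, h2, sub_add_cancel]
    rw [h]
    exact sobolevOne.add_mem hφ hu
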